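/- Let $M\ge 1$, let $m_1,\dots,m_M\in\mathbb{Z}_{\ge 1}$, put $N=m_1+\dots+m_M$, and let $t_1,\dots,t_M\in\mathbb{C}$ be such that $0,1,t_1,\dots,t_M$ are mutually distinct. For $\gamma,\delta,s_0,\dots,s_M\in\mathbb{C}$ set $$\tilde L=\frac{d^2}{dz^2}+\Bigl(\frac{\gamma}{z}+\frac{\delta}{z-1}-\sum_{k=1}^M\frac{m_k}{z-t_k}\Bigr)\frac{d}{dz}+\frac{s_Mz^M+\dots+s_0}{z(z-1)(z-t_1)\cdots(z-t_M)}.$$ Assume that each singularity $z=t_k$ of $\tilde L y=0$ (whose exponents are $0$ and $m_k+1$) is apparent, i.e. the equation has a basis of local solutions $f(z)=\sum_{j\ge0}c_j(z-t_k)^j$, $c_0\ne0$, and $g(z)=(z-t_k)^{m_k+1}\sum_{j\ge0}c'_j(z-t_k)^j$, $c'_0\neq 0$, so that no logarithmic term occurs. Assume moreover that one of the following holds: (i) $M=1$ and $m_1\le5$; (ii) $M=2$ and $m_1+m_2\le4$; (iii) $M=3$ and $m_1=m_2=m_3=1$. For $a_1,\dots,a_{q+1},b_1,\dots,b_q\in\mathbb{C}$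 let $L_{a_1,\dots,a_{q+1};b_1,\dots,b_q}$ be the monic generalized hypergeometric differential operator of order $q+1$, that is, $\frac{1}{z^q(1-z)}$ times $$\frac{d}{dz}\Bigl(z\frac{d}{dz}+b_1-1\Bigr)\cdots\Bigl(z\frac{d}{dz}+b_q-1\Bigr)-\Bigl(z\frac{d}{dz}+a_1\Bigr)\cdots\Bigl(z\frac{d}{dz}+a_{q+1}\Bigr).$$ Then there exist $\alpha,\beta\in\mathbb{C}$ with $s_M=\alpha\beta$ and $\delta=\alpha+\beta-\gamma+N+1$, numbers $e_1,\dots,e_N\in\mathbb{C}$, and a differential operator $\tilde D$ of order $N$ with rational function coefficients such that $$L_{\alpha,\beta,e_1+1,\dots,e_N+1;\gamma,e_1,\dots,e_N}=\tilde D\,\tilde L .$$ -/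

import Mathlib

open Filter Topology Polynomial

noncomputable section

namespace Fuchsian

/-! ### The derivation `d/dz` on the field `ℂ(z)` of rational functions -/

/-- The quotient rule, on the numerator and denominator in lowest terms. -/
def ratDerivFun (f : RatFunc ℂ) : RatFunc ℂ :=
  (algebraMap ℂ[X] (RatFunc ℂ) (derivative f.num) * algebraMap ℂ[X] (RatFunc ℂ) f.denom
      - algebraMap ℂ[X] (RatFunc ℂ) f.num * algebraMap ℂ[X] (RatFunc ℂ) (derivative f.denom))
    / algebraMap ℂ[X] (RatFunc ℂ) f.denom ^ 2

/-- The quotient rule holds for every representation of a rational function as a fraction. -/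
theorem ratDerivFun_div (p q : ℂ[X]) (hq : q ≠ 0) :
    ratDerivFun (algebraMap ℂ[X] (RatFunc ℂ) p / algebraMap ℂ[X] (RatFunc ℂ) q) =
      (algebraMap ℂ[X] (RatFunc ℂ) (derivative p) * algebraMap ℂ[X] (RatFunc ℂ) q
        - algebraMap ℂ[X] (RatFunc ℂ) p * algebraMap ℂ[X] (RatFunc ℂ) (derivative q))
      / algebraMap ℂ[X] (RatFunc ℂ) q ^ 2 := by
  set f : RatFunc ℂ := algebraMap ℂ[X] (RatFunc ℂ) p / algebraMap ℂ[X] (RatFunc ℂ) q with hf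
  have hq' : algebraMap ℂ[X] (RatFunc ℂ) q ≠ 0 := RatFunc.algebraMap_ne_zero hq
  have hd' : algebraMap ℂ[X] (RatFunc ℂ) f.denom ≠ 0 :=
    RatFunc.algebraMap_ne_zero f.denom_ne_zero
  have h1 : f.num * q = p * f.denom := by
    apply RatFunc.algebraMap_injective ℂ
    have h2 : algebraMap ℂ[X] (RatFunc ℂ) f.num / algebraMap ℂ[X] (RatFunc ℂ) f.denom
        = algebraMap ℂ[X] (RatFunc ℂ) p / algebraMap ℂ[X] (RatFunc ℂ) q := by
      rw [RatFunc.num_div_denom, hf]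
    rw [div_eq_div_iff hd' hq'] at h2
    simpa using h2
  have h3 := congrArg (fun r => algebraMap ℂ[X] (RatFunc ℂ) (derivative r)) h1
  have h4 := congrArg (fun r => algebraMap ℂ[X] (RatFunc ℂ) r) h1
  simp only [derivative_mul, map_add, map_mul] at h3 h4
  unfold ratDerivFun
  rw [div_eq_div_iff (pow_ne_zero 2 hd') (pow_ne_zero 2 hq')]
  linear_combination (algebraMap ℂ[X] (RatFunc ℂ) f.denom * algebraMap ℂ[X] (RatFunc ℂ) q) * h3
    - (algebraMap ℂ[X] (RatFunc ℂ) (derivative f.denom) * algebraMap ℂ[X] (RatFunc ℂ) q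
      + algebraMap ℂ[X] (RatFunc ℂ) f.denom * algebraMap ℂ[X] (RatFunc ℂ) (derivative q)) * h4

theorem ratDerivFun_add (f g : RatFunc ℂ) :
    ratDerivFun (f + g) = ratDerivFun f + ratDerivFun g := by
  induction f using RatFunc.induction_on with
  | f p q hq =>
  induction g using RatFunc.induction_on with
  | f r s hs =>
  have hq' : algebraMap ℂ[X] (RatFunc ℂ) q ≠ 0 := RatFunc.algebraMap_ne_zero hq
  have hs' : algebraMap ℂ[X] (RatFunc ℂ) s ≠ 0 := RatFunc.algebraMap_ne_zero hs
  rw [div_add_div _ _ hq' hs', ← map_mul, ← map_mul, ← map_mul, ← map_add,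
    ratDerivFun_div _ _ (mul_ne_zero hq hs), ratDerivFun_div _ _ hq, ratDerivFun_div _ _ hs]
  simp only [derivative_mul, map_add, map_mul]
  field_simp
  ring

theorem ratDerivFun_mul (f g : RatFunc ℂ) :
    ratDerivFun (f * g) = f * ratDerivFun g + g * ratDerivFun f := by
  induction f using RatFunc.induction_on with
  | f p q hq =>
  induction g using RatFunc.induction_on with
  | f r s hs =>
  have hq' : algebraMap ℂ[X] (RatFunc ℂ) q ≠ 0 := RatFunc.algebraMap_ne_zero hq
  have hs' : algebraMap ℂ[X] (RatFunc ℂ) s ≠ 0 := RatFunc.algebraMap_ne_zero hs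
  rw [div_mul_div_comm, ← map_mul, ← map_mul,
    ratDerivFun_div _ _ (mul_ne_zero hq hs), ratDerivFun_div _ _ hq, ratDerivFun_div _ _ hs]
  simp only [derivative_mul, map_add, map_mul]
  field_simp
  ring

theorem ratDerivFun_C (c : ℂ) : ratDerivFun (RatFunc.C c) = 0 := by
  have h := ratDerivFun_div (Polynomial.C c) 1 one_ne_zero
  simpa using h

/-- The operator `d/dz` on `ℂ(z)`. -/
def ddz : Module.End ℂ (RatFunc ℂ) where
  toFun := ratDerivFun
  map_add' := ratDerivFun_add
  map_smul' c f := by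
    rw [RatFunc.smul_eq_C_mul, ratDerivFun_mul, ratDerivFun_C]
    simp [RatFunc.smul_eq_C_mul]

/-! ### Differential operators with rational coefficients

A differential operator with coefficients in `ℂ(z)` is represented by its action on `ℂ(z)`.
The representation is faithful (a non-zero operator of order `n` cannot annihilate all of
`1, z, …, z ^ n`), and the product of operators is composition. -/

/-- Multiplication by a rational function, the differential operator of order zero. -/
def mulOp (f : RatFunc ℂ) : Module.End ℂ (RatFunc ℂ) := LinearMap.mulLeft ℂ f

/-- `D = v_n (d/dz)^n + ⋯ + v_1 (d/dz) + v_0` with rational `v_j` and `v_n ≠ 0`. -/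
def IsDiffOpOfOrder (n : ℕ) (D : Module.End ℂ (RatFunc ℂ)) : Prop :=
  ∃ v : Fin (n + 1) → RatFunc ℂ, v (Fin.last n) ≠ 0 ∧
    D = ∑ j : Fin (n + 1), mulOp (v j) * ddz ^ (j : ℕ)

/-- The Euler operator `z d/dz` plus the constant `c`. -/
def eulerAdd (c : ℂ) : Module.End ℂ (RatFunc ℂ) :=
  mulOp RatFunc.X * ddz + mulOp (RatFunc.C c)

/-- `d/dz (z d/dz + b_1 - 1) ⋯ (z d/dz + b_q - 1) - (z d/dz + a_1) ⋯ (z d/dz + a_p)`. -/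
def ghgRaw (a b : List ℂ) : Module.End ℂ (RatFunc ℂ) :=
  ddz * (b.map fun c => eulerAdd (c - 1)).prod - (a.map fun c => eulerAdd c).prod

/-- The monic generalized hypergeometric operator `L_{a_1, …, a_{q+1}; b_1, …, b_q}`. For
`p = q + 1` the leading coefficient of `ghgRaw a b` is `z ^ q - z ^ (q + 1) = z ^ q (1 - z)`. -/
def ghgOp (a b : List ℂ) : Module.End ℂ (RatFunc ℂ) :=
  mulOp ((RatFunc.X ^ b.length * (1 - RatFunc.X))⁻¹) * ghgRaw a b

/-- The operator `d²/dz² + P d/dz + Q`. -/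
def secondOrderOp (P Q : RatFunc ℂ) : Module.End ℂ (RatFunc ℂ) :=
  ddz ^ 2 + mulOp P * ddz + mulOp Q

/-- `γ / z + δ / (z - 1) - ∑ m_k / (z - t_k)`. -/
def coeffP {M : ℕ} (γ δ : ℂ) (m : Fin M → ℕ) (t : Fin M → ℂ) : RatFunc ℂ :=
  RatFunc.C γ / RatFunc.X + RatFunc.C δ / (RatFunc.X - 1)
    - ∑ k, (m k : RatFunc ℂ) / (RatFunc.X - RatFunc.C (t k))

/-- `(s_M z ^ M + ⋯ + s_0) / (z (z - 1) (z - t_1) ⋯ (z - t_M))`. -/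
def coeffQ {M : ℕ} (s : Fin (M + 1) → ℂ) (t : Fin M → ℂ) : RatFunc ℂ :=
  (∑ i : Fin (M + 1), RatFunc.C (s i) * RatFunc.X ^ (i : ℕ))
    / (RatFunc.X * (RatFunc.X - 1) * ∏ k, (RatFunc.X - RatFunc.C (t k)))

/-! ### Apparent singularities -/

/-- `y'' + P y' + Q y = 0` on a punctured neighbourhood of `t`. -/
def SolvesNear (P Q : RatFunc ℂ) (t : ℂ) (y : ℂ → ℂ) : Prop :=
  ∀ᶠ z in 𝓝[≠] t, deriv (deriv y) z + P.eval (RingHom.id ℂ) z * deriv y z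
    + Q.eval (RingHom.id ℂ) z * y z = 0

/-- The singularity `t`, with exponents `0` and `m + 1`, of `y'' + P y' + Q y = 0` is apparent:
there is a basis of local solutions `f = ∑ c_j (z - t) ^ j` with `c_0 ≠ 0`, free of a
logarithmic term, and `g = (z - t) ^ (m + 1) * ∑ c'_j (z - t) ^ j` with `c'_0 ≠ 0`. -/
def IsApparentAt (P Q : RatFunc ℂ) (t : ℂ) (m : ℕ) : Prop :=
  (∃ f : ℂ → ℂ, AnalyticAt ℂ f t ∧ f t ≠ 0 ∧ SolvesNear P Q t f) ∧
    ∃ h : ℂ → ℂ, AnalyticAt ℂ h t ∧ h t ≠ 0 ∧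
      SolvesNear P Q t fun z => (z - t) ^ (m + 1) * h z

end Fuchsian

end

noncomputable section
namespace Fuchsian

/-! ### The derivation of `ℂ(z)` -/

/-! Write `L` for the second order operator, `θ = z d/dz`, and `y` for the class of `1` in
`ℂ(z)[d/dz] / ℂ(z)[d/dz] L`. An operator is a left multiple of `L` exactly when it kills `y`
(`exists_ghgOp_eq_mul`). With `H₁ = θ(θ + γ - 1)` and `H₂ = (θ + α)(θ + β)`, the goal becomes a
polynomial `E` of degree `N` with `H₁(θ) E(θ - 1) y = z H₂(θ) E(θ + 1) y`; the `e_i` are the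
negatives of its roots. This relation follows formally if `y = E(θ) F` for some solution `F` of the
Gauss equation `H₁(θ) F = z H₂(θ) F`.

For generic exponents the module is irreducible (no rational Riccati solution), and `F` is found by
counting dimensions. Look for `F = (A y + z(z-1) B y') / Π` with `Π = ∏ (z - t_k)^{m_k}`, `deg A ≤
N`, `deg B ≤ N - 1`. Let `U` approximate `z(z-1) f'/f` for the non-vanishing local solution at each
`t_k` (this is where apparentness enters) and for the solution of exponent `1 - δ` at `z = 1`.
Requiring `Π (z-1)^N` to divide `A + U B` makes `F` regular at every `t_k` and raises the exponent
at `1` to `N + 1 - δ = γ - α - β`, the Gauss value. These are `2N` conditions on `2N + 1` unknowns.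
A degree estimate then shows that `F` satisfies the Gauss equation
(`exists_hypergeometric_section`). Among `F, θF, …, θ^N F` some combination has no `y'` component,
and it must be a constant multiple of `y`: this is `E` (`exists_hypergeometric`).

For arbitrary exponents one specializes. The relation on `E` is linear in its coefficients, so
having a nonzero solution is a closed condition on the parameters. A second linear condition,
`indicial`, is carried along because it forces `deg E = N` and so survives a drop of degree in the
limit (`natDegree_eq_of_indicial`). It remains to approach the given equation by generic equations
with apparent singularities. The exponents are moved along a line; the `k`-th obstruction to
apparentness is a polynomial in the accessory parameters dominated by `η_k^{m_k + 1}`. Hence the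
solution scheme is finite over the line, and by Krull's height theorem each of its components
through a given point is a curve dominating the line (`exists_generic_point`). `exists_rem_eq_zero`
combines these facts. -/

theorem ddz_mul (f g : RatFunc ℂ) : ddz (f * g) = f * ddz g + g * ddz f := ratDerivFun_mul f g

theorem ddz_algebraMap (p : ℂ[X]) :
    ddz (algebraMap ℂ[X] (RatFunc ℂ) p) = algebraMap ℂ[X] (RatFunc ℂ) (derivative p) := by
  change ratDerivFun _ = _
  have h := ratDerivFun_div p 1 one_ne_zero
  simpa using h

theorem ddz_C (c : ℂ) : ddz (RatFunc.C c) = 0 := ratDerivFun_C c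

theorem ddz_X : ddz (RatFunc.X : RatFunc ℂ) = 1 := by
  rw [← RatFunc.algebraMap_X, ddz_algebraMap]; simp

theorem ddz_div (f g : RatFunc ℂ) (hg : g ≠ 0) :
    ddz (f / g) = (g * ddz f - f * ddz g) / g ^ 2 := by
  have h : f = (f / g) * g := by field_simp
  have h2 := ddz_mul (f / g) g
  rw [← h] at h2
  field_simp at h2 ⊢
  linear_combination -h2

/-! ### The module `ℂ(z)[d/dz] / ℂ(z)[d/dz] L`

For `L = d²/dz² + P d/dz + Q` it has the basis `y, y'`, and the pair `(a, b)` stands for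
`a y + b y'`. -/

/-- The action of `d/dz` on `a y + b y'`, where `y'' = - P y' - Q y`. -/
def nabla (P Q : RatFunc ℂ) : Module.End ℂ (RatFunc ℂ × RatFunc ℂ) where
  toFun w := (ddz w.1 - Q * w.2, w.1 + ddz w.2 - P * w.2)
  map_add' v w := by
    ext <;> simp <;> ring
  map_smul' c w := by
    ext <;> simp [smul_sub, smul_add]

theorem nabla_apply (P Q : RatFunc ℂ) (w : RatFunc ℂ × RatFunc ℂ) :
    nabla P Q w = (ddz w.1 - Q * w.2, w.1 + ddz w.2 - P * w.2) := rfl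

/-- Multiplication by a rational function on pairs. -/
def smulOp (f : RatFunc ℂ) : Module.End ℂ (RatFunc ℂ × RatFunc ℂ) :=
  Algebra.lsmul ℂ ℂ (RatFunc ℂ × RatFunc ℂ) f

@[simp] theorem smulOp_apply (f : RatFunc ℂ) (w : RatFunc ℂ × RatFunc ℂ) :
    smulOp f w = f • w := rfl

theorem nabla_smul (P Q f : RatFunc ℂ) (w : RatFunc ℂ × RatFunc ℂ) :
    nabla P Q (f • w) = ddz f • w + f • nabla P Q w := by
  ext <;> simp [nabla_apply, ddz_mul] <;> ring

/-- The Euler operator `z d/dz` on pairs. -/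
def theta (P Q : RatFunc ℂ) : Module.End ℂ (RatFunc ℂ × RatFunc ℂ) :=
  smulOp RatFunc.X * nabla P Q

/-! ### Division by an operator of order two -/

/-- `D` has the form `c (d/dz)^n + lower order terms`. -/
def HasLead (n : ℕ) (c : RatFunc ℂ) (D : Module.End ℂ (RatFunc ℂ)) : Prop :=
  ∃ v : ℕ → RatFunc ℂ, v n = c ∧ D = ∑ j ∈ Finset.range (n + 1), mulOp (v j) * ddz ^ j

theorem mulOp_apply (f g : RatFunc ℂ) : mulOp f g = f * g := rfl

theorem mulOp_add (f g : RatFunc ℂ) : mulOp (f + g) = mulOp f + mulOp g := by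
  ext h; simp [mulOp_apply, add_mul]

theorem mulOp_mul (f g : RatFunc ℂ) : mulOp (f * g) = mulOp f * mulOp g := by
  ext h; simp [mulOp_apply, mul_assoc]

theorem mulOp_sub (f g : RatFunc ℂ) : mulOp (f - g) = mulOp f - mulOp g := by
  ext h; simp [mulOp_apply, sub_mul]

theorem mulOp_zero : mulOp 0 = 0 := by
  ext h; simp [mulOp_apply]

theorem ddz_mulOp (f : RatFunc ℂ) : ddz * mulOp f = mulOp f * ddz + mulOp (ddz f) := by
  ext g; simp [mulOp_apply, ddz_mul]; ring

theorem HasLead.isDiffOpOfOrder {n : ℕ} {c : RatFunc ℂ} {D : Module.End ℂ (RatFunc ℂ)}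
    (h : HasLead n c D) (hc : c ≠ 0) : IsDiffOpOfOrder n D := by
  obtain ⟨v, hv, rfl⟩ := h
  refine ⟨fun j => v j, by simpa [hv] using hc, ?_⟩
  rw [Finset.sum_range]

theorem hasLead_mulOp (c : RatFunc ℂ) : HasLead 0 c (mulOp c) :=
  ⟨fun _ => c, rfl, by simp⟩

theorem HasLead.sub {n : ℕ} {c c' : RatFunc ℂ} {D D' : Module.End ℂ (RatFunc ℂ)}
    (h : HasLead n c D) (h' : HasLead n c' D') : HasLead n (c - c') (D - D') := by
  obtain ⟨v, hv, rfl⟩ := h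
  obtain ⟨v', hv', rfl⟩ := h'
  refine ⟨fun j => v j - v' j, by simp [hv, hv'], ?_⟩
  simp only [mulOp_sub, sub_mul, Finset.sum_sub_distrib]

theorem HasLead.mulOp_mul {n : ℕ} {c : RatFunc ℂ} {D : Module.End ℂ (RatFunc ℂ)}
    (h : HasLead n c D) (f : RatFunc ℂ) : HasLead n (f * c) (mulOp f * D) := by
  obtain ⟨v, hv, rfl⟩ := h
  refine ⟨fun j => f * v j, by simp [hv], ?_⟩
  simp only [Finset.mul_sum, Fuchsian.mulOp_mul, mul_assoc]

/-- Adding an operator of lower order does not change the leading term. -/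
theorem HasLead.add_mulOp {n : ℕ} {c : RatFunc ℂ} {D : Module.End ℂ (RatFunc ℂ)}
    (h : HasLead (n + 1) c D) (f : RatFunc ℂ) : HasLead (n + 1) c (D + mulOp f) := by
  obtain ⟨v, hv, rfl⟩ := h
  refine ⟨fun j => v j + if j = 0 then f else 0, by simp [hv], ?_⟩
  simp only [mulOp_add, add_mul, Finset.sum_add_distrib]
  congr 1
  rw [Finset.sum_eq_single 0] <;> simp +contextual [mulOp_zero]

theorem HasLead.ddz_mul {n : ℕ} {c : RatFunc ℂ} {D : Module.End ℂ (RatFunc ℂ)}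
    (h : HasLead n c D) : HasLead (n + 1) c (ddz * D) := by
  obtain ⟨v, hv, rfl⟩ := h
  refine ⟨fun j => (if j = n + 1 then 0 else ddz (v j)) + if j = 0 then 0 else v (j - 1),
    by simp [hv], ?_⟩
  simp only [mulOp_add, add_mul, Finset.sum_add_distrib, Finset.mul_sum, ← mul_assoc, ddz_mulOp]
  rw [add_comm]
  congr 1
  · rw [Finset.sum_range_succ _ (n + 1)]
    simp only [if_true, mulOp_zero, zero_mul, add_zero]
    refine Finset.sum_congr rfl fun j hj => ?_
    rw [if_neg (by have := Finset.mem_range.1 hj; omega)]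
  · rw [Finset.sum_range_succ' _ (n + 1)]
    simp [mulOp_zero, pow_succ', mul_assoc]

/-- The operator `D₀` and its action `D₁` on the module agree modulo left multiples of `L`, and
the quotient of the division of `D₀` by `L` has order `n` and leading coefficient `c`. -/
def DivLead (P Q : RatFunc ℂ) (n : ℕ) (c : RatFunc ℂ) (D₀ : Module.End ℂ (RatFunc ℂ))
    (D₁ : Module.End ℂ (RatFunc ℂ × RatFunc ℂ)) : Prop :=
  ∃ D : Module.End ℂ (RatFunc ℂ), HasLead n c D ∧
    D₀ = D * secondOrderOp P Q + mulOp (D₁ (1, 0)).2 * ddz + mulOp (D₁ (1, 0)).1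

/-- Differentiating `r₂ y' + r₁ y` produces one second derivative; replacing it by `L` leaves
`nabla` as the new remainder and `r₂` as the new term of the quotient. -/
theorem secondOrder_step (P Q : RatFunc ℂ) (r : RatFunc ℂ × RatFunc ℂ) :
    ddz * (mulOp r.2 * ddz + mulOp r.1) = mulOp r.2 * secondOrderOp P Q
      + mulOp (nabla P Q r).2 * ddz + mulOp (nabla P Q r).1 := by
  ext g
  simp [secondOrderOp, nabla_apply, mulOp_apply, ddz_mul, pow_two]
  ring

theorem DivLead.ddz_mul {P Q : RatFunc ℂ} {n : ℕ} {c : RatFunc ℂ} {D₀ : Module.End ℂ (RatFunc ℂ)}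
    {D₁ : Module.End ℂ (RatFunc ℂ × RatFunc ℂ)} (h : DivLead P Q n c D₀ D₁) :
    DivLead P Q (n + 1) c (ddz * D₀) (nabla P Q * D₁) := by
  obtain ⟨D, hD, h0⟩ := h
  -- The new term of the quotient has order zero while `ddz * D` has positive order, so the leading
  -- coefficient is unaffected.
  refine ⟨ddz * D + mulOp (D₁ (1, 0)).2, hD.ddz_mul.add_mulOp _, ?_⟩
  rw [h0, add_assoc, mul_add, secondOrder_step P Q, add_mul, Module.End.mul_apply, mul_assoc,
    ← add_assoc, ← add_assoc]

theorem DivLead.smul {P Q : RatFunc ℂ} {n : ℕ} {c : RatFunc ℂ} {D₀ : Module.End ℂ (RatFunc ℂ)}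
    {D₁ : Module.End ℂ (RatFunc ℂ × RatFunc ℂ)} (h : DivLead P Q n c D₀ D₁) (f : RatFunc ℂ) :
    DivLead P Q n (f * c) (mulOp f * D₀) (smulOp f * D₁) := by
  obtain ⟨D, hD, h0⟩ := h
  refine ⟨mulOp f * D, hD.mulOp_mul f, ?_⟩
  conv_lhs => rw [h0]
  simp [Fuchsian.mulOp_mul, mul_add, mul_assoc]

theorem DivLead.sub {P Q : RatFunc ℂ} {n : ℕ} {c c' : RatFunc ℂ}
    {D₀ D₀' : Module.End ℂ (RatFunc ℂ)} {D₁ D₁' : Module.End ℂ (RatFunc ℂ × RatFunc ℂ)}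
    (h : DivLead P Q n c D₀ D₁) (h' : DivLead P Q n c' D₀' D₁') :
    DivLead P Q n (c - c') (D₀ - D₀') (D₁ - D₁') := by
  obtain ⟨D, hD, h0⟩ := h
  obtain ⟨D', hD', h0'⟩ := h'
  refine ⟨D - D', hD.sub hD', ?_⟩
  rw [h0, h0']
  simp only [LinearMap.sub_apply, Prod.fst_sub, Prod.snd_sub, mulOp_sub, sub_mul]
  abel

/-- `z d/dz + c` on pairs. -/
def eulerPair (P Q : RatFunc ℂ) (c : ℂ) : Module.End ℂ (RatFunc ℂ × RatFunc ℂ) :=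
  theta P Q + smulOp (RatFunc.C c)

theorem HasLead.euler {n : ℕ} {c : RatFunc ℂ} {D : Module.End ℂ (RatFunc ℂ)}
    (h : HasLead n c D) (a : ℂ) : HasLead (n + 1) (RatFunc.X * c) (eulerAdd a * D) := by
  obtain ⟨v, hv, h2⟩ := h.ddz_mul.mulOp_mul RatFunc.X
  obtain ⟨w, hw, h4⟩ := h.mulOp_mul (RatFunc.C a)
  refine ⟨fun j => v j + if j = n + 1 then 0 else w j, by simp [hv], ?_⟩
  rw [eulerAdd, add_mul, mul_assoc, h2, h4]
  simp only [mulOp_add, add_mul, Finset.sum_add_distrib]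
  congr 1
  rw [Finset.sum_range_succ _ (n + 1)]
  simp only [if_true, mulOp_zero, zero_mul, add_zero]
  refine Finset.sum_congr rfl fun j hj => ?_
  rw [if_neg (by have := Finset.mem_range.1 hj; omega)]

theorem DivLead.euler {P Q : RatFunc ℂ} {n : ℕ} {c : RatFunc ℂ} {D₀ : Module.End ℂ (RatFunc ℂ)}
    {D₁ : Module.End ℂ (RatFunc ℂ × RatFunc ℂ)} (h : DivLead P Q n c D₀ D₁) (a : ℂ) :
    DivLead P Q (n + 1) (RatFunc.X * c) (eulerAdd a * D₀) (eulerPair P Q a * D₁) := by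
  obtain ⟨D, hD, h0⟩ := h
  refine ⟨eulerAdd a * D + mulOp (RatFunc.X * (D₁ (1, 0)).2), (hD.euler a).add_mulOp _, ?_⟩
  have h1 := secondOrder_step P Q (D₁ (1, 0))
  conv_lhs => rw [h0, add_assoc, mul_add]
  rw [eulerAdd, add_mul _ _ (mulOp _ * ddz + mulOp _), mul_assoc (mulOp RatFunc.X) ddz (_ + _), h1]
  simp only [eulerPair, theta, Module.End.mul_apply, LinearMap.add_apply, smulOp_apply,
    Prod.fst_add, Prod.snd_add, Prod.smul_fst, Prod.smul_snd, smul_eq_mul, mulOp_add,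
    Fuchsian.mulOp_mul, mul_add, add_mul, mul_assoc]
  abel

theorem divLead_pair (P Q : RatFunc ℂ) (a b : ℂ) :
    DivLead P Q 0 (RatFunc.X ^ 2) (eulerAdd a * eulerAdd b) (eulerPair P Q a * eulerPair P Q b) := by
  refine ⟨mulOp (RatFunc.X ^ 2), hasLead_mulOp _, ?_⟩
  ext g
  simp [eulerPair, theta, eulerAdd, secondOrderOp, nabla_apply, mulOp_apply, ddz_mul, ddz_X, ddz_C,
    pow_two, Module.End.mul_apply]
  have : ddz (1 : RatFunc ℂ) = 0 := by simpa using ddz_C 1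
  simp [this]
  ring

/-- Each Euler factor contributes one order and one factor `z` to the leading coefficient; two of
the orders are absorbed by `L`. -/
theorem divLead_list (P Q : RatFunc ℂ) (n : ℕ) (l : List ℂ) (hl : l.length = n + 2) :
    DivLead P Q n (RatFunc.X ^ (n + 2)) (l.map fun c => eulerAdd c).prod
      (l.map fun c => eulerPair P Q c).prod := by
  induction n generalizing l with
  | zero =>
    obtain ⟨a, b, rfl⟩ := List.length_eq_two.1 hl
    simpa using divLead_pair P Q a b
  | succ n ih =>
    obtain ⟨a, l, rfl⟩ := List.exists_cons_of_length_eq_add_one hl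
    rw [List.length_cons, Nat.add_right_cancel_iff] at hl
    have := (ih l hl).euler a
    rw [← pow_succ'] at this
    simpa using this

/-- The action of `ghgRaw a b` on pairs. -/
def ghgPair (P Q : RatFunc ℂ) (a b : List ℂ) : Module.End ℂ (RatFunc ℂ × RatFunc ℂ) :=
  nabla P Q * (b.map fun c => eulerPair P Q (c - 1)).prod - (a.map fun c => eulerPair P Q c).prod

/-- If the hypergeometric operator annihilates the generator `y`, then `L` divides it. -/
theorem exists_ghgOp_eq_mul (P Q : RatFunc ℂ) (n : ℕ) (a b : List ℂ) (ha : a.length = n + 3)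
    (hb : b.length = n + 2) (h : ghgPair P Q a b (1, 0) = 0) :
    ∃ D, IsDiffOpOfOrder (n + 1) D ∧ ghgOp a b = D * secondOrderOp P Q := by
  have h1 := divLead_list P Q (n + 1) a ha
  have h2 := (divLead_list P Q n (b.map fun c => c - 1) (by simpa using hb)).ddz_mul
  obtain ⟨D, hD, h3⟩ := ((h2.sub h1).smul (RatFunc.X ^ b.length * (1 - RatFunc.X))⁻¹)
  refine ⟨D, hD.isDiffOpOfOrder ?_, ?_⟩
  · have hX : (RatFunc.X : RatFunc ℂ) ≠ 0 := RatFunc.X_ne_zero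
    have h1X : (1 - RatFunc.X : RatFunc ℂ) ≠ 0 := by
      rw [sub_ne_zero, ← map_one (algebraMap ℂ[X] (RatFunc ℂ)), ← RatFunc.algebraMap_X]
      exact fun h => X_ne_C (R := ℂ) 1 ((RatFunc.algebraMap_injective ℂ h).symm.trans (by simp))
    rw [hb]
    refine mul_ne_zero (inv_ne_zero (mul_ne_zero (pow_ne_zero _ hX) h1X)) ?_
    -- The two products in the hypergeometric operator both have order `n + 3`, and their leading
    -- coefficients `z^(n+2)` and `z^(n+3)` do not cancel.
    rw [show (RatFunc.X : RatFunc ℂ) ^ (n + 2) - RatFunc.X ^ (n + 1 + 2)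
      = RatFunc.X ^ (n + 2) * (1 - RatFunc.X) by ring]
    exact mul_ne_zero (pow_ne_zero _ hX) h1X
  · have h4 : (smulOp (RatFunc.X ^ b.length * (1 - RatFunc.X))⁻¹ *
        (nabla P Q * ((b.map fun c => c - 1).map fun c => eulerPair P Q c).prod
          - (a.map fun c => eulerPair P Q c).prod)) (1, 0) = 0 := by
      rw [Module.End.mul_apply]
      have : (nabla P Q * ((b.map fun c => c - 1).map fun c => eulerPair P Q c).prod
          - (a.map fun c => eulerPair P Q c).prod) = ghgPair P Q a b := by
        simp [ghgPair, Function.comp_def]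
      rw [this, h, map_zero]
    rw [h4] at h3
    simp only [Prod.fst_zero, Prod.snd_zero, mulOp_zero, zero_mul, add_zero] at h3
    rw [← h3, ghgOp, ghgRaw]
    simp [Function.comp_def]

/-! ### Rational solutions of a Riccati equation -/

/-- A rational solution `n / e` of the Riccati equation of a Fuchsian equation has an exponent at
infinity which differs from a sum of local exponents by a natural number. -/
theorem riccati_exponents (s : Finset ℂ) (hs : 2 ≤ s.card) (p S n e : ℂ[X])
    (hp : p.natDegree ≤ s.card - 1) (hS : S.natDegree ≤ s.card - 2)
    (he : e.Monic) (hne : IsCoprime n e)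
    (H : (∏ c ∈ s, (X - C c)) * (derivative n * e - n * derivative e + n ^ 2)
      + p * n * e + S * e ^ 2 = 0) :
    ∃ (r : ℂ) (k : ℕ) (x : ℂ → ℂ),
      r ^ 2 + (p.coeff (s.card - 1) - 1) * r + S.coeff (s.card - 2) = 0 ∧
      (∀ c ∈ s, x c = 0 ∨ x c = -p.eval c / ∏ j ∈ s.erase c, (c - j)) ∧
      r = k + ∑ c ∈ s, x c := by
  by_cases hn0 : n = 0
  · subst hn0
    have hS0 : S = 0 := by simpa [he.ne_zero] using H
    exact ⟨0, 0, 0, by simp [hS0], by simp, by simp⟩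
  set q : ℂ[X] := ∏ c ∈ s, (X - C c) with hq
  have hqm : q.Monic := monic_prod_of_monic _ _ fun c _ => monic_X_sub_C c
  have hqd : q.natDegree = s.card := by
    rw [hq, natDegree_prod_of_monic _ _ fun c _ => monic_X_sub_C c]; simp
  set D := s.card with hD
  have hqc : q.coeff D = 1 := by rw [← hqd]; exact hqm
  set de := e.natDegree with hde
  -- A Riccati solution vanishes at infinity: otherwise `q n²` would have strictly larger degree
  -- than all other terms.
  have hlt : n.natDegree < de := by
    by_contra! hle
    set dn := n.natDegree with hdn
    have hlead : (q * n ^ 2).coeff (D + 2 * dn) = n.leadingCoeff ^ 2 := by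
      rw [coeff_mul_add_eq_of_natDegree_le hqd.le (natDegree_pow_le), hqc, one_mul,
        ← hdn, coeff_pow_mul_natDegree]
    have h0 : q * n ^ 2 = -(q * (derivative n * e - n * derivative e) + p * n * e + S * e ^ 2) := by
      linear_combination H
    have h1 : (q * (derivative n * e - n * derivative e)).coeff (D + 2 * dn) = 0 := by
      rcases Nat.eq_zero_or_pos dn with h | h
      · rw [natDegree_eq_zero.1 (by omega : n.natDegree = 0) |>.choose_spec.symm,
          (natDegree_eq_zero.1 (by omega : e.natDegree = 0)).choose_spec.symm]
        simp
      · refine coeff_eq_zero_of_natDegree_lt ?_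
        have h2 : (derivative n * e - n * derivative e).natDegree ≤ 2 * dn - 1 := by
          refine (natDegree_sub_le _ _).trans (max_le ?_ ?_)
          · refine natDegree_mul_le.trans ?_
            have := natDegree_derivative_le n
            omega
          · refine natDegree_mul_le.trans ?_
            have := natDegree_derivative_le e
            rcases Nat.eq_zero_or_pos de with h' | h'
            · omega
            · omega
        have := natDegree_mul_le (p := q) (q := derivative n * e - n * derivative e)
        omega
    have h2 : (p * n * e).coeff (D + 2 * dn) = 0 := by
      refine coeff_eq_zero_of_natDegree_lt ?_
      have := natDegree_mul_le (p := p * n) (q := e)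
      have := natDegree_mul_le (p := p) (q := n)
      omega
    have h3 : (S * e ^ 2).coeff (D + 2 * dn) = 0 := by
      refine coeff_eq_zero_of_natDegree_lt ?_
      have := natDegree_mul_le (p := S) (q := e ^ 2)
      have : (e ^ 2).natDegree ≤ 2 * de := natDegree_pow_le
      omega
    rw [h0, coeff_neg, coeff_add, coeff_add, h1, h2, h3] at hlead
    simp only [add_zero, neg_zero] at hlead
    exact hn0 (leadingCoeff_eq_zero.1 ((pow_eq_zero_iff two_ne_zero).1 hlead.symm))
  -- In other words `n / e = e'/e + w / q`: away from the roots of `q`, poles of the solution are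
  -- simple with positive integer residue.
  obtain ⟨w, hw⟩ : e ∣ q * (n - derivative e) := by
    refine hne.symm.dvd_of_dvd_mul_left ⟨-(q * derivative n + p * n + S * e), ?_⟩
    linear_combination H
  have hw2 : q * derivative n + n * (w + p) + S * e = 0 := by
    refine mul_left_cancel₀ he.ne_zero ?_
    linear_combination H - n * hw
  have hnd : n.natDegree ≤ de - 1 := by omega
  have hsub : (n - derivative e).natDegree ≤ de - 1 :=
    (natDegree_sub_le _ _).trans (max_le hnd (natDegree_derivative_le e))
  have hwd : w.natDegree ≤ D - 1 := by
    by_cases hw0 : w = 0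
    · simp [hw0]
    have h1 := he.natDegree_mul' hw0
    have h2 := natDegree_mul_le (p := q) (q := n - derivative e)
    rw [hw] at h2
    omega
  set r := n.coeff (de - 1) with hr
  have hder : (derivative e).coeff (de - 1) = de := by
    rw [coeff_derivative, show de - 1 + 1 = de by omega, hde, he.coeff_natDegree, one_mul,
      ← Nat.cast_add_one, show de - 1 + 1 = de by omega]
  have hwc : w.coeff (D - 1) = r - de := by
    have h1 := coeff_mul_add_eq_of_natDegree_le hqd.le hsub
    rw [hw, show D + (de - 1) = de + (D - 1) by omega,
      coeff_mul_add_eq_of_natDegree_le hde.ge hwd, hqc, coeff_sub, hder, he.coeff_natDegree] at h1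
    simpa using h1
  -- Here `r` is the coefficient of `1/z` in `n / e` at infinity; the top coefficient of the
  -- equation is the indicial equation there.
  have hrr : r ^ 2 + (p.coeff (D - 1) - 1) * r + S.coeff (D - 2) = 0 := by
    have h0 : q * (X * derivative n) + n * (X * (w + p)) + (X * S) * e = 0 := by
      linear_combination X * hw2
    have e1 : (X * derivative n).natDegree ≤ de - 1 := by
      by_cases h : n.natDegree = 0
      · rw [(natDegree_eq_zero.1 h).choose_spec.symm]; simp
      · have := natDegree_mul_le (p := (X : ℂ[X])) (q := derivative n)
        have := natDegree_derivative_le n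
        rw [natDegree_X] at *
        omega
    have e2 : (X * (w + p)).natDegree ≤ D := by
      have := natDegree_mul_le (p := (X : ℂ[X])) (q := w + p)
      have := natDegree_add_le w p
      rw [natDegree_X] at *
      omega
    have e3 : (X * S).natDegree ≤ D - 1 := by
      have := natDegree_mul_le (p := (X : ℂ[X])) (q := S)
      rw [natDegree_X] at *
      omega
    have c1 := coeff_mul_add_eq_of_natDegree_le hqd.le e1
    have c2 := coeff_mul_add_eq_of_natDegree_le hnd e2
    have c3 := coeff_mul_add_eq_of_natDegree_le e3 hde.ge
    have d1 : (X * derivative n).coeff (de - 1) = (de - 1) * r := by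
      rcases Nat.exists_eq_add_of_le' (show 1 ≤ de by omega) with ⟨j, hj⟩
      rw [hr, hj, Nat.add_sub_cancel]
      cases j with
      | zero => simp
      | succ j => rw [coeff_X_mul, coeff_derivative]; push_cast; ring
    have d2 : (X * (w + p)).coeff D = r - de + p.coeff (D - 1) := by
      conv_lhs => rw [show D = D - 1 + 1 by omega]
      rw [coeff_X_mul, coeff_add, hwc]
    have d3 : (X * S).coeff (D - 1) = S.coeff (D - 2) := by
      rw [show D - 1 = D - 2 + 1 by omega, coeff_X_mul]
    have hc := congrArg (fun f => coeff f (D + (de - 1))) h0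
    simp only [coeff_add, coeff_zero] at hc
    rw [c1, show D + (de - 1) = (de - 1) + D by omega, c2,
      show (de - 1) + D = (D - 1) + de by omega, c3, d1, d2, d3, hqc, he.coeff_natDegree] at hc
    linear_combination hc
  have hq0 : ∀ c ∈ s, q.eval c = 0 := fun c hc => by
    rw [hq, eval_prod]; exact Finset.prod_eq_zero hc (by simp)
  refine ⟨r, de, fun c => w.eval c / ∏ j ∈ s.erase c, (c - j), hrr, fun c hc => ?_, ?_⟩
  · have h1 := congrArg (eval c) hw
    have h2 := congrArg (eval c) hw2
    simp only [eval_mul, eval_add, hq0 c hc, zero_mul, eval_zero, zero_add] at h1 h2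
    -- If `e` vanishes at `c`, then `n` does not, and the equation forces the nonzero exponent;
    -- otherwise `w` vanishes at `c`.
    rcases mul_eq_zero.1 h1.symm with h3 | h3
    · have h4 : n.eval c ≠ 0 := by
        intro h4
        obtain ⟨a, b, hab⟩ := hne
        have := congrArg (eval c) hab
        simp [h3, h4] at this
      right
      have h5 : w.eval c + p.eval c = 0 := by simpa [h3, h4] using h2
      simp only
      rw [eq_neg_of_add_eq_zero_left h5]
    · left; simp [h3]
  · have hdeg : w.degree < D := by
      refine (degree_le_natDegree).trans_lt ?_
      exact_mod_cast (by omega : w.natDegree < D)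
    -- The top coefficient of `w` is the sum of the residues of `w / q`, by Lagrange interpolation
    -- at the roots of `q`.
    have := Lagrange.coeff_eq_sum (s := s) (v := id) (Function.injective_id.injOn) hdeg
    rw [← hD, hwc] at this
    simp only [id] at this
    linear_combination this

/-! ### The parameters of the equation -/

/-- Parameters `t_k, m_k, α, β, γ` and accessory parameters `η_k` in a ring `A`. -/
structure Datum (M : ℕ) (A : Type*) where
  t : Fin M → A
  m : Fin M → ℕ
  α : A
  β : A
  γ : A
  η : Fin M → A

namespace Datum

variable {M : ℕ} {A B : Type*} [CommRing A] [CommRing B]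

/-- The sum of the `m_k`. -/
def N (d : Datum M A) : ℕ := ∑ k, d.m k

/-- The exponent parameter at `z = 1`, determined by the Fuchs relation. -/
def δ (d : Datum M A) : A := d.α + d.β - d.γ + d.N + 1

/-- The product of all `z - t_k`. -/
def T (d : Datum M A) : A[X] := ∏ k, (X - C (d.t k))

/-- The product of all `z - t_j` with `j ≠ k`. -/
def Tk (d : Datum M A) (k : Fin M) : A[X] := ∏ j ∈ Finset.univ.erase k, (X - C (d.t j))

/-- `∑ m_k ∏_{j ≠ k} (z - t_j)`. -/
def mT (d : Datum M A) : A[X] := ∑ k, C (d.m k : A) * d.Tk k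

/-- The leading coefficient `z (z - 1) ∏ (z - t_k)`. -/
def q (d : Datum M A) : A[X] := X * (X - 1) * d.T

/-- The coefficient of `d/dz`. -/
def p (d : Datum M A) : A[X] :=
  C d.γ * (X - 1) * d.T + C d.δ * X * d.T - X * (X - 1) * d.mT

/-- The coefficient of order zero. -/
def S (d : Datum M A) : A[X] := C (d.α * d.β) * d.T + ∑ k, C (d.η k) * d.Tk k

theorem X_sub_mul_Tk (d : Datum M A) (k : Fin M) : (X - C (d.t k)) * d.Tk k = d.T :=
  Finset.mul_prod_erase Finset.univ (fun j => X - C (d.t j)) (Finset.mem_univ k)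

theorem T_monic (d : Datum M A) : d.T.Monic :=
  monic_prod_of_monic _ _ fun _ _ => monic_X_sub_C _

theorem T_natDegree [Nontrivial A] (d : Datum M A) : d.T.natDegree = M := by
  rw [T, natDegree_prod_of_monic _ _ fun k _ => monic_X_sub_C _]; simp

theorem T_coeff [Nontrivial A] (d : Datum M A) : d.T.coeff M = 1 := by
  have := d.T_monic
  rwa [Monic, leadingCoeff, T_natDegree] at this

theorem Tk_monic (d : Datum M A) (k : Fin M) : (d.Tk k).Monic :=
  monic_prod_of_monic _ _ fun _ _ => monic_X_sub_C _

theorem Tk_natDegree [Nontrivial A] (d : Datum M A) (k : Fin M) : (d.Tk k).natDegree = M - 1 := by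
  rw [Tk, natDegree_prod_of_monic _ _ fun k _ => monic_X_sub_C _]; simp

theorem Tk_coeff [Nontrivial A] (d : Datum M A) (k : Fin M) : (d.Tk k).coeff (M - 1) = 1 := by
  have := d.Tk_monic k
  rwa [Monic, leadingCoeff, Tk_natDegree] at this

theorem mT_natDegree [Nontrivial A] (d : Datum M A) : d.mT.natDegree ≤ M - 1 :=
  natDegree_sum_le_of_forall_le _ _ fun k _ => by
    refine (natDegree_C_mul_le _ _).trans (d.Tk_natDegree k).le

theorem mT_coeff [Nontrivial A] (d : Datum M A) : d.mT.coeff (M - 1) = (d.N : A) := by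
  simp [mT, Tk_coeff, N]

theorem S_natDegree [Nontrivial A] (d : Datum M A) : d.S.natDegree ≤ M := by
  refine (natDegree_add_le _ _).trans (max_le ?_ ?_)
  · exact (natDegree_C_mul_le _ _).trans d.T_natDegree.le
  · refine natDegree_sum_le_of_forall_le _ _ fun k _ => ?_
    refine (natDegree_C_mul_le _ _).trans ((d.Tk_natDegree k).le.trans (Nat.sub_le _ _))

theorem S_coeff [Nontrivial A] (d : Datum M A) : d.S.coeff M = d.α * d.β := by
  rw [S, coeff_add, coeff_C_mul, T_coeff, finsetSum_coeff, Finset.sum_eq_zero, mul_one, add_zero]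
  intro k _
  rw [coeff_C_mul, coeff_eq_zero_of_natDegree_lt, mul_zero]
  rw [Tk_natDegree]
  have := k.pos
  omega

theorem p_natDegree [Nontrivial A] (d : Datum M A) : d.p.natDegree ≤ M + 1 := by
  have h1 : (X - 1 : A[X]).natDegree ≤ 1 := by simpa using natDegree_X_sub_C_le (1 : A)
  have h2 := d.T_natDegree
  have h3 := d.mT_natDegree
  have hX : (X : A[X]).natDegree = 1 := natDegree_X
  refine (natDegree_sub_le _ _).trans (max_le ((natDegree_add_le _ _).trans (max_le ?_ ?_)) ?_)
  · rw [mul_assoc]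
    refine (natDegree_C_mul_le _ _).trans (natDegree_mul_le.trans (by omega))
  · rw [mul_assoc]
    refine (natDegree_C_mul_le _ _).trans (natDegree_mul_le.trans (by omega))
  · rcases Nat.eq_zero_or_pos M with h | h
    · subst h; simp [mT]
    · refine natDegree_mul_le.trans ?_
      have := natDegree_mul_le (p := (X : A[X])) (q := X - 1)
      omega

theorem p_coeff [Nontrivial A] (d : Datum M A) : d.p.coeff (M + 1) = d.α + d.β + 1 := by
  have h1 : (X - 1 : A[X]).natDegree ≤ 1 := by simpa using natDegree_X_sub_C_le (1 : A)
  have h2 := d.T_natDegree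
  have h3 := d.mT_natDegree
  have hX : (X : A[X]).natDegree = 1 := natDegree_X
  have e1 : ((X - 1) * d.T).coeff (1 + M) = 1 := by
    rw [coeff_mul_add_eq_of_natDegree_le h1 h2.le, T_coeff]; simp [coeff_one]
  have e2 : (X * d.T).coeff (M + 1) = 1 := by rw [coeff_X_mul, T_coeff]
  have e3 : (X * (X - 1) * d.mT).coeff (M + 1) = (d.N : A) := by
    rcases Nat.eq_zero_or_pos M with h | h
    · subst h; simp [mT, N]
    · have := coeff_mul_add_eq_of_natDegree_le h1 h3
      rw [show M + 1 = (1 + (M - 1)) + 1 by omega, mul_assoc, coeff_X_mul, this, mT_coeff]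
      simp [coeff_one]
  rw [p, coeff_sub, coeff_add, mul_assoc, mul_assoc, coeff_C_mul, coeff_C_mul, add_comm M 1, e1,
    add_comm 1 M, e2, e3, δ]
  ring

/-- The coefficient of `d/dz` in monic form. -/
def P (d : Datum M ℂ) : RatFunc ℂ := algebraMap ℂ[X] _ d.p / algebraMap ℂ[X] _ d.q

/-- The coefficient of order zero in monic form. -/
def Q (d : Datum M ℂ) : RatFunc ℂ := algebraMap ℂ[X] _ d.S / algebraMap ℂ[X] _ d.q

/-- The points `0, 1, t_1, …, t_M` are distinct. -/
structure Distinct (d : Datum M ℂ) : Prop where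
  inj : Function.Injective d.t
  ne_zero : ∀ k, d.t k ≠ 0
  ne_one : ∀ k, d.t k ≠ 1

/-- The exponents are so generic that the equation is irreducible and nonresonant at `1`. -/
structure Generic (d : Datum M ℂ) : Prop where
  α_ne : ∀ n : ℤ, d.α ≠ n
  β_ne : ∀ n : ℤ, d.β ≠ n
  αγ_ne : ∀ n : ℤ, d.α - d.γ ≠ n
  βγ_ne : ∀ n : ℤ, d.β - d.γ ≠ n
  δ_ne : ∀ n : ℤ, d.δ ≠ n

theorem q_monic (d : Datum M A) : d.q.Monic :=
  (monic_X.mul (by simpa using monic_X_sub_C (1 : A))).mul d.T_monic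

theorem q_ne_zero (d : Datum M ℂ) : algebraMap ℂ[X] (RatFunc ℂ) d.q ≠ 0 :=
  RatFunc.algebraMap_ne_zero d.q_monic.ne_zero

/-- The set of singular points in `ℂ`. -/
def nodes (d : Datum M ℂ) : Finset ℂ := insert 0 (insert 1 (Finset.univ.image d.t))

theorem nodes_prod (d : Datum M ℂ) (hd : d.Distinct) {B : Type*} [CommMonoid B] (f : ℂ → B) :
    ∏ c ∈ d.nodes, f c = f 0 * f 1 * ∏ k, f (d.t k) := by
  rw [nodes, Finset.prod_insert, Finset.prod_insert, Finset.prod_image hd.inj.injOn, mul_assoc]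
  · simpa using fun k => hd.ne_one k
  · simpa using fun k => hd.ne_zero k

theorem nodes_card (d : Datum M ℂ) (hd : d.Distinct) : d.nodes.card = M + 2 := by
  rw [nodes, Finset.card_insert_of_notMem, Finset.card_insert_of_notMem,
    Finset.card_image_of_injective _ hd.inj, Finset.card_univ, Fintype.card_fin]
  · simpa using fun k => hd.ne_one k
  · simpa using fun k => hd.ne_zero k

theorem prod_erase_eq_eval_derivative (s : Finset ℂ) (c : ℂ) (hc : c ∈ s) :
    ∏ j ∈ s.erase c, (c - j) = (derivative (∏ j ∈ s, (X - C j))).eval c := by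
  rw [← Finset.mul_prod_erase _ _ hc, derivative_mul]
  simp [eval_prod]

theorem q_eq_prod (d : Datum M ℂ) (hd : d.Distinct) : d.q = ∏ c ∈ d.nodes, (X - C c) := by
  rw [nodes_prod d hd]; simp [q, T]

theorem Tk_eval_ne_zero (d : Datum M ℂ) (hd : d.Distinct) (k : Fin M) :
    (d.Tk k).eval (d.t k) ≠ 0 := by
  rw [Tk, eval_prod]
  refine Finset.prod_ne_zero_iff.2 fun j hj => ?_
  simpa [sub_eq_zero] using fun h => (Finset.mem_erase.1 hj).1 (hd.inj h).symm

theorem Tk_eval_of_ne (d : Datum M A) {j k : Fin M} (h : j ≠ k) :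
    (d.Tk k).eval (d.t j) = 0 := by
  rw [Tk, eval_prod]
  exact Finset.prod_eq_zero (Finset.mem_erase.2 ⟨h, Finset.mem_univ _⟩) (by simp)

theorem T_eval_t (d : Datum M A) (k : Fin M) : d.T.eval (d.t k) = 0 := by
  rw [← d.X_sub_mul_Tk k]; simp

theorem mT_eval (d : Datum M A) (k : Fin M) :
    d.mT.eval (d.t k) = d.m k * (d.Tk k).eval (d.t k) := by
  rw [mT, eval_finsetSum, Finset.sum_eq_single k]
  · simp
  · intro j _ hj; simp [d.Tk_eval_of_ne hj.symm]
  · simp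

theorem T_eval_ne_zero (d : Datum M ℂ) {c : ℂ} (h : ∀ k, d.t k ≠ c) : d.T.eval c ≠ 0 := by
  rw [T, eval_prod]
  refine Finset.prod_ne_zero_iff.2 fun j _ => ?_
  simpa [sub_eq_zero] using (h j).symm

theorem exponent_zero (d : Datum M ℂ) (hd : d.Distinct) :
    -d.p.eval 0 / d.q.derivative.eval 0 = -d.γ := by
  have := d.T_eval_ne_zero hd.ne_zero
  simp [p, q]

  field_simp

theorem exponent_one (d : Datum M ℂ) (hd : d.Distinct) :
    -d.p.eval 1 / d.q.derivative.eval 1 = -d.δ := by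
  have := d.T_eval_ne_zero hd.ne_one
  simp [p, q]
  field_simp

theorem exponent_t (d : Datum M ℂ) (hd : d.Distinct) (k : Fin M) :
    -d.p.eval (d.t k) / d.q.derivative.eval (d.t k) = d.m k := by
  have h1 := d.Tk_eval_ne_zero hd k
  have h2 := hd.ne_zero k
  have h3 := sub_ne_zero.2 (hd.ne_one k)
  have h4 : d.T.derivative.eval (d.t k) = (d.Tk k).eval (d.t k) := by
    rw [← d.X_sub_mul_Tk k, derivative_mul]; simp
  simp [p, q, T_eval_t, mT_eval, h4]
  field_simp

/-- For generic parameters the Riccati equation has no rational solution. -/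
theorem no_rational_riccati (d : Datum M ℂ) (hd : d.Distinct) (hg : d.Generic) (v : RatFunc ℂ) :
    ddz v + v ^ 2 + d.P * v + d.Q ≠ 0 := by
  intro hv
  have he0 : algebraMap ℂ[X] (RatFunc ℂ) v.denom ≠ 0 :=
    RatFunc.algebraMap_ne_zero v.denom_ne_zero
  have hq0 := d.q_ne_zero
  have H : d.q * (derivative v.num * v.denom - v.num * derivative v.denom + v.num ^ 2)
      + d.p * v.num * v.denom + d.S * v.denom ^ 2 = 0 := by
    apply RatFunc.algebraMap_injective ℂ
    have h1 := RatFunc.num_div_denom v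
    have h2 := ratDerivFun_div v.num v.denom v.denom_ne_zero
    rw [h1] at h2
    change ddz v = _ at h2
    rw [h2, P, Q] at hv
    have key : ∀ V n e n' e' q p S : RatFunc ℂ, q ≠ 0 → e ≠ 0 → n / e = V →
        (n' * e - n * e') / e ^ 2 + V ^ 2 + p / q * V + S / q = 0 →
        q * (n' * e - n * e' + n ^ 2) + p * n * e + S * e ^ 2 = 0 := by
      rintro _ n e n' e' q p S hq he rfl h
      field_simp at h
      linear_combination h
    simpa using key _ _ _ _ _ _ _ _ hq0 he0 h1 hv
  rw [d.q_eq_prod hd] at H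
  have hcard := d.nodes_card hd
  obtain ⟨r, k, x, hr, hx, hk⟩ := riccati_exponents d.nodes (by omega) d.p d.S v.num v.denom
    (by rw [hcard]; exact d.p_natDegree) (by rw [hcard]; exact d.S_natDegree) v.monic_denom
    v.isCoprime_num_denom H
  rw [hcard, Nat.add_sub_cancel, show M + 2 - 1 = M + 1 by omega, p_coeff, S_coeff] at hr
  have hx' : ∀ c ∈ d.nodes, x c = 0 ∨ x c = -d.p.eval c / d.q.derivative.eval c := by
    intro c hc
    rw [d.q_eq_prod hd, ← prod_erase_eq_eval_derivative _ _ hc]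
    exact hx c hc
  have hsum : ∑ c ∈ d.nodes, x c = x 0 + x 1 + ∑ k, x (d.t k) :=
    d.nodes_prod hd (B := Multiplicative ℂ) (fun c => Multiplicative.ofAdd (x c))
  have ht : ∃ n : ℕ, ∑ k, x (d.t k) = n := by
    have : ∀ k, ∃ n : ℕ, x (d.t k) = n := fun k => by
      rcases hx' (d.t k) (by simp [nodes]) with h | h
      · exact ⟨0, by simpa using h⟩
      · exact ⟨d.m k, by rw [h, d.exponent_t hd]⟩
    choose n hn using this
    exact ⟨∑ k, n k, by simp [hn]⟩
  obtain ⟨n, hn⟩ := ht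
  have h0 := hx' 0 (by simp [nodes])
  have h1 := hx' 1 (by simp [nodes])
  rw [d.exponent_zero hd] at h0
  rw [d.exponent_one hd] at h1
  have hr' : (r + d.α) * (r + d.β) = 0 := by linear_combination hr
  rw [hsum, hn] at hk
  have hδ : d.δ = d.α + d.β - d.γ + d.N + 1 := rfl
  -- One choice of exponent at each of `∞`, `0` and `1`. The contributions of the `t_k` are natural
  -- numbers, so by the Fuchs relation each of the eight combinations makes one of `α`, `β`, `α -
  -- γ`, `β - γ` an integer.
  rcases mul_eq_zero.1 hr' with h | h <;> rcases h0 with h0 | h0 <;> rcases h1 with h1 | h1 <;>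
    rw [h0, h1] at hk
  · exact hg.α_ne (-(k + n)) (by push_cast; linear_combination h - hk)
  · exact hg.βγ_ne (k + n - d.N - 1) (by push_cast; linear_combination hk - h - hδ)
  · exact hg.αγ_ne (-(k + n)) (by push_cast; linear_combination h - hk)
  · exact hg.β_ne (k + n - d.N - 1) (by push_cast; linear_combination hk - h - hδ)
  · exact hg.β_ne (-(k + n)) (by push_cast; linear_combination h - hk)
  · exact hg.αγ_ne (k + n - d.N - 1) (by push_cast; linear_combination hk - h - hδ)
  · exact hg.βγ_ne (-(k + n)) (by push_cast; linear_combination h - hk)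
  · exact hg.α_ne (k + n - d.N - 1) (by push_cast; linear_combination hk - h - hδ)

/-- For generic parameters no nonzero element of the module spans an invariant line. -/
theorem irreducible (d : Datum M ℂ) (hd : d.Distinct) (hg : d.Generic)
    {w : RatFunc ℂ × RatFunc ℂ} (hw : w ≠ 0) :
    w.1 * (nabla d.P d.Q w).2 - w.2 * (nabla d.P d.Q w).1 ≠ 0 := by
  obtain ⟨a, b⟩ := w
  simp only [nabla_apply]
  intro h
  by_cases hb : b = 0
  · subst hb
    have ha : a ≠ 0 := fun ha => hw (by simp [ha])
    simp [ha] at h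
  -- An invariant line spanned by `a y + b y'` is a right factor of order one, whose solution has
  -- logarithmic derivative `-a / b`.
  · apply d.no_rational_riccati hd hg (-a / b)
    rw [ddz_div _ _ hb, map_neg]
    field_simp
    linear_combination h

/-! ### The Riccati equation modulo powers of local parameters -/

/-- The linear polynomial `γ (z - 1) + δ z - 2 z + 1`. -/
def lin (d : Datum M ℂ) : ℂ[X] := C d.γ * (X - 1) + C d.δ * X - 2 * X + 1

/-- The product of all `(z - t_k) ^ m_k`. -/
def Pi (d : Datum M ℂ) : ℂ[X] := ∏ k, (X - C (d.t k)) ^ d.m k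

/-- The Riccati expression of `z (z - 1) y' / y`, with denominators cleared. -/
def ric (d : Datum M ℂ) (U : ℂ[X]) : ℂ[X] :=
  d.T * (X * (X - 1) * derivative U + U ^ 2 + d.lin * U) + X * (X - 1) * (d.S - U * d.mT)

/-- The singularity `t_k` is apparent: there is an approximate polynomial solution which does not
vanish there. -/
def ApparentAt (d : Datum M ℂ) (k : Fin M) : Prop :=
  ∃ f : ℂ[X], f.eval (d.t k) ≠ 0 ∧ (X - C (d.t k)) ^ (d.m k + 1) ∣
    d.q * derivative (derivative f) + d.p * derivative f + d.S * f

theorem p_eq (d : Datum M ℂ) :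
    d.p = (d.lin + 2 * X - 1) * d.T - X * (X - 1) * d.mT := by
  rw [p, lin]; ring

/-- Modulo `(z - t_k)^(m_k + 1)` the polynomial `U` is `z(z-1) f'/f`, so `f² ric U` is `z(z-1) f`
times the operator applied to `f`. Differentiating the error loses one power of `z - t_k`, which the
factor `T` in `ric` gives back. -/
theorem pow_dvd_ric_of_apparent (d : Datum M ℂ) (k : Fin M) (f U : ℂ[X])
    (hf : f.eval (d.t k) ≠ 0)
    (h : (X - C (d.t k)) ^ (d.m k + 1) ∣
      d.q * derivative (derivative f) + d.p * derivative f + d.S * f)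
    (hU : (X - C (d.t k)) ^ (d.m k + 1) ∣ f * U - X * (X - 1) * derivative f) :
    (X - C (d.t k)) ^ (d.m k + 1) ∣ d.ric U := by
  obtain ⟨g, hg⟩ := h
  obtain ⟨e, he⟩ := hU
  have hcop : IsCoprime ((X - C (d.t k)) ^ (d.m k + 1)) (f ^ 2) := by
    refine IsCoprime.pow ?_
    refine ((irreducible_X_sub_C (d.t k)).coprime_iff_not_dvd).2 fun h => hf ?_
    exact dvd_iff_isRoot.1 h
  refine hcop.dvd_of_dvd_mul_left ?_
  have hde := congrArg derivative he
  rw [derivative_mul, derivative_X_sub_C_pow] at hde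
  simp only [derivative_sub, derivative_mul, derivative_X, derivative_one] at hde
  rw [ric]
  refine ⟨f * X * (X - 1) * g + d.T * f * X * (X - 1) * derivative e
      + d.Tk k * f * X * (X - 1) * ((d.m k : ℂ[X]) + 1) * e
      + d.T * e * (f * U + f * d.lin) - X * (X - 1) * f * e * d.mT, ?_⟩
  have hT := d.X_sub_mul_Tk k
  have hp := d.p_eq
  have hq : d.q = X * (X - 1) * d.T := rfl
  set x := X - C (d.t k) with hx
  simp only [Nat.add_sub_cancel] at hde
  push_cast at hde
  set W := derivative U
  set f1 := derivative f
  set f2 := derivative f1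
  set e1 := derivative e
  set xm := x ^ d.m k with hxm
  rw [pow_succ, ← hxm] at *
  have h2 : xm * ((d.m k : ℂ[X]) + 1) * e * d.T
      = xm * x * (d.Tk k * ((d.m k : ℂ[X]) + 1) * e) := by rw [← hT]; ring
  rw [hq, hp] at hg
  simp only [map_natCast, map_one, map_add] at hde
  linear_combination f * X * (X - 1) * hg + d.T * f * X * (X - 1) * hde
    + (d.T * f * U + d.T * f * d.lin - X * (X - 1) * f * d.mT) * he
    + f * X * (X - 1) * h2

/-- In `ric` the derivative of `U` is multiplied by `z - 1`, so congruences modulo powers of `z - 1`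
are preserved. -/
theorem pow_dvd_ric_sub (d : Datum M ℂ) (U V : ℂ[X]) (n : ℕ) (h : (X - 1) ^ n ∣ U - V) :
    (X - 1) ^ n ∣ d.ric U - d.ric V := by
  obtain ⟨e, he⟩ := h
  obtain rfl : U = V + (X - 1) ^ n * e := by linear_combination he
  have hd : (X - 1 : ℂ[X]) * derivative ((X - 1) ^ n) = (n : ℂ[X]) * (X - 1) ^ n := by
    have := derivative_X_sub_C_pow (1 : ℂ) n
    rw [map_one] at this
    rw [this]
    cases n with
    | zero => simp
    | succ n => simp; ring
  refine ⟨d.T * (X * (n : ℂ[X]) * e + X * (X - 1) * derivative e + 2 * V * e + (X - 1) ^ n * e ^ 2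
    + d.lin * e) - X * (X - 1) * e * d.mT, ?_⟩
  rw [ric, ric, derivative_add, derivative_mul]
  linear_combination d.T * X * e * hd

theorem lin_eval_one (d : Datum M ℂ) : d.lin.eval 1 = d.δ - 1 := by
  simp [lin]; ring

/-- Power series recursion at `z = 1` for the solution of exponent `1 - δ`. The coefficient of the
new unknown is `T(1)` times `(n + 1) + 2(1 - δ) + (δ - 1) = n + 2 - δ`, nonzero since `δ` is not an
integer. -/
theorem exists_ric_at_one (d : Datum M ℂ) (hd : d.Distinct) (hδ : ∀ n : ℤ, d.δ ≠ n) (n : ℕ) :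
    ∃ U : ℂ[X], U.eval 1 = 1 - d.δ ∧ (X - 1) ^ (n + 1) ∣ d.ric U := by
  have hT1 := d.T_eval_ne_zero hd.ne_one
  induction n with
  | zero =>
    refine ⟨C (1 - d.δ), by simp, ?_⟩
    rw [zero_add, pow_one, ← map_one C, dvd_iff_isRoot, IsRoot.def]
    simp [ric, lin_eval_one]
    right; ring
  | succ n ih =>
    obtain ⟨U, hU, s, hs⟩ := ih
    have hne : (n : ℂ) + 2 - d.δ ≠ 0 := by
      rw [sub_ne_zero]; intro h; exact hδ (n + 2) (by push_cast; exact h.symm)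
    set c := -s.eval 1 / (d.T.eval 1 * ((n : ℂ) + 2 - d.δ)) with hc
    refine ⟨U + C c * (X - 1) ^ (n + 1), by simp [hU], ?_⟩
    have hd : derivative ((X - 1 : ℂ[X]) ^ (n + 1)) = ((n : ℂ[X]) + 1) * (X - 1) ^ n := by
      have := derivative_X_sub_C_pow (1 : ℂ) (n + 1)
      rw [map_one] at this
      rw [this]; simp
    have h1 : d.ric (U + C c * (X - 1) ^ (n + 1)) = (X - 1) ^ (n + 1) *
        (s + d.T * (C c * ((n : ℂ[X]) + 1) * X + 2 * U * C c + C c ^ 2 * (X - 1) ^ (n + 1) + d.lin * C c)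
          - X * (X - 1) * C c * d.mT) := by
      rw [ric] at hs ⊢
      rw [derivative_add, derivative_C_mul, hd]
      linear_combination hs
    rw [h1, pow_succ _ (n + 1)]
    refine mul_dvd_mul_left _ ?_
    rw [← map_one C, dvd_iff_isRoot, IsRoot.def]
    simp only [map_one, eval_add, eval_sub, eval_mul, eval_X, eval_one, sub_self, mul_zero,
      zero_mul, sub_zero, eval_C, eval_pow, lin_eval_one, hU, eval_natCast, eval_ofNat]
    rw [zero_pow (by omega), hc]
    field_simp
    ring

/-- A simultaneous approximate solution of the Riccati equation at all apparent singularities and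
at `z = 1`. -/
theorem exists_ric (d : Datum M ℂ) (hd : d.Distinct) (hδ : ∀ n : ℤ, d.δ ≠ n)
    (ha : ∀ k, d.ApparentAt k) :
    ∃ U V : ℂ[X], U.eval 1 = 1 - d.δ ∧ d.ric U = d.T * (d.Pi * (X - 1) ^ d.N) * V := by
  choose f hf0 hf using ha
  obtain ⟨U₁, hU₁, hr₁⟩ := d.exists_ric_at_one hd hδ d.N
  have hloc : ∀ k, ∃ U : ℂ[X], (X - C (d.t k)) ^ (d.m k + 1) ∣
      f k * U - X * (X - 1) * derivative (f k) := by
    intro k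
    have hcop : IsCoprime ((X - C (d.t k)) ^ (d.m k + 1)) (f k) := by
      refine IsCoprime.pow_left ?_
      refine ((irreducible_X_sub_C (d.t k)).coprime_iff_not_dvd).2 fun h => hf0 k ?_
      exact dvd_iff_isRoot.1 h
    obtain ⟨a, b, hab⟩ := hcop
    refine ⟨b * (X * (X - 1) * derivative (f k)), -(a * (X * (X - 1) * derivative (f k))), ?_⟩
    linear_combination X * (X - 1) * derivative (f k) * hab
  choose u hu using hloc
  -- Chinese remainder theorem; `none` stands for the point `1`. The exponent `N + 1` there, rather
  -- than `N`, keeps the value `U(1)` even when `N = 0`.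
  let c : Option (Fin M) → ℂ := fun o => o.elim 1 d.t
  have hcinj : Function.Injective c := by
    rintro (_ | i) (_ | j) h
    · rfl
    · exact absurd h.symm (hd.ne_one j)
    · exact absurd h (hd.ne_one i)
    · exact congrArg _ (hd.inj h)
  have hcc : ∀ i j : Option (Fin M), i ≠ j → IsCoprime (X - C (c i)) (X - C (c j)) :=
    fun i j hij => isCoprime_X_sub_C_of_isUnit_sub
      (sub_ne_zero.2 fun h => hij (hcinj h)).isUnit
  let e : Option (Fin M) → ℕ := fun o => o.elim (d.N + 1) fun k => d.m k + 1
  let g : Option (Fin M) → ℂ[X] := fun o => o.elim U₁ u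
  obtain ⟨U, hU⟩ := Ideal.exists_forall_sub_mem_ideal
    (I := fun o => Ideal.span {(X - C (c o)) ^ e o})
    (fun i j hij => (Ideal.isCoprime_span_singleton_iff _ _).2 (hcc i j hij).pow) g
  have hU1 : (X - 1 : ℂ[X]) ^ (d.N + 1) ∣ U - U₁ := by
    simpa [Ideal.mem_span_singleton, c, e, g] using hU none
  have hUk : ∀ k, (X - C (d.t k)) ^ (d.m k + 1) ∣ U - u k := fun k => by
    simpa [Ideal.mem_span_singleton, c, e, g] using hU (some k)
  have hdk : ∀ k, (X - C (d.t k)) ^ (d.m k + 1) ∣ d.ric U := fun k => by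
    refine d.pow_dvd_ric_of_apparent k (f k) U (hf0 k) (hf k) ?_
    have := dvd_add ((hUk k).mul_left (f k)) (hu k)
    rwa [show f k * (U - u k) + (f k * u k - X * (X - 1) * derivative (f k))
      = f k * U - X * (X - 1) * derivative (f k) by ring] at this
  have hd1 : (X - 1 : ℂ[X]) ^ d.N ∣ d.ric U := by
    have h := dvd_add (d.pow_dvd_ric_sub U U₁ _ hU1) hr₁
    rw [sub_add_cancel] at h
    exact (pow_dvd_pow _ (Nat.le_succ _)).trans h
  have hprod : d.T * d.Pi = ∏ k, (X - C (d.t k)) ^ (d.m k + 1) := by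
    rw [T, Pi, ← Finset.prod_mul_distrib]
    exact Finset.prod_congr rfl fun k _ => by ring
  have h1 : (∏ k, (X - C (d.t k)) ^ (d.m k + 1)) ∣ d.ric U := by
    refine Finset.prod_dvd_of_coprime (fun i _ j _ hij => ?_) fun k _ => hdk k
    exact (hcc (some i) (some j) (by simpa using hij)).pow
  have h2 : IsCoprime (∏ k, (X - C (d.t k)) ^ (d.m k + 1)) ((X - 1 : ℂ[X]) ^ d.N) := by
    refine IsCoprime.prod_left fun k _ => ?_
    have := hcc (some k) none (by simp)
    simp only [c, Option.elim, map_one] at this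
    exact this.pow
  obtain ⟨V, hV⟩ := h2.mul_dvd h1 hd1
  refine ⟨U, V, ?_, by rw [hV, ← hprod]; ring⟩
  have h3 : U.eval 1 - U₁.eval 1 = 0 := by
    obtain ⟨e, he⟩ := hU1
    rw [← eval_sub, he]
    simp
  rw [← hU₁]
  linear_combination h3

/-! ### A polynomial lattice in the module -/

theorem Pi_monic (d : Datum M ℂ) : d.Pi.Monic :=
  monic_prod_of_monic _ _ fun _ _ => (monic_X_sub_C _).pow _

theorem Pi_natDegree (d : Datum M ℂ) : d.Pi.natDegree = d.N := by
  rw [Pi, natDegree_prod_of_monic _ _ fun _ _ => (monic_X_sub_C _).pow _]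
  simp [N]

theorem T_mul_derivative_Pi (d : Datum M ℂ) : d.T * derivative d.Pi = d.mT * d.Pi := by
  rw [Pi, derivative_prod_finset, Finset.mul_sum, mT, Finset.sum_mul]
  refine Finset.sum_congr rfl fun k _ => ?_
  rw [← d.X_sub_mul_Tk k, derivative_X_sub_C_pow, ← Finset.mul_prod_erase _ _ (Finset.mem_univ k)]
  cases d.m k with
  | zero => simp
  | succ n => rw [Nat.add_sub_cancel, pow_succ]; push_cast; simp; ring

theorem derivative_X_sub_one_pow (i : ℕ) :
    (X - 1) * derivative ((X - 1 : ℂ[X]) ^ i) = (i : ℂ[X]) * (X - 1) ^ i := by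
  have := derivative_X_sub_C_pow (1 : ℂ) i
  rw [map_one] at this
  rw [this]
  cases i with
  | zero => simp
  | succ n => simp; ring

/-- The element `A y / Π + z (z - 1) B y' / Π` of the module. -/
def iota (d : Datum M ℂ) (A B : ℂ[X]) : RatFunc ℂ × RatFunc ℂ :=
  (algebraMap ℂ[X] (RatFunc ℂ) A / algebraMap ℂ[X] (RatFunc ℂ) d.Pi,
    algebraMap ℂ[X] (RatFunc ℂ) (X * (X - 1) * B) / algebraMap ℂ[X] (RatFunc ℂ) d.Pi)

theorem iota_add (d : Datum M ℂ) (A B A' B' : ℂ[X]) :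
    d.iota (A + A') (B + B') = d.iota A B + d.iota A' B' := by
  ext <;> simp [iota] <;> ring

theorem iota_smul (d : Datum M ℂ) (f A B : ℂ[X]) :
    d.iota (f * A) (f * B) = algebraMap ℂ[X] (RatFunc ℂ) f • d.iota A B := by
  ext
  · simp only [iota, map_mul, Prod.smul_fst, smul_eq_mul, mul_div_assoc]
  · simp only [iota, map_mul, Prod.smul_snd, smul_eq_mul]; ring

theorem iota_ne_zero (d : Datum M ℂ) {A B : ℂ[X]} (h : A ≠ 0 ∨ B ≠ 0) : d.iota A B ≠ 0 := by
  intro h0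
  have hPi := RatFunc.algebraMap_ne_zero d.Pi_monic.ne_zero
  have h1 := congrArg Prod.fst h0
  have h2 := congrArg Prod.snd h0
  simp only [iota, Prod.fst_zero, Prod.snd_zero, div_eq_zero_iff, hPi, or_false] at h1 h2
  rw [map_eq_zero_iff _ (RatFunc.algebraMap_injective ℂ)] at h1 h2
  have hX1 : (X - 1 : ℂ[X]) ≠ 0 := by simpa using X_sub_C_ne_zero (1 : ℂ)
  simp [X_ne_zero, hX1] at h2
  tauto

/-- The coefficients of `z (z - 1) d/dz` applied to `iota A B`. -/
structure IsStep (d : Datum M ℂ) (A B A' B' : ℂ[X]) : Prop where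
  fst : d.T * A' = d.T * (X * (X - 1) * derivative A) - X * (X - 1) * d.mT * A
    - X * (X - 1) * d.S * B
  snd : B' = A + X * (X - 1) * derivative B - d.lin * B

/-- The logarithmic derivative of `Π` is `mT / T`; this cancels the part of the coefficient of
`d/dz` that has poles at the `t_k`, so the second component needs no division by `T`. -/
theorem IsStep.nabla_iota {d : Datum M ℂ} {A B A' B' : ℂ[X]} (h : d.IsStep A B A' B') :
    algebraMap ℂ[X] (RatFunc ℂ) (X * (X - 1)) • nabla d.P d.Q (d.iota A B) = d.iota A' B' := by
  have hPi := RatFunc.algebraMap_ne_zero d.Pi_monic.ne_zero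
  have hT := RatFunc.algebraMap_ne_zero d.T_monic.ne_zero
  have hX : algebraMap ℂ[X] (RatFunc ℂ) (X * (X - 1)) ≠ 0 := RatFunc.algebraMap_ne_zero
    (mul_ne_zero X_ne_zero (by simpa using X_sub_C_ne_zero (1 : ℂ)))
  obtain ⟨x, hx⟩ : ∃ x, algebraMap ℂ[X] (RatFunc ℂ) (X * (X - 1)) = x := ⟨_, rfl⟩
  let φ := algebraMap ℂ[X] (RatFunc ℂ)
  have hφ : algebraMap ℂ[X] (RatFunc ℂ) 2 = 2 := map_ofNat _ 2
  have h1 : φ d.T * φ (derivative d.Pi) = φ d.mT * φ d.Pi := by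
    simpa using congrArg φ d.T_mul_derivative_Pi
  have h2 : φ d.T * φ A' = φ d.T * (x * φ (derivative A)) - x * φ d.mT * φ A - x * φ d.S * φ B := by
    simpa [← hx, φ] using congrArg φ h.fst
  have h3 : φ B' = φ A + x * φ (derivative B) - φ d.lin * φ B := by
    simpa [← hx, φ] using congrArg φ h.snd
  have h4 : φ d.p = (φ d.lin + 2 * φ X - 1) * φ d.T - x * φ d.mT := by
    simpa [← hx, φ, hφ] using congrArg φ d.p_eq
  have h5 : φ (derivative (X * (X - 1) * B)) = (2 * φ X - 1) * φ B + x * φ (derivative B) := by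
    rw [← hx, ← map_mul φ, derivative_mul, show derivative (X * (X - 1) : ℂ[X]) = 2 * X - 1 by
      simp; ring]
    simp [φ, hφ]
  have hq : φ d.q = x * φ d.T := by rw [← hx, ← map_mul]; rfl
  rw [hx] at hX
  ext
  · simp only [iota, nabla_apply, Prod.smul_fst, smul_eq_mul, Q]
    rw [ddz_div _ _ hPi, ddz_algebraMap, ddz_algebraMap, map_mul _ (X * (X - 1)) B]
    change _ = φ A' / φ d.Pi
    rw [hx]
    change x * ((φ d.Pi * φ (derivative A) - φ A * φ (derivative d.Pi)) / φ d.Pi ^ 2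
      - φ d.S / φ d.q * (x * φ B / φ d.Pi)) = _
    rw [hq]
    change φ d.Pi ≠ 0 at hPi
    change φ d.T ≠ 0 at hT
    field_simp
    linear_combination -(φ d.Pi) * h2 - x * φ A * h1
  · simp only [iota, nabla_apply, Prod.smul_snd, smul_eq_mul, P]
    rw [ddz_div _ _ hPi, ddz_algebraMap, ddz_algebraMap]
    change _ = φ (X * (X - 1) * B') / φ d.Pi
    change φ (X * (X - 1)) * (φ A / φ d.Pi + (φ d.Pi * φ (derivative (X * (X - 1) * B))
      - φ (X * (X - 1) * B) * φ (derivative d.Pi)) / φ d.Pi ^ 2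
      - φ d.p / φ d.q * (φ (X * (X - 1) * B) / φ d.Pi)) = _
    rw [map_mul φ _ B, map_mul φ _ B', show φ (X * (X - 1)) = x from hx, hq, h5, h3, h4]
    change φ d.Pi ≠ 0 at hPi
    change φ d.T ≠ 0 at hT
    field_simp
    linear_combination -x * φ B * h1

/-- `z (z - 1) d/dz` acts on pairs `(A, B)` with `A + U B` divisible by `Π (z - 1) ^ i`. -/
theorem exists_step (d : Datum M ℂ) {U V : ℂ[X]} {i : ℕ}
    (hV : d.ric U = d.T * (d.Pi * (X - 1) ^ i) * V) {A B D : ℂ[X]}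
    (hA : A = d.Pi * (X - 1) ^ i * D - U * B) :
    ∃ A' B' D', d.IsStep A B A' B' ∧ A' = d.Pi * (X - 1) ^ i * D' - U * B' ∧
      D' = X * (X - 1) * derivative D + (U + (i : ℂ[X]) * X) * D - V * B := by
  refine ⟨_, _, _, ⟨?_, rfl⟩, rfl, rfl⟩
  have h1 := d.T_mul_derivative_Pi
  have h2 := derivative_X_sub_one_pow i
  subst hA
  rw [ric] at hV
  simp only [derivative_sub, derivative_mul]
  linear_combination B * hV - (X * (X - 1) * (X - 1) ^ i * D) * h1 - d.T * X * d.Pi * D * h2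

theorem lin_natDegree (d : Datum M ℂ) : d.lin.natDegree ≤ 1 := by
  rw [show d.lin = C (d.γ + d.δ - 2) * X + C (1 - d.γ) by
    simp [lin, C_ofNat]; ring]
  exact natDegree_linear_le

theorem lin_coeff (d : Datum M ℂ) : d.lin.coeff 1 = d.α + d.β + d.N - 1 := by
  rw [show d.lin = C (d.γ + d.δ - 2) * X + C (1 - d.γ) by
    simp [lin, C_ofNat]; ring]
  rw [coeff_add, coeff_C_mul, coeff_X_one, coeff_C_of_ne_zero one_ne_zero, δ]
  ring

theorem XX1_natDegree : (X * (X - 1) : ℂ[X]).natDegree ≤ 2 := by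
  refine natDegree_mul_le.trans ?_
  have h1 : (X - 1 : ℂ[X]).natDegree ≤ 1 := by simpa using natDegree_X_sub_C_le (1 : ℂ)
  rw [natDegree_X]; omega

theorem XX1_coeff : (X * (X - 1) : ℂ[X]).coeff 2 = 1 := by
  rw [show 2 = 1 + 1 from rfl, coeff_X_mul]; simp [coeff_one]

theorem XX1_mul_derivative_natDegree {A : ℂ[X]} {n : ℕ} (hA : A.natDegree ≤ n) :
    (X * (X - 1) * derivative A).natDegree ≤ n + 1 ∧
      (X * (X - 1) * derivative A).coeff (n + 1) = n * A.coeff n := by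
  rcases Nat.eq_zero_or_pos n with h | h
  · subst h
    rw [natDegree_eq_zero.1 (Nat.le_zero.1 hA) |>.choose_spec.symm]; simp
  · have h1 : (derivative A).natDegree ≤ n - 1 := (natDegree_derivative_le A).trans (by omega)
    have h2 := XX1_natDegree
    refine ⟨natDegree_mul_le.trans (by omega), ?_⟩
    rw [show n + 1 = 2 + (n - 1) by omega, coeff_mul_add_eq_of_natDegree_le h2 h1, XX1_coeff,
      coeff_derivative, ← Nat.cast_add_one, show n - 1 + 1 = n by omega]
    ring

theorem XX1_mul_mT (d : Datum M ℂ) : (X * (X - 1) * d.mT).natDegree ≤ M + 1 ∧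
    (X * (X - 1) * d.mT).coeff (M + 1) = (d.N : ℂ) := by
  rcases Nat.eq_zero_or_pos M with h | h
  · subst h; simp [mT, N]
  · have h1 := d.mT_natDegree
    have h2 := XX1_natDegree
    refine ⟨natDegree_mul_le.trans (by omega), ?_⟩
    rw [show M + 1 = 2 + (M - 1) by omega, coeff_mul_add_eq_of_natDegree_le h2 h1, XX1_coeff,
      mT_coeff, one_mul]

/-- The operator `z(z-1) d/dz` raises degrees by one. The top coefficients transform by a matrix
depending only on the data at infinity: `αβ` is the top coefficient of `S`, and `α + β + N - 1` that
of `lin`. -/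
theorem IsStep.natDegree {d : Datum M ℂ} {A B A' B' : ℂ[X]} (h : d.IsStep A B A' B') {n : ℕ}
    (hA : A.natDegree ≤ n + 1) (hB : B.natDegree ≤ n) :
    A'.natDegree ≤ n + 2 ∧ B'.natDegree ≤ n + 1 ∧
      A'.coeff (n + 2) = (n + 1 - d.N) * A.coeff (n + 1) - d.α * d.β * B.coeff n ∧
      B'.coeff (n + 1) = A.coeff (n + 1) + (n - (d.α + d.β + d.N - 1)) * B.coeff n := by
  obtain ⟨a1, a2⟩ := XX1_mul_derivative_natDegree hA
  obtain ⟨b1, b2⟩ := XX1_mul_derivative_natDegree hB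
  obtain ⟨m1, m2⟩ := d.XX1_mul_mT
  have t1 := d.T_natDegree
  have s1 : (X * (X - 1) * d.S).natDegree ≤ M + 2 := by
    have := d.S_natDegree
    have := XX1_natDegree
    exact natDegree_mul_le.trans (by omega)
  have s2 : (X * (X - 1) * d.S).coeff (M + 2) = d.α * d.β := by
    rw [add_comm M 2, coeff_mul_add_eq_of_natDegree_le XX1_natDegree d.S_natDegree, XX1_coeff,
      S_coeff, one_mul]
  have l1 := d.lin_natDegree
  have hB1 : B'.natDegree ≤ n + 1 := by
    rw [h.snd]
    refine (natDegree_sub_le _ _).trans (max_le ((natDegree_add_le _ _).trans (max_le hA b1)) ?_)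
    exact natDegree_mul_le.trans (by omega)
  have hB2 : B'.coeff (n + 1) = A.coeff (n + 1) + (n - (d.α + d.β + d.N - 1)) * B.coeff n := by
    rw [h.snd, coeff_sub, coeff_add, b2, add_comm n 1, coeff_mul_add_eq_of_natDegree_le l1 hB,
      lin_coeff]
    ring
  have hT : (d.T * A').natDegree ≤ M + (n + 2) := by
    rw [h.fst]
    refine (natDegree_sub_le _ _).trans (max_le ((natDegree_sub_le _ _).trans (max_le ?_ ?_)) ?_)
      <;> exact natDegree_mul_le.trans (by omega)
  have hA1 : A'.natDegree ≤ n + 2 := by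
    by_cases h0 : A' = 0
    · simp [h0]
    rw [d.T_monic.natDegree_mul' h0] at hT
    omega
  refine ⟨hA1, hB1, ?_, hB2⟩
  have hc := congrArg (fun f => coeff f (M + (n + 2))) h.fst
  simp only [coeff_sub] at hc
  rw [coeff_mul_add_eq_of_natDegree_le t1.le hA1, coeff_mul_add_eq_of_natDegree_le t1.le a1, a2,
    T_coeff, show M + (n + 2) = (M + 1) + (n + 1) by ring,
    coeff_mul_add_eq_of_natDegree_le m1 hA, m2, show M + 1 + (n + 1) = (M + 2) + n by ring,
    coeff_mul_add_eq_of_natDegree_le s1 hB, s2] at hc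
  push_cast at hc
  linear_combination hc

theorem finrank_degreeLT (n : ℕ) : Module.finrank ℂ (degreeLT ℂ n) = n := by
  rw [(degreeLTEquiv ℂ n).finrank_eq]; simp

theorem mem_degreeLT_succ_iff {n : ℕ} {A : ℂ[X]} : A ∈ degreeLT ℂ (n + 1) ↔ A.natDegree ≤ n := by
  rw [mem_degreeLT, natDegree_le_iff_degree_le, degree_lt_iff_coeff_zero,
    degree_le_iff_coeff_zero]
  exact ⟨fun h m hm => h m (by exact_mod_cast hm), fun h m hm => h m (by exact_mod_cast hm)⟩

instance (n : ℕ) : Module.Finite ℂ (degreeLT ℂ n) :=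
  Module.Finite.equiv (degreeLTEquiv ℂ n).symm

/-- There is a nonzero pair of polynomials satisfying the divisibility condition, by counting
dimensions. -/
theorem exists_section (Om U : ℂ[X]) (hOm : Om.Monic) (n : ℕ) (hdeg : Om.natDegree = 2 * (n + 1)) :
    ∃ A B D : ℂ[X], (A ≠ 0 ∨ B ≠ 0) ∧ A.natDegree ≤ n + 1 ∧ B.natDegree ≤ n ∧
      A = Om * D - U * B := by
  -- Reduction of `A + U B` modulo `Om`: a linear map from dimension `2n + 3` to dimension `2n + 2`.
  let φ : (degreeLT ℂ (n + 2) × degreeLT ℂ (n + 1)) →ₗ[ℂ] degreeLT ℂ (2 * (n + 1)) :=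
    LinearMap.codRestrict _ ((modByMonicHom Om).comp
      ((degreeLT ℂ (n + 2)).subtype.coprod
        ((LinearMap.mulLeft ℂ U).comp (degreeLT ℂ (n + 1)).subtype))) fun w => by
      rw [mem_degreeLT, ← hdeg, ← degree_eq_natDegree hOm.ne_zero]
      exact degree_modByMonic_lt _ hOm
  have hker : LinearMap.ker φ ≠ ⊥ := LinearMap.ker_ne_bot_of_finrank_lt (by
    rw [Module.finrank_prod, finrank_degreeLT, finrank_degreeLT, finrank_degreeLT]; omega)
  obtain ⟨⟨A, B⟩, hw, hne⟩ := (Submodule.ne_bot_iff _).1 hker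
  have h1 : (A.1 + U * B.1) %ₘ Om = 0 := by
    have := congrArg Subtype.val (LinearMap.mem_ker.1 hw)
    simpa [φ] using this
  obtain ⟨D, hD⟩ := (modByMonic_eq_zero_iff_dvd hOm).1 h1
  refine ⟨A.1, B.1, D, ?_, mem_degreeLT_succ_iff.1 A.2, mem_degreeLT_succ_iff.1 B.2, ?_⟩
  · by_contra! h
    exact hne (Prod.ext (Subtype.ext h.1) (Subtype.ext h.2))
  · linear_combination hD

theorem X_mul_X_sub_one_dvd {f : ℂ[X]} (h0 : f.eval 0 = 0) (h1 : f.eval 1 = 0) :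
    X * (X - 1) ∣ f := by
  have hc : IsCoprime (X - C (0 : ℂ)) (X - C (1 : ℂ)) :=
    isCoprime_X_sub_C_of_isUnit_sub (by simp)
  have := hc.mul_dvd (dvd_iff_isRoot.2 h0) (dvd_iff_isRoot.2 h1)
  simpa using this

/-! ### The hypergeometric section -/

/-- The action of `z d/dz` on the module of `d`. -/
def θ (d : Datum M ℂ) : Module.End ℂ (RatFunc ℂ × RatFunc ℂ) := theta d.P d.Q

theorem θ_apply (d : Datum M ℂ) (w : RatFunc ℂ × RatFunc ℂ) :
    d.θ w = (RatFunc.X : RatFunc ℂ) • nabla d.P d.Q w := rfl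

theorem θ_smul (d : Datum M ℂ) (f : RatFunc ℂ) (w : RatFunc ℂ × RatFunc ℂ) :
    d.θ (f • w) = (RatFunc.X * ddz f) • w + f • d.θ w := by
  rw [θ_apply, θ_apply, nabla_smul, smul_add, smul_smul, smul_smul, smul_smul, mul_comm _ f]

theorem X_sub_one_ne_zero : (RatFunc.X - 1 : RatFunc ℂ) ≠ 0 := by
  have : algebraMap ℂ[X] (RatFunc ℂ) (X - C 1) ≠ 0 :=
    RatFunc.algebraMap_ne_zero (X_sub_C_ne_zero 1)
  simpa using this

theorem IsStep.θ_iota {d : Datum M ℂ} {A B A' B' : ℂ[X]} (h : d.IsStep A B A' B') :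
    (RatFunc.X - 1 : RatFunc ℂ) • d.θ (d.iota A B) = d.iota A' B' := by
  rw [← h.nabla_iota, θ_apply, smul_smul]
  simp [mul_comm]

/-- For generic parameters, no nonzero polynomial in `z d/dz` annihilates a nonzero element. -/
theorem aeval_θ_ne_zero (d : Datum M ℂ) (hd : d.Distinct) (hg : d.Generic) (g : ℂ[X]) (hg0 : g ≠ 0)
    {w : RatFunc ℂ × RatFunc ℂ} (hw : w ≠ 0) : aeval d.θ g w ≠ 0 := by
  induction hn : g.natDegree generalizing g with
  | zero =>
    obtain ⟨c, rfl⟩ := natDegree_eq_zero.1 hn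
    have hc : c ≠ 0 := by simpa using hg0
    simpa [Module.algebraMap_end_apply] using smul_ne_zero hc hw
  | succ n ih =>
    -- Split off a linear factor of `g`. If the product annihilated `w`, the other factor applied to
    -- `w` would be an eigenvector of `θ`, spanning an invariant line.
    obtain ⟨a, ha⟩ := IsAlgClosed.exists_root g (fun h => by
      have := natDegree_eq_zero_iff_degree_le_zero.2 h.le; omega)
    obtain ⟨h, rfl⟩ := dvd_iff_isRoot.2 ha
    have h0 : h ≠ 0 := right_ne_zero_of_mul hg0
    have h1 := ih h h0 (by
      rw [(monic_X_sub_C a).natDegree_mul' h0, natDegree_X_sub_C] at hn; omega)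
    intro h2
    rw [map_mul, Module.End.mul_apply] at h2
    set G := aeval d.θ h w
    have h3 : d.θ G = RatFunc.C a • G := by
      have h4 : d.θ G - a • G = 0 := by simpa [Module.algebraMap_end_apply] using h2
      rw [sub_eq_zero.1 h4]
      ext <;> simp [RatFunc.smul_eq_C_mul]
    refine d.irreducible hd hg h1 ?_
    have hX : (RatFunc.X : RatFunc ℂ) ≠ 0 := RatFunc.X_ne_zero
    have h5 := congrArg Prod.fst h3
    have h6 := congrArg Prod.snd h3
    rw [θ_apply] at h5 h6
    simp only [Prod.smul_fst, Prod.smul_snd, smul_eq_mul] at h5 h6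
    refine mul_left_cancel₀ hX ?_
    linear_combination G.1 * h6 - G.2 * h5

theorem aeval_θ_mul_apply (d : Datum M ℂ) (a b : ℂ) (w : RatFunc ℂ × RatFunc ℂ) :
    aeval d.θ ((X + C a) * (X + C b)) w =
      d.θ (d.θ w) + RatFunc.C (a + b) • d.θ w + RatFunc.C (a * b) • w := by
  have h : ∀ (c : ℂ) (v : RatFunc ℂ × RatFunc ℂ), c • v = RatFunc.C c • v := fun c v => by
    ext <;> simp [RatFunc.smul_eq_C_mul]
  have h2 : (X + C a) * (X + C b) = X * X + C (a + b) * X + C (a * b) := by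
    simp only [C_add, C_mul]; ring
  rw [h2, map_add, map_add, map_mul, map_mul, aeval_X, aeval_C, aeval_C, LinearMap.add_apply,
    LinearMap.add_apply, Module.End.mul_apply, Module.End.mul_apply, Module.algebraMap_end_apply,
    Module.algebraMap_end_apply, h, h]

/-- A nonzero element of the lattice which satisfies the hypergeometric equation. -/
theorem exists_hypergeometric_section (d : Datum M ℂ) (hd : d.Distinct) (hg : d.Generic)
    (ha : ∀ k, d.ApparentAt k) {n : ℕ} (hN : d.N = n + 1) :
    ∃ U V A B D : ℂ[X], U.eval 1 = 1 - d.δ ∧ d.ric U = d.T * (d.Pi * (X - 1) ^ d.N) * V ∧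
      d.iota A B ≠ 0 ∧ A.natDegree ≤ n + 1 ∧ B.natDegree ≤ n ∧
      A = d.Pi * (X - 1) ^ d.N * D - U * B ∧
      aeval d.θ (X * (X + C (d.γ - 1))) (d.iota A B) =
        (RatFunc.X : RatFunc ℂ) • aeval d.θ ((X + C d.α) * (X + C d.β)) (d.iota A B) := by
  obtain ⟨U, V, hU1, hV⟩ := d.exists_ric hd hg.δ_ne ha
  set Om := d.Pi * (X - 1) ^ d.N with hOm
  have hX1m : (X - 1 : ℂ[X]).Monic := by simpa using monic_X_sub_C (1 : ℂ)
  have hX1d : (X - 1 : ℂ[X]).natDegree = 1 := by simpa using natDegree_X_sub_C (1 : ℂ)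
  have hOmm : Om.Monic := d.Pi_monic.mul (hX1m.pow _)
  have hOmd : Om.natDegree = 2 * (n + 1) := by
    rw [hOm, d.Pi_monic.natDegree_mul (hX1m.pow _), hX1m.natDegree_pow, hX1d, d.Pi_natDegree, hN]
    ring
  have hlin := d.lin_eval_one
  obtain ⟨A, B, D, hne, hA, hB, hABD⟩ := exists_section Om U hOmm n hOmd
  have hF0 : d.iota A B ≠ 0 := d.iota_ne_zero hne
  obtain ⟨A₁, B₁, D₁, hs, hABD₁, hD₁⟩ := d.exists_step hV hABD
  obtain ⟨A₂, B₂, D₂, hs', hABD₂, hD₂⟩ := d.exists_step hV hABD₁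
  rw [← hOm] at hABD₁ hABD₂
  obtain ⟨dA₁, dB₁, cA₁, cB₁⟩ := hs.natDegree hA hB
  obtain ⟨dA₂, dB₂, cA₂, cB₂⟩ := hs'.natDegree dA₁ dB₁
  -- Irreducibility: `F` and its derivative are independent over `ℂ(z)`.
  have hdet : A * B₁ - A₁ * B ≠ 0 := by
    intro h0
    refine d.irreducible hd hg hF0 ?_
    have hx : algebraMap ℂ[X] (RatFunc ℂ) (X * (X - 1)) ≠ 0 :=
      RatFunc.algebraMap_ne_zero (mul_ne_zero X_ne_zero hX1m.ne_zero)
    have e1 := congrArg Prod.fst hs.nabla_iota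
    have e2 := congrArg Prod.snd hs.nabla_iota
    simp only [Prod.smul_fst, Prod.smul_snd, smul_eq_mul] at e1 e2
    have h1 := congrArg (algebraMap ℂ[X] (RatFunc ℂ)) h0
    simp only [map_sub, map_mul, map_zero] at h1
    refine mul_left_cancel₀ hx ?_
    calc _ = (d.iota A B).1 * (d.iota A₁ B₁).2 - (d.iota A B).2 * (d.iota A₁ B₁).1 := by
          rw [← e1, ← e2]; ring
      _ = _ := by
          simp only [iota, map_mul]
          linear_combination (algebraMap ℂ[X] (RatFunc ℂ) X * algebraMap ℂ[X] (RatFunc ℂ) (X - 1)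
            / algebraMap ℂ[X] (RatFunc ℂ) d.Pi ^ 2) * h1
  -- the numerators of the hypergeometric expression
  set ℓ : ℂ[X] := d.lin - (d.N : ℂ[X]) * X with hℓ
  set s : ℂ[X] := C (d.α * d.β) * (X * (X - 1)) with hs_def
  -- The pair `NA, NB` represents `(z - 1)(z H₂(θ) - H₁(θ)) F`, and `ND` is its quotient by `Om` in
  -- the divisibility condition. The `-N z` in `ℓ` accounts for the shift of the exponent at `1` by
  -- `N`.
  set NA := A₂ + ℓ * A₁ + s * A with hNA
  set NB := B₂ + ℓ * B₁ + s * B with hNB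
  set ND := D₂ + ℓ * D₁ + s * D with hND
  have hN1 : NA = Om * ND - U * NB := by
    rw [hNA, hNB, hND, hABD, hABD₁, hABD₂]; ring
  have hℓd : ℓ.natDegree ≤ 1 := by
    refine (natDegree_sub_le _ _).trans (max_le d.lin_natDegree ?_)
    rw [← map_natCast (C : ℂ →+* ℂ[X])]
    exact (natDegree_C_mul_le _ _).trans natDegree_X.le
  have hℓc : ℓ.coeff 1 = d.α + d.β - 1 := by
    rw [hℓ, coeff_sub, lin_coeff, ← map_natCast (C : ℂ →+* ℂ[X]), coeff_C_mul, coeff_X_one]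
    ring
  have hsd : s.natDegree ≤ 2 := (natDegree_C_mul_le _ _).trans XX1_natDegree
  have hsc : s.coeff 2 = d.α * d.β := by rw [hs_def, coeff_C_mul, XX1_coeff, mul_one]
  rw [hN] at cA₁ cB₁ cA₂ cB₂
  push_cast at cA₁ cB₁ cA₂ cB₂
  have dNA : NA.natDegree ≤ n + 2 := by
    have h1 : NA.natDegree ≤ n + 3 := by
      refine (natDegree_add_le _ _).trans (max_le ((natDegree_add_le _ _).trans (max_le dA₂ ?_)) ?_)
        <;> exact natDegree_mul_le.trans (by omega)
    -- The degree drops because `H₂` has the same exponents `α`, `β` at infinity as the equation.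
    have h2 : NA.coeff (n + 3) = 0 := by
      rw [hNA, coeff_add, coeff_add, show n + 3 = 1 + (n + 2) by ring,
        coeff_mul_add_eq_of_natDegree_le hℓd dA₁, show 1 + (n + 2) = 2 + (n + 1) by ring,
        coeff_mul_add_eq_of_natDegree_le hsd hA, show 2 + (n + 1) = n + 1 + 2 by ring, cA₂, hℓc,
        hsc, cB₁, show n + 1 + 1 = n + 2 from rfl, cA₁]
      ring
    exact Nat.le_of_lt_succ (lt_of_le_of_ne h1 fun h => by
      have h3 : NA.leadingCoeff = 0 := by rw [leadingCoeff, h, h2]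
      rw [leadingCoeff_eq_zero.1 h3] at h
      simp at h)
  have dNB : NB.natDegree ≤ n + 1 := by
    have h1 : NB.natDegree ≤ n + 2 := by
      refine (natDegree_add_le _ _).trans (max_le ((natDegree_add_le _ _).trans (max_le dB₂ ?_)) ?_)
        <;> exact natDegree_mul_le.trans (by omega)
    have h2 : NB.coeff (n + 2) = 0 := by
      rw [hNB, coeff_add, coeff_add, show n + 2 = 1 + (n + 1) by ring,
        coeff_mul_add_eq_of_natDegree_le hℓd dB₁, show 1 + (n + 1) = 2 + n by ring,
        coeff_mul_add_eq_of_natDegree_le hsd hB, show 2 + n = n + 1 + 1 by ring, cB₂, hℓc,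
        hsc, cB₁, show n + 1 + 1 = n + 2 from rfl, cA₁]
      ring
    exact Nat.le_of_lt_succ (lt_of_le_of_ne h1 fun h => by
      have h3 : NB.leadingCoeff = 0 := by rw [leadingCoeff, h, h2]
      rw [leadingCoeff_eq_zero.1 h3] at h
      simp at h)
  -- divisibility at `0` and `1`
  have hT0 := d.T_eval_ne_zero hd.ne_zero
  have hT1 := d.T_eval_ne_zero hd.ne_one
  have hV0 : U.eval 0 ^ 2 + d.lin.eval 0 * U.eval 0 = Om.eval 0 * V.eval 0 := by
    have := congrArg (eval 0) hV
    simp only [ric, eval_add, eval_mul, eval_X, eval_pow, zero_mul, zero_add, add_zero] at this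
    exact mul_left_cancel₀ hT0 (by linear_combination this)
  have hV1 : U.eval 1 ^ 2 + d.lin.eval 1 * U.eval 1 = Om.eval 1 * V.eval 1 := by
    have := congrArg (eval 1) hV
    simp only [ric, eval_add, eval_sub, eval_mul, eval_X, eval_pow, eval_one, zero_mul, zero_add,
      add_zero, sub_self, mul_zero] at this
    exact mul_left_cancel₀ hT1 (by linear_combination this)
  have hB₁ := hs.snd
  have hB₂ := hs'.snd
  -- At `0` both equations have exponents `0` and `1 - γ`; formally this is the Riccati relation
  -- `hV0`.
  have hev0 : NB.eval 0 = 0 ∧ ND.eval 0 = 0 := by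
    have a0 := congrArg (eval 0) hABD
    have a1 := congrArg (eval 0) hABD₁
    have b1 := congrArg (eval 0) hB₁
    have b2 := congrArg (eval 0) hB₂
    have c1 := congrArg (eval 0) hD₁
    have c2 := congrArg (eval 0) hD₂
    simp only [eval_add, eval_sub, eval_mul, eval_X, eval_natCast, zero_mul, mul_zero, zero_add,
      add_zero] at a0 a1 b1 b2 c1 c2
    rw [hNB, hND]
    simp only [hℓ, hs_def, eval_add, eval_sub, eval_mul, eval_X, eval_natCast, zero_mul, mul_zero,
      add_zero, sub_zero]
    constructor
    · rw [b2, a1, b1, c1, a0]; linear_combination B.eval 0 * hV0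
    · rw [c2, c1, b1, a0]; linear_combination D.eval 0 * hV0
  -- At `1` the relation `U(1) = -lin(1)` is also needed, to absorb the terms with the factor `N`.
  have hev1 : NB.eval 1 = 0 ∧ ND.eval 1 = 0 := by
    have a0 := congrArg (eval 1) hABD
    have a1 := congrArg (eval 1) hABD₁
    have b1 := congrArg (eval 1) hB₁
    have b2 := congrArg (eval 1) hB₂
    have c1 := congrArg (eval 1) hD₁
    have c2 := congrArg (eval 1) hD₂
    simp only [eval_add, eval_sub, eval_mul, eval_X, eval_one, eval_natCast, zero_mul, mul_zero,
      zero_add, add_zero, sub_self, mul_one] at a0 a1 b1 b2 c1 c2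
    have hUl : U.eval 1 + d.lin.eval 1 = 0 := by rw [hlin, hU1]; ring
    rw [hNB, hND]
    simp only [hℓ, hs_def, eval_add, eval_sub, eval_mul, eval_X, eval_one, eval_natCast, zero_mul,
      mul_zero, add_zero, sub_self, mul_one]
    constructor
    · rw [b2, a1, b1, c1, a0]
      linear_combination B.eval 1 * hV1 + d.N * B.eval 1 * hUl
    · rw [c2, c1, b1, a0]
      linear_combination D.eval 1 * hV1 + d.N * D.eval 1 * hUl
  obtain ⟨b, hb⟩ := X_mul_X_sub_one_dvd hev0.1 hev1.1
  obtain ⟨g, hg'⟩ := X_mul_X_sub_one_dvd hev0.2 hev1.2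
  have hbig : (Om * (X * (X - 1))).natDegree = 2 * n + 4 := by
    rw [hOmm.natDegree_mul (monic_X.mul hX1m), monic_X.natDegree_mul hX1m, natDegree_X, hX1d, hOmd]
    ring
  -- The determinants below are divisible by `Om z (z - 1)`, of degree `2n + 4`, but have degree at
  -- most `2n + 3`.
  have hzero : ∀ f k : ℂ[X], f = Om * (X * (X - 1)) * k → f.natDegree ≤ 2 * n + 3 → f = 0 := by
    intro f k hf hfd
    by_contra h0
    have hk : k ≠ 0 := fun hk => h0 (by rw [hf, hk, mul_zero])
    rw [hf, (hOmm.mul (monic_X.mul hX1m)).natDegree_mul' hk, hbig] at hfd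
    omega
  have z1 : A * NB - NA * B = 0 := by
    refine hzero _ (D * b - g * B) ?_ ?_
    · rw [hN1, hABD, hb, hg']; ring
    · refine (natDegree_sub_le _ _).trans (max_le ?_ ?_) <;> exact natDegree_mul_le.trans (by omega)
  have z2 : A₁ * NB - NA * B₁ = 0 := by
    refine hzero _ (D₁ * b - g * B₁) ?_ ?_
    · rw [hN1, hABD₁, hb, hg']; ring
    · refine (natDegree_sub_le _ _).trans (max_le ?_ ?_) <;> exact natDegree_mul_le.trans (by omega)
  -- The vector `(NA, NB)` is proportional to both `(A, B)` and `(A₁, B₁)`, which are independent.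
  have hNB0 : NB = 0 := by
    refine (mul_eq_zero.1 ?_).resolve_right hdet
    linear_combination B₁ * z1 - B * z2
  have hNA0 : NA = 0 := by
    refine (mul_eq_zero.1 ?_).resolve_right hdet
    linear_combination A₁ * z1 - A * z2
  refine ⟨U, V, A, B, D, hU1, hV, hF0, hA, hB, hABD, ?_⟩
  have h1 := hs.θ_iota
  have h2 := hs'.θ_iota
  rw [← h1, θ_smul, map_sub, ddz_X, show ddz (1 : RatFunc ℂ) = 0 by simpa using ddz_C 1, sub_zero,
    mul_one] at h2
  set F := d.iota A B
  have h3 : d.iota A₂ B₂ + algebraMap ℂ[X] (RatFunc ℂ) ℓ • d.iota A₁ B₁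
      + algebraMap ℂ[X] (RatFunc ℂ) s • F = 0 := by
    rw [← iota_smul, ← iota_smul, ← iota_add, ← iota_add, ← hNA, ← hNB, hNA0, hNB0]
    simp [iota]
  rw [← h2, ← h1] at h3
  have hℓ' : algebraMap ℂ[X] (RatFunc ℂ) ℓ =
      RatFunc.C (d.α + d.β - 1) * RatFunc.X + RatFunc.C (1 - d.γ) := by
    have : ℓ = C (d.α + d.β - 1) * X + C (1 - d.γ) := by
      simp only [hℓ, lin, δ, map_add, map_sub, map_one, map_natCast]; ring
    rw [this]; simp
  have hs'' : algebraMap ℂ[X] (RatFunc ℂ) s =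
      RatFunc.C (d.α * d.β) * (RatFunc.X * (RatFunc.X - 1)) := by
    rw [hs_def]; simp
  have hX1 := X_sub_one_ne_zero
  have h4 := d.aeval_θ_mul_apply 0 (d.γ - 1) F
  rw [map_zero, add_zero, zero_add, zero_mul, map_zero, zero_smul, add_zero] at h4
  rw [h4, aeval_θ_mul_apply]
  rw [hℓ', hs''] at h3
  simp only [map_add, map_sub, map_one, map_mul] at h3 ⊢
  ext
  · have := congrArg Prod.fst h3
    simp only [Prod.fst_add, Prod.smul_fst, smul_eq_mul, Prod.fst_zero] at this ⊢
    refine mul_left_cancel₀ hX1 ?_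
    linear_combination -this
  · have := congrArg Prod.snd h3
    simp only [Prod.snd_add, Prod.smul_snd, smul_eq_mul, Prod.snd_zero] at this ⊢
    refine mul_left_cancel₀ hX1 ?_
    linear_combination -this

/-- The action of `z d/dz` on the lattice lowers the order of divisibility at `z = 1` by one. -/
theorem exists_θ_iota (d : Datum M ℂ) {U V : ℂ[X]} (hU1 : U.eval 1 = 1 - d.δ) {i n : ℕ}
    (hV : d.ric U = d.T * (d.Pi * (X - 1) ^ (i + 1)) * V) {A B D : ℂ[X]}
    (hA : A.natDegree ≤ n + 1) (hB : B.natDegree ≤ n)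
    (hD : A = d.Pi * (X - 1) ^ (i + 1) * D - U * B) :
    ∃ A' B' D' : ℂ[X], A'.natDegree ≤ n + 1 ∧ B'.natDegree ≤ n ∧
      A' = d.Pi * (X - 1) ^ i * D' - U * B' ∧ d.θ (d.iota A B) = d.iota A' B' := by
  obtain ⟨A₁, B₁, D₁, hs, hD₁, -⟩ := d.exists_step hV hD
  obtain ⟨dA₁, dB₁, -, -⟩ := hs.natDegree hA hB
  have hX1m : (X - 1 : ℂ[X]).Monic := by simpa using monic_X_sub_C (1 : ℂ)
  have hX1d : (X - 1 : ℂ[X]).natDegree = 1 := by simpa using natDegree_X_sub_C (1 : ℂ)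
  have hdvd : ∀ f : ℂ[X], f.eval 1 = 0 → X - 1 ∣ f := fun f hf => by
    simpa using dvd_iff_isRoot.2 hf
  -- Since `U(1) + lin(1) = 0`, the image under `z(z-1) d/dz` vanishes at `1`. Dividing by `z - 1`
  -- restores the degree bounds at the cost of one order of divisibility.
  have hB1 : B₁.eval 1 = 0 := by
    rw [hs.snd, hD]
    simp [lin_eval_one, hU1]
    ring
  have hA1 : A₁.eval 1 = 0 := by
    rw [hD₁]; simp [hB1]
  obtain ⟨A', rfl⟩ := hdvd _ hA1
  obtain ⟨B', rfl⟩ := hdvd _ hB1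
  have hdeg : ∀ (f : ℂ[X]) (k : ℕ), ((X - 1) * f).natDegree ≤ k + 1 → f.natDegree ≤ k := by
    intro f k h
    by_cases h0 : f = 0
    · simp [h0]
    rw [hX1m.natDegree_mul' h0, hX1d] at h
    omega
  refine ⟨A', B', D₁, hdeg _ _ dA₁, hdeg _ _ dB₁, ?_, ?_⟩
  · refine mul_left_cancel₀ hX1m.ne_zero ?_
    linear_combination hD₁
  · have h := hs.θ_iota
    rw [iota_smul] at h
    have hx : algebraMap ℂ[X] (RatFunc ℂ) (X - 1) = RatFunc.X - 1 := by simp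
    rw [hx] at h
    exact smul_right_injective _ X_sub_one_ne_zero h

/-- There is a nonzero element satisfying the hypergeometric equation whose image under a polynomial
of degree at most `N` in `z d/dz` is a multiple of the generator. -/
theorem exists_hypergeometric (d : Datum M ℂ) (hd : d.Distinct) (hg : d.Generic)
    (ha : ∀ k, d.ApparentAt k) {n : ℕ} (hN : d.N = n + 1) :
    ∃ (F : RatFunc ℂ × RatFunc ℂ) (E : ℂ[X]) (c : ℂ), F ≠ 0 ∧ E ≠ 0 ∧ E.natDegree ≤ d.N ∧
      aeval d.θ (X * (X + C (d.γ - 1))) F =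
        (RatFunc.X : RatFunc ℂ) • aeval d.θ ((X + C d.α) * (X + C d.β)) F ∧
      c ≠ 0 ∧ aeval d.θ E F = c • (1, 0) := by
  obtain ⟨U, V, A, B, D, hU1, hV, hF0, hA, hB, hD, hH⟩ :=
    d.exists_hypergeometric_section hd hg ha hN
  have hpow : ∀ j ≤ d.N, ∃ A' B' D' : ℂ[X], A'.natDegree ≤ n + 1 ∧ B'.natDegree ≤ n ∧
      A' = d.Pi * (X - 1) ^ (d.N - j) * D' - U * B' ∧
      (d.θ ^ j) (d.iota A B) = d.iota A' B' := by
    intro j hj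
    induction j with
    | zero => exact ⟨A, B, D, hA, hB, hD, rfl⟩
    | succ j ih =>
      obtain ⟨A', B', D', hA', hB', hD', hθ⟩ := ih (by omega)
      rw [show d.N - j = d.N - (j + 1) + 1 by omega] at hD'
      -- Only `N - j` orders at `1` remain after `j` steps; the surplus power of `z - 1` in the
      -- Riccati relation goes into `V`.
      obtain ⟨A'', B'', D'', h1, h2, h3, h4⟩ := d.exists_θ_iota (V := (X - 1) ^ j * V) hU1
        (by rw [hV, show d.N = d.N - (j + 1) + 1 + j by omega, pow_add _ _ j]
            rw [show d.N - (j + 1) + 1 + j - (j + 1) = d.N - (j + 1) by omega]; ring) hA' hB' hD'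
      exact ⟨A'', B'', D'', h1, h2, h3, by rw [pow_succ', Module.End.mul_apply, hθ, h4]⟩
  choose! a b e ha' hb' he' hθ using hpow
  -- There are `N + 1` second components in a space of dimension `n + 1 = N`; the dependence
  -- coefficients become those of `E`.
  have hdep : ¬ LinearIndependent ℂ (fun j : Fin (d.N + 1) =>
      (⟨b j, by rw [mem_degreeLT_succ_iff]; exact hb' j (by omega)⟩ : degreeLT ℂ (n + 1))) := by
    intro h
    have := h.fintype_card_le_finrank
    rw [finrank_degreeLT, Fintype.card_fin] at this
    omega
  obtain ⟨x, hx, j₀, hj₀⟩ := Fintype.not_linearIndependent_iff.1 hdep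
  have hx' : ∑ j : Fin (d.N + 1), C (x j) * b j = 0 := by
    have := congrArg Subtype.val hx
    simpa [smul_eq_C_mul] using this
  set E : ℂ[X] := ∑ j : Fin (d.N + 1), C (x j) * X ^ (j : ℕ) with hE
  have hEc : ∀ j : Fin (d.N + 1), E.coeff j = x j := fun j => by
    rw [hE, finsetSum_coeff, Finset.sum_eq_single j]
    · simp
    · intro i _ hij
      rw [coeff_C_mul, coeff_X_pow, if_neg (fun h => hij (Fin.ext h.symm)), mul_zero]
    · simp
  have hE0 : E ≠ 0 := fun h => hj₀ (by rw [← hEc, h, coeff_zero])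
  have hEd : E.natDegree ≤ d.N := natDegree_sum_le_of_forall_le _ _ fun j _ =>
    (natDegree_C_mul_X_pow_le _ _).trans (by omega)
  have hEF : aeval d.θ E (d.iota A B) = d.iota (∑ j : Fin (d.N + 1), C (x j) * a j) 0 := by
    have h1 : ∀ s : Finset (Fin (d.N + 1)), d.iota (∑ j ∈ s, C (x j) * a j)
        (∑ j ∈ s, C (x j) * b j) = ∑ j ∈ s, x j • d.iota (a j) (b j) := by
      intro s
      induction s using Finset.induction_on with
      | empty => simp [iota]
      | insert i s hi ih =>
        rw [Finset.sum_insert hi, Finset.sum_insert hi, Finset.sum_insert hi, iota_add, ih,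
          iota_smul]
        congr 1
        ext <;> simp [RatFunc.smul_eq_C_mul]
    rw [← hx', h1, hE, map_sum, LinearMap.sum_apply]
    refine Finset.sum_congr rfl fun j _ => ?_
    rw [← hθ j (by omega)]
    simp [Module.algebraMap_end_apply]
  -- With vanishing second component the divisibility condition says that `Π` divides the first,
  -- whose degree is at most `N = deg Π`. Hence the quotient is a constant.
  have hPid : d.Pi ∣ ∑ j : Fin (d.N + 1), C (x j) * a j := by
    have h1 : ∑ j : Fin (d.N + 1), C (x j) * a j
        = ∑ j : Fin (d.N + 1), d.Pi * (C (x j) * (X - 1) ^ (d.N - j) * e j)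
          - U * ∑ j : Fin (d.N + 1), C (x j) * b j := by
      rw [Finset.mul_sum, ← Finset.sum_sub_distrib]
      refine Finset.sum_congr rfl fun j _ => ?_
      rw [he' j (by omega)]; ring
    rw [h1, hx', mul_zero, sub_zero, ← Finset.mul_sum]
    exact dvd_mul_right _ _
  obtain ⟨f, hf⟩ := hPid
  have hfd : f.natDegree = 0 := by
    by_cases h0 : f = 0
    · simp [h0]
    have h1 : (∑ j : Fin (d.N + 1), C (x j) * a j).natDegree ≤ d.N :=
      natDegree_sum_le_of_forall_le _ _ fun j _ =>
        (natDegree_C_mul_le _ _).trans ((ha' j (by omega)).trans hN.ge)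
    rw [hf, d.Pi_monic.natDegree_mul' h0, d.Pi_natDegree] at h1
    omega
  obtain ⟨c, rfl⟩ := natDegree_eq_zero.1 hfd
  have hc : aeval d.θ E (d.iota A B) = c • (1, 0) := by
    rw [hEF, hf]
    have hPi := RatFunc.algebraMap_ne_zero d.Pi_monic.ne_zero
    ext
    · simp [iota, RatFunc.smul_eq_C_mul, hPi]
    · simp [iota]
  refine ⟨_, E, c, hF0, hE0, hEd, hH, ?_, hc⟩
  rintro rfl
  rw [zero_smul] at hc
  exact d.aeval_θ_ne_zero hd hg E hE0 hF0 hc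

/-! ### Linear conditions on the Euler polynomial -/

section Conditions

variable {A : Type*} [CommRing A]

/-- The indicial polynomial at the origin. -/
def H₁ (d : Datum M A) : A[X] := X * (X + C (d.γ - 1))

/-- The indicial polynomial at infinity. -/
def H₂ (d : Datum M A) : A[X] := (X + C d.α) * (X + C d.β)

/-- `(z - 1) ^ j T ^ j` times the `j`-th power of `z d/dz` applied to the generator. -/
def thetaIter (d : Datum M A) : ℕ → A[X] × A[X]
  | 0 => (1, 0)
  | j + 1 =>
    (d.q * derivative (d.thetaIter j).1 - d.S * (d.thetaIter j).2
        - (j : A[X]) * X * derivative ((X - 1) * d.T) * (d.thetaIter j).1,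
      d.q * ((d.thetaIter j).1 + derivative (d.thetaIter j).2) - d.p * (d.thetaIter j).2
        - (j : A[X]) * X * derivative ((X - 1) * d.T) * (d.thetaIter j).2)

/-- The coefficient of `(z d/dz) ^ j` in `H₁ E(· - 1) - z H₂ E(· + 1)`. -/
def opCoeff (d : Datum M A) (E : A[X]) (j : ℕ) : A[X] :=
  C ((d.H₁ * E.comp (X - 1)).coeff j) - X * C ((d.H₂ * E.comp (X + 1)).coeff j)

/-- The remainder of the division of the hypergeometric operator with Euler polynomial `E` by the
second order operator, without its denominator. -/
def rem (d : Datum M A) (E : A[X]) : A[X] × A[X] :=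
  (∑ j ∈ Finset.range (d.N + 3),
      d.opCoeff E j * ((X - 1) * d.T) ^ (d.N + 2 - j) * (d.thetaIter j).1,
    ∑ j ∈ Finset.range (d.N + 3),
      d.opCoeff E j * ((X - 1) * d.T) ^ (d.N + 2 - j) * (d.thetaIter j).2)

/-- The second order operator times `z ^ 2` is the sum over `j` of `z ^ j` times this polynomial in
`z d/dz`, up to the factor `(z - 1) T`. -/
def eulerPart (d : Datum M A) (j : ℕ) : A[X] :=
  C (((X - 1) * d.T).coeff j) * (X ^ 2 - X) + C (d.p.coeff j) * X + C ((X * d.S).coeff j)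

/-- The factor which turns a multiple of `z ^ j` of a hypergeometric function into the function. -/
def shiftFactor (d : Datum M A) (j : ℕ) : A[X] :=
  (∏ i ∈ Finset.range j, d.H₁.comp (X - (i : A[X]))) *
    ∏ i ∈ Finset.Ico j (M + 1), d.H₂.comp (X - ((i + 1 : ℕ) : A[X]))

/-- The polynomial in `z d/dz` which has to annihilate the hypergeometric section. -/
def indicial (d : Datum M A) (E : A[X]) : A[X] :=
  ∑ j ∈ Finset.range (M + 2), (d.eulerPart j * E).comp (X - (j : A[X])) * d.shiftFactor j

end Conditions

/-! ### Commutation of `z` and `θ`, and the identities forced on the Euler polynomial -/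

theorem θ_mul_smulOp_X (d : Datum M ℂ) :
    d.θ * smulOp RatFunc.X = smulOp RatFunc.X * (d.θ + 1) := by
  refine LinearMap.ext fun w => ?_
  simp only [Module.End.mul_apply, smulOp_apply, LinearMap.add_apply, Module.End.one_apply, θ_smul,
    ddz_X, mul_one, smul_add]
  rw [add_comm]

theorem aeval_θ_X_smul (d : Datum M ℂ) (g : ℂ[X]) (w : RatFunc ℂ × RatFunc ℂ) :
    aeval d.θ g ((RatFunc.X : RatFunc ℂ) • w)
      = (RatFunc.X : RatFunc ℂ) • aeval d.θ (g.comp (X + 1)) w := by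
  have h : aeval d.θ g * smulOp RatFunc.X = smulOp RatFunc.X * aeval (d.θ + 1) g := by
    induction g using Polynomial.induction_on' with
    | add a b ha hb => rw [map_add, map_add, add_mul, mul_add, ha, hb]
    | monomial n a =>
      have hp : d.θ ^ n * smulOp RatFunc.X = smulOp RatFunc.X * (d.θ + 1) ^ n := by
        induction n with
        | zero => simp
        | succ n ih => rw [pow_succ, mul_assoc, θ_mul_smulOp_X, ← mul_assoc, ih, mul_assoc,
            ← pow_succ]
      rw [aeval_monomial, aeval_monomial, mul_assoc, hp, ← mul_assoc,
        Algebra.commutes, mul_assoc]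
  have h1 := LinearMap.congr_fun h w
  simp only [Module.End.mul_apply, smulOp_apply] at h1
  rw [h1, aeval_comp]
  simp

theorem aeval_θ_X_pow_smul (d : Datum M ℂ) (g : ℂ[X]) (j : ℕ) (w : RatFunc ℂ × RatFunc ℂ) :
    aeval d.θ g ((RatFunc.X ^ j : RatFunc ℂ) • w)
      = (RatFunc.X ^ j : RatFunc ℂ) • aeval d.θ (g.comp (X + (j : ℂ[X]))) w := by
  induction j generalizing g with
  | zero => simp
  | succ j ih =>
    rw [pow_succ', mul_smul, aeval_θ_X_smul, ih, comp_assoc, mul_smul]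
    simp [add_assoc]

/-- Leibniz rule for `r^j`, arranged to match the recursion of `thetaIter` with `r = (z - 1) T`. -/
theorem pow_smul_θ (d : Datum M ℂ) (r : ℂ[X]) (j : ℕ) (w : RatFunc ℂ × RatFunc ℂ) :
    algebraMap ℂ[X] (RatFunc ℂ) (r ^ (j + 1)) • d.θ w
      = algebraMap ℂ[X] (RatFunc ℂ) r • d.θ (algebraMap ℂ[X] (RatFunc ℂ) (r ^ j) • w)
        - algebraMap ℂ[X] (RatFunc ℂ) ((j : ℂ[X]) * X * derivative r) •
          algebraMap ℂ[X] (RatFunc ℂ) (r ^ j) • w := by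
  have h1 : algebraMap ℂ[X] (RatFunc ℂ) r * (RatFunc.X * ddz (algebraMap ℂ[X] (RatFunc ℂ) (r ^ j)))
      = algebraMap ℂ[X] (RatFunc ℂ) ((j : ℂ[X]) * X * derivative r) *
        algebraMap ℂ[X] (RatFunc ℂ) (r ^ j) := by
    rw [ddz_algebraMap, ← RatFunc.algebraMap_X, ← map_mul, ← map_mul, ← map_mul, derivative_pow]
    congr 1
    cases j with
    | zero => simp
    | succ j => rw [Nat.add_sub_cancel, pow_succ, map_natCast]; ring
  rw [θ_smul, smul_add, smul_smul, smul_smul, smul_smul, h1, ← map_mul _ r, ← pow_succ',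
    add_sub_cancel_left]

theorem thetaIter_spec (d : Datum M ℂ) (j : ℕ) :
    algebraMap ℂ[X] (RatFunc ℂ) (((X - 1) * d.T) ^ j) • (d.θ ^ j) (1, 0)
      = (algebraMap ℂ[X] (RatFunc ℂ) (d.thetaIter j).1,
          algebraMap ℂ[X] (RatFunc ℂ) (d.thetaIter j).2) := by
  induction j with
  | zero => simp [thetaIter]
  | succ j ih =>
    have hq : d.q = X * ((X - 1) * d.T) := by rw [q, mul_assoc]
    have hq' := d.q_ne_zero
    set r := (X - 1) * d.T with hr
    rw [pow_succ' d.θ, Module.End.mul_apply, pow_smul_θ, ih, θ_apply, nabla_apply]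
    have e1 : algebraMap ℂ[X] (RatFunc ℂ) d.q * d.Q = algebraMap ℂ[X] (RatFunc ℂ) d.S := by
      rw [Q]; field_simp
    have e2 : algebraMap ℂ[X] (RatFunc ℂ) d.q * d.P = algebraMap ℂ[X] (RatFunc ℂ) d.p := by
      rw [P]; field_simp
    have e3 : algebraMap ℂ[X] (RatFunc ℂ) d.q = RatFunc.X * algebraMap ℂ[X] (RatFunc ℂ) r := by
      rw [hq, map_mul, RatFunc.algebraMap_X]
    ext
    · simp only [thetaIter, ddz_algebraMap, Prod.fst_sub, Prod.smul_fst, smul_eq_mul, map_sub,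
        map_mul, ← hr]
      rw [← e1, e3]
      ring
    · simp only [thetaIter, ddz_algebraMap, Prod.snd_sub, Prod.smul_snd, smul_eq_mul, map_sub,
        map_mul, map_add, ← hr]
      rw [← e2, e3]
      ring

theorem H_mul_natDegree (d : Datum M ℂ) {E : ℂ[X]} {n : ℕ} (hE : E.natDegree ≤ n) :
    (d.H₁ * E.comp (X - 1)).natDegree ≤ n + 2 ∧ (d.H₂ * E.comp (X + 1)).natDegree ≤ n + 2 := by
  have h1 : (E.comp (X - 1)).natDegree ≤ n := by
    rw [natDegree_comp, show (X - 1 : ℂ[X]) = X - C 1 by simp, natDegree_X_sub_C, mul_one]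
    exact hE
  have h2 : (E.comp (X + 1)).natDegree ≤ n := by
    rw [natDegree_comp, show (X + 1 : ℂ[X]) = X + C 1 by simp, natDegree_X_add_C, mul_one]
    exact hE
  have h3 : d.H₁.natDegree ≤ 2 := by
    rw [H₁, monic_X.natDegree_mul (monic_X_add_C _), natDegree_X, natDegree_X_add_C]
  have h4 : d.H₂.natDegree ≤ 2 := by
    rw [H₂, (monic_X_add_C _).natDegree_mul (monic_X_add_C _), natDegree_X_add_C,
      natDegree_X_add_C]
  exact ⟨natDegree_mul_le.trans (by omega), natDegree_mul_le.trans (by omega)⟩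

theorem rem_eq (d : Datum M ℂ) {E : ℂ[X]} (hE : E.natDegree ≤ d.N) :
    (algebraMap ℂ[X] (RatFunc ℂ) (d.rem E).1, algebraMap ℂ[X] (RatFunc ℂ) (d.rem E).2)
      = algebraMap ℂ[X] (RatFunc ℂ) (((X - 1) * d.T) ^ (d.N + 2)) •
        (aeval d.θ (d.H₁ * E.comp (X - 1)) (1, 0)
          - (RatFunc.X : RatFunc ℂ) • aeval d.θ (d.H₂ * E.comp (X + 1)) (1, 0)) := by
  obtain ⟨h1, h2⟩ := d.H_mul_natDegree hE
  set g₁ := d.H₁ * E.comp (X - 1) with hg₁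
  set g₂ := d.H₂ * E.comp (X + 1) with hg₂
  have hsum : ∀ g : ℂ[X], g.natDegree ≤ d.N + 2 → aeval d.θ g (1, 0)
      = ∑ j ∈ Finset.range (d.N + 3),
        algebraMap ℂ[X] (RatFunc ℂ) (C (g.coeff j)) • (d.θ ^ j) (1, 0) := by
    intro g hg
    rw [aeval_eq_sum_range' (show g.natDegree < d.N + 3 by omega), LinearMap.sum_apply]
    refine Finset.sum_congr rfl fun j _ => ?_
    ext <;> simp [RatFunc.smul_eq_C_mul]
  have hterm : ∀ j ∈ Finset.range (d.N + 3),
      algebraMap ℂ[X] (RatFunc ℂ) (d.opCoeff E j * ((X - 1) * d.T) ^ (d.N + 2 - j)) •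
        (algebraMap ℂ[X] (RatFunc ℂ) (d.thetaIter j).1,
          algebraMap ℂ[X] (RatFunc ℂ) (d.thetaIter j).2)
      = algebraMap ℂ[X] (RatFunc ℂ) (((X - 1) * d.T) ^ (d.N + 2)) •
        (algebraMap ℂ[X] (RatFunc ℂ) (C (g₁.coeff j)) • (d.θ ^ j) (1, 0)
        - (RatFunc.X : RatFunc ℂ) • algebraMap ℂ[X] (RatFunc ℂ) (C (g₂.coeff j)) •
          (d.θ ^ j) (1, 0)) := by
    intro j hj
    rw [← thetaIter_spec, smul_smul, ← map_mul, mul_assoc, ← pow_add,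
      Nat.sub_add_cancel (Nat.lt_succ_iff.1 (Finset.mem_range.1 hj)), smul_smul, ← sub_smul,
      smul_smul, opCoeff, ← RatFunc.algebraMap_X, ← map_mul, ← map_sub, ← map_mul, mul_comm]
  rw [hsum _ h1, hsum _ h2, Finset.smul_sum, ← Finset.sum_sub_distrib, Finset.smul_sum,
    ← Finset.sum_congr rfl hterm]
  ext
  · simp [rem, Prod.fst_sum]
  · simp [rem, Prod.snd_sum]

theorem rem_eq_zero_iff (d : Datum M ℂ) {E : ℂ[X]} (hE : E.natDegree ≤ d.N) :
    d.rem E = 0 ↔ aeval d.θ (d.H₁ * E.comp (X - 1)) (1, 0)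
          = (RatFunc.X : RatFunc ℂ) • aeval d.θ (d.H₂ * E.comp (X + 1)) (1, 0) := by
  have h := d.rem_eq hE
  have hX1m : (X - 1 : ℂ[X]).Monic := by simpa using monic_X_sub_C (1 : ℂ)
  have h0 : algebraMap ℂ[X] (RatFunc ℂ) (((X - 1) * d.T) ^ (d.N + 2)) ≠ 0 :=
    RatFunc.algebraMap_ne_zero ((hX1m.mul d.T_monic).pow _).ne_zero
  rw [← sub_eq_zero (b := _ • _)]
  constructor
  · intro h1
    rw [h1] at h
    refine (smul_eq_zero.1 (h.symm.trans ?_)).resolve_left h0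
    simp
  · intro h1
    rw [h1, smul_zero] at h
    ext1
    · exact RatFunc.algebraMap_injective ℂ ((congrArg Prod.fst h).trans (by simp))
    · exact RatFunc.algebraMap_injective ℂ ((congrArg Prod.snd h).trans (by simp))

/-- Put `c y = E(θ) F`. Then `H₁(θ) E(θ-1) E(θ) F = E(θ-1) E(θ) z H₂(θ) F = z E(θ) E(θ+1) H₂(θ) F`,
because moving `z` to the left shifts `θ` by one. -/
theorem rem_eq_zero_of_hypergeometric (d : Datum M ℂ) {F : RatFunc ℂ × RatFunc ℂ} {E : ℂ[X]} {c : ℂ}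
    (hE : E.natDegree ≤ d.N)
    (hF : aeval d.θ d.H₁ F = (RatFunc.X : RatFunc ℂ) • aeval d.θ d.H₂ F) (hc : c ≠ 0)
    (hEF : aeval d.θ E F = c • (1, 0)) : d.rem E = 0 := by
  rw [d.rem_eq_zero_iff hE]
  refine smul_right_injective _ hc ?_
  simp only
  rw [← map_smul, smul_comm, ← map_smul, ← hEF, ← Module.End.mul_apply, ← Module.End.mul_apply,
    ← map_mul, ← map_mul, mul_assoc, mul_comm d.H₁, map_mul, Module.End.mul_apply, hF,
    aeval_θ_X_smul, ← Module.End.mul_apply, ← map_mul]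
  refine congrArg (fun g : ℂ[X] => (RatFunc.X : RatFunc ℂ) • aeval d.θ g F) ?_
  rw [mul_comp, comp_assoc, sub_comp, X_comp, one_comp, add_sub_cancel_right, comp_X]
  ring

theorem prod_H₁_apply (d : Datum M ℂ) {F : RatFunc ℂ × RatFunc ℂ}
    (hF : aeval d.θ d.H₁ F = (RatFunc.X : RatFunc ℂ) • aeval d.θ d.H₂ F) (j : ℕ) :
    aeval d.θ (∏ i ∈ Finset.range j, d.H₁.comp (X - (i : ℂ[X]))) F =
      (RatFunc.X ^ j : RatFunc ℂ) •
        aeval d.θ (∏ i ∈ Finset.range j, d.H₂.comp (X + (i : ℂ[X]))) F := by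
  induction j with
  | zero => simp
  | succ j ih =>
    rw [Finset.prod_range_succ, mul_comm, map_mul, Module.End.mul_apply, ih, aeval_θ_X_pow_smul,
      comp_assoc, ← Module.End.mul_apply, ← map_mul, mul_comm]
    simp only [sub_comp, X_comp, natCast_comp, add_sub_cancel_right, comp_X]
    rw [map_mul, Module.End.mul_apply, hF, aeval_θ_X_smul, ← Module.End.mul_apply, ← map_mul,
      smul_smul, ← pow_succ, Finset.prod_range_succ', prod_comp]
    simp [comp_assoc, add_assoc, add_comm (1 : ℂ[X])]

/-- Moving `z^j` to the left turns `j` of the factors of `shiftFactor 0` into `H₂(θ + i)` with `i <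
j`; by `prod_H₁_apply` these convert `z^j F` into factors `H₁(θ - i)` acting on `F`. -/
theorem shiftFactor_apply (d : Datum M ℂ) {F : RatFunc ℂ × RatFunc ℂ}
    (hF : aeval d.θ d.H₁ F = (RatFunc.X : RatFunc ℂ) • aeval d.θ d.H₂ F) {j : ℕ} (hj : j ≤ M + 1) :
    aeval d.θ (d.shiftFactor j) F = aeval d.θ (d.shiftFactor 0) ((RatFunc.X ^ j : RatFunc ℂ) • F) := by
  rw [shiftFactor, mul_comm, map_mul, Module.End.mul_apply, d.prod_H₁_apply hF, aeval_θ_X_pow_smul,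
    aeval_θ_X_pow_smul, ← Module.End.mul_apply, ← map_mul]
  congr 3
  rw [shiftFactor, Finset.prod_range_zero, one_mul, ← Finset.range_eq_Ico,
    ← Finset.prod_range_mul_prod_Ico _ hj, mul_comp, mul_comm]
  congr 1
  rw [prod_comp, ← Finset.prod_range_reflect]
  refine Finset.prod_congr rfl fun i hi => ?_
  rw [comp_assoc]
  congr 1
  have h : ((j - 1 - i : ℕ) : ℂ[X]) = j - ((i + 1 : ℕ) : ℂ[X]) := by
    rw [eq_sub_iff_add_eq, ← Nat.cast_add]
    congr 1
    have := Finset.mem_range.1 hi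
    omega
  rw [h, sub_comp, X_comp, natCast_comp]
  ring

/-- The sum is `z² (z - 1) T L` written with `z² d²/dz² = θ² - θ`, and `L` annihilates the
generator. -/
theorem sum_eulerPart_apply (d : Datum M ℂ) :
    ∑ j ∈ Finset.range (M + 2), (RatFunc.X ^ j : RatFunc ℂ) • aeval d.θ (d.eulerPart j) (1, 0) = 0 := by
  have hX1d : (X - 1 : ℂ[X]).natDegree ≤ 1 := by simpa using natDegree_X_sub_C_le (1 : ℂ)
  have hsum : ∀ f : ℂ[X], f.natDegree ≤ M + 1 → ∑ j ∈ Finset.range (M + 2),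
      (RatFunc.X ^ j * RatFunc.C (f.coeff j)) = algebraMap ℂ[X] (RatFunc ℂ) f := by
    intro f hf
    conv_rhs => rw [f.as_sum_range' (M + 2) (by omega), map_sum]
    refine Finset.sum_congr rfl fun j _ => ?_
    rw [← C_mul_X_pow_eq_monomial, map_mul, map_pow, RatFunc.algebraMap_C, RatFunc.algebraMap_X,
      mul_comm]
  have hs1 := hsum ((X - 1) * d.T) (natDegree_mul_le.trans (by rw [T_natDegree]; omega))
  have hs2 := hsum d.p d.p_natDegree
  have hs3 := hsum (X * d.S) (natDegree_mul_le.trans (by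
    have := d.S_natDegree; rw [natDegree_X]; omega))
  have hterm : ∀ j, (RatFunc.X ^ j : RatFunc ℂ) • aeval d.θ (d.eulerPart j) (1, 0)
      = (RatFunc.X ^ j * RatFunc.C (((X - 1) * d.T).coeff j)) • (d.θ (d.θ (1, 0)) - d.θ (1, 0))
        + (RatFunc.X ^ j * RatFunc.C (d.p.coeff j)) • d.θ (1, 0)
        + (RatFunc.X ^ j * RatFunc.C ((X * d.S).coeff j)) • (1, 0) := by
    intro j
    have h : ∀ (c : ℂ) (v : RatFunc ℂ × RatFunc ℂ), c • v = RatFunc.C c • v := fun c v => by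
      ext <;> simp [RatFunc.smul_eq_C_mul]
    rw [eulerPart]
    simp only [map_add, map_sub, map_mul, aeval_C, aeval_X, LinearMap.add_apply,
      LinearMap.sub_apply, Module.End.mul_apply, Module.algebraMap_end_apply, pow_two, h, smul_add,
      smul_sub, smul_smul]
  have hq := d.q_ne_zero
  have e1 : algebraMap ℂ[X] (RatFunc ℂ) d.q * d.Q = algebraMap ℂ[X] (RatFunc ℂ) d.S := by
    rw [Q]; field_simp
  have e2 : algebraMap ℂ[X] (RatFunc ℂ) d.q * d.P = algebraMap ℂ[X] (RatFunc ℂ) d.p := by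
    rw [P]; field_simp
  have e3 : algebraMap ℂ[X] (RatFunc ℂ) d.q
      = RatFunc.X * algebraMap ℂ[X] (RatFunc ℂ) ((X - 1) * d.T) := by
    rw [q, mul_assoc, map_mul, RatFunc.algebraMap_X]
  rw [Finset.sum_congr rfl fun j _ => hterm j, Finset.sum_add_distrib, Finset.sum_add_distrib,
    ← Finset.sum_smul, ← Finset.sum_smul, ← Finset.sum_smul, hs1, hs2, hs3]
  have hd0 : ddz (0 : RatFunc ℂ) = 0 := map_zero _
  have hd1 : ddz (1 : RatFunc ℂ) = 0 := by simpa using ddz_C 1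
  rw [map_mul _ X, RatFunc.algebraMap_X, ← e1, ← e2, e3]
  ext
  · simp [θ_apply, nabla_apply, hd0, hd1, ddz_X]
    ring
  · simp [θ_apply, nabla_apply, hd0, hd1, ddz_X]
    ring

/-- Applied to `F`, this polynomial in `θ` is `shiftFactor 0` acting on a multiple of `L y = 0`; by
irreducibility only the zero polynomial in `θ` kills `F`. -/
theorem indicial_eq_zero_of_hypergeometric (d : Datum M ℂ) (hd : d.Distinct) (hg : d.Generic)
    {F : RatFunc ℂ × RatFunc ℂ} {E : ℂ[X]} {c : ℂ} (hF0 : F ≠ 0)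
    (hF : aeval d.θ d.H₁ F = (RatFunc.X : RatFunc ℂ) • aeval d.θ d.H₂ F)
    (hEF : aeval d.θ E F = c • (1, 0)) : d.indicial E = 0 := by
  by_contra h0
  refine d.aeval_θ_ne_zero hd hg _ h0 hF0 ?_
  have hterm : ∀ j ∈ Finset.range (M + 2),
      aeval d.θ ((d.eulerPart j * E).comp (X - (j : ℂ[X])) * d.shiftFactor j) F
      = aeval d.θ (d.shiftFactor 0) (c • (RatFunc.X ^ j : RatFunc ℂ) •
        aeval d.θ (d.eulerPart j) (1, 0)) := by
    intro j hj
    rw [map_mul, Module.End.mul_apply,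
      d.shiftFactor_apply hF (Nat.lt_succ_iff.1 (Finset.mem_range.1 hj)), ← Module.End.mul_apply,
      ← map_mul, mul_comm, map_mul, Module.End.mul_apply, aeval_θ_X_pow_smul, comp_assoc]
    simp only [sub_comp, X_comp, natCast_comp, add_sub_cancel_right, comp_X]
    rw [map_mul, Module.End.mul_apply, hEF, (aeval d.θ (d.eulerPart j)).map_smul, smul_comm]
  rw [indicial, map_sum, LinearMap.sum_apply, Finset.sum_congr rfl hterm, ← map_sum,
    ← Finset.smul_sum, sum_eulerPart_apply, smul_zero, map_zero]

/-- For generic parameters with apparent singularities there is an Euler polynomial satisfying the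
linear conditions. -/
theorem exists_rem_indicial_eq_zero_of_generic (d : Datum M ℂ) (hd : d.Distinct) (hg : d.Generic)
    (ha : ∀ k, d.ApparentAt k) {n : ℕ} (hN : d.N = n + 1) :
    ∃ E : ℂ[X], E ≠ 0 ∧ E.natDegree ≤ d.N ∧ d.rem E = 0 ∧ d.indicial E = 0 := by
  obtain ⟨F, E, c, hF0, hE0, hE, hF, hc, hEF⟩ := d.exists_hypergeometric hd hg ha hN
  exact ⟨E, hE0, hE, d.rem_eq_zero_of_hypergeometric hE hF hc hEF,
    d.indicial_eq_zero_of_hypergeometric hd hg hF0 hF hEF⟩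

end Datum
-- Two top coefficients, and the degree of the Euler polynomial
/-- `f = a z ^ (n + 1) + b z ^ n + ⋯`. -/
def HasTop (n : ℕ) (f : ℂ[X]) (a b : ℂ) : Prop :=
  f.natDegree ≤ n + 1 ∧ f.coeff (n + 1) = a ∧ f.coeff n = b

theorem HasTop.mul {n m : ℕ} {f g : ℂ[X]} {a b a' b' : ℂ} (hf : HasTop n f a b)
    (hg : HasTop m g a' b') : HasTop (n + m + 1) (f * g) (a * a') (a * b' + b * a') := by
  obtain ⟨hf1, rfl, rfl⟩ := hf
  obtain ⟨hg1, rfl, rfl⟩ := hg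
  refine ⟨natDegree_mul_le.trans (by omega), ?_, ?_⟩
  · rw [show n + m + 1 + 1 = n + 1 + (m + 1) by ring, coeff_mul_add_eq_of_natDegree_le hf1 hg1]
  · have e : ∀ (h : ℂ[X]) (k : ℕ), h.natDegree ≤ k + 1 → ∃ h₀ : ℂ[X],
        h = C (h.coeff (k + 1)) * X ^ (k + 1) + h₀ ∧ h₀.natDegree ≤ k ∧ h₀.coeff k = h.coeff k := by
      intro h k hk
      refine ⟨h - C (h.coeff (k + 1)) * X ^ (k + 1), by ring, ?_, by simp [coeff_X_pow]⟩
      rw [natDegree_le_iff_coeff_eq_zero]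
      intro i hi
      rcases Nat.lt_or_ge (k + 1) i with h' | h'
      · rw [coeff_sub, coeff_eq_zero_of_natDegree_lt (hk.trans_lt h'), coeff_C_mul, coeff_X_pow,
          if_neg (by omega)]
        simp
      · obtain rfl : i = k + 1 := by omega
        simp
    obtain ⟨f₀, hf0, hf2, hf3⟩ := e f n hf1
    obtain ⟨g₀, hg0, hg2, hg3⟩ := e g m hg1
    rw [← hf3, ← hg3]
    generalize f.coeff (n + 1) = u at *
    generalize g.coeff (m + 1) = v at *
    have h1 : f * g = C (u * v) * X ^ (n + m + 2) + C u * (g₀ * X ^ (n + 1))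
        + C v * (f₀ * X ^ (m + 1)) + f₀ * g₀ := by
      rw [hf0, hg0, C_mul]; ring
    have h2 : (f₀ * g₀).coeff (n + m + 1) = 0 :=
      coeff_eq_zero_of_natDegree_lt (natDegree_mul_le.trans_lt (by omega))
    rw [h1, coeff_add, coeff_add, coeff_add, coeff_C_mul, coeff_C_mul, coeff_C_mul, coeff_X_pow,
      if_neg (by omega), h2, show n + m + 1 = m + (n + 1) by ring, coeff_mul_X_pow,
      show m + (n + 1) = n + (m + 1) by ring, coeff_mul_X_pow]
    ring

theorem hasTop_X_add_C (c : ℂ) : HasTop 0 (X + C c) 1 c := by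
  refine ⟨by simp, by simp, by simp⟩

theorem hasTop_X : HasTop 0 X 1 0 := by simpa using hasTop_X_add_C 0

theorem HasTop.prod {ι : Type*} (s : Finset ι) (f : ι → ℂ[X]) (b : ι → ℂ)
    (hf : ∀ i ∈ s, HasTop 1 (f i) 1 (b i)) :
    HasTop (2 * s.card) (X * ∏ i ∈ s, f i) 1 (∑ i ∈ s, b i) := by
  classical
  induction s using Finset.induction_on with
  | empty => simpa using hasTop_X
  | insert i s hi ih =>
    rw [Finset.prod_insert hi, Finset.sum_insert hi, Finset.card_insert_of_notMem hi]
    have := (hf i (Finset.mem_insert_self _ _)).mul (ih fun j hj => hf j (Finset.mem_insert_of_mem hj))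
    rw [show 2 * (s.card + 1) = 1 + 2 * s.card + 1 by ring, mul_left_comm]
    simpa [add_comm] using this

theorem hasTop_multiset (s : Multiset ℂ) :
    HasTop s.card (X * (s.map fun r => X - C r).prod) 1 (-s.sum) := by
  induction s using Multiset.induction_on with
  | empty => simpa using hasTop_X
  | cons r s ih =>
    have := (hasTop_X_add_C (-r)).mul ih
    rw [Multiset.map_cons, Multiset.prod_cons, Multiset.sum_cons, Multiset.card_cons, mul_left_comm]
    simpa [sub_eq_add_neg, add_comm] using this

/-- Factoring `E` over its roots, the shift by `j` moves each root by `j`. The extra factor `X`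
gives even a constant `E` a subleading coefficient. -/
theorem exists_hasTop_comp (E : ℂ[X]) :
    ∃ e : ℂ, ∀ j : ℕ, HasTop E.natDegree (X * E.comp (X - (j : ℂ[X]))) E.leadingCoeff
      (e - E.natDegree * j * E.leadingCoeff) := by
  refine ⟨-E.leadingCoeff * E.roots.sum, fun j => ?_⟩
  have hsp := (IsAlgClosed.splits E)
  have h1 := hasTop_multiset (E.roots.map fun r => r + j)
  have hE := hsp.eq_prod_roots
  have h2 : X * E.comp (X - (j : ℂ[X])) = C E.leadingCoeff *
      (X * ((E.roots.map fun r => r + (j : ℂ)).map fun r => X - C r).prod) := by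
    conv_lhs => rw [hE]
    rw [mul_comp, C_comp, multiset_prod_comp, Multiset.map_map, Multiset.map_map]
    have : ((fun p : ℂ[X] => p.comp (X - (j : ℂ[X]))) ∘ fun a => X - C a)
        = ((fun r => X - C r) ∘ fun r => r + (j : ℂ)) := by
      funext r; simp [sub_sub, add_comm]
    rw [this]; ring
  have hc : E.roots.card = E.natDegree := hsp.natDegree_eq_card_roots.symm
  rw [Multiset.card_map, hc] at h1
  obtain ⟨a1, a2, a3⟩ := h1
  rw [h2]
  refine ⟨(natDegree_C_mul_le _ _).trans a1, by rw [coeff_C_mul, a2, mul_one], ?_⟩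
  rw [coeff_C_mul, a3]
  simp [Multiset.sum_map_add, hc]
  ring

namespace Datum

variable {M : ℕ}

/-- Passing from `j` to `j + 1` exchanges `H₂(X - j - 1)` for `H₁(X - j)`, which changes the
subleading coefficient by the same amount for every `j`. -/
theorem hasTop_shiftFactor (d : Datum M ℂ) : ∃ g : ℂ, ∀ j ≤ M + 1,
    HasTop (2 * M + 2) (X * d.shiftFactor j) 1 (g + j * (d.γ + 1 - d.α - d.β)) := by
  refine ⟨∑ i ∈ Finset.range (M + 1), (d.α + d.β - 2 * ((i + 1 : ℕ) : ℂ)), fun j hj => ?_⟩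
  have h1 : ∀ i : ℕ, HasTop 1 (d.H₁.comp (X - (i : ℂ[X]))) 1 (d.γ - 1 - 2 * i) := by
    intro i
    have := (hasTop_X_add_C (-(i : ℂ))).mul (hasTop_X_add_C (d.γ - 1 - i))
    convert this using 1
    · simp [H₁]; ring
    · ring
    · ring
  have h2 : ∀ i : ℕ, HasTop 1 (d.H₂.comp (X - ((i + 1 : ℕ) : ℂ[X]))) 1
      (d.α + d.β - 2 * ((i + 1 : ℕ) : ℂ)) := by
    intro i
    have := (hasTop_X_add_C (d.α - ((i + 1 : ℕ) : ℂ))).mul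
      (hasTop_X_add_C (d.β - ((i + 1 : ℕ) : ℂ)))
    convert this using 1
    · simp [H₂]; ring
    · ring
    · ring
  have h3 := HasTop.prod (Finset.range (M + 1)) (fun i => if i < j then d.H₁.comp (X - (i : ℂ[X]))
      else d.H₂.comp (X - ((i + 1 : ℕ) : ℂ[X])))
    (fun i => (d.α + d.β - 2 * ((i + 1 : ℕ) : ℂ)) + if i < j then d.γ + 1 - d.α - d.β else 0)
    (fun i _ => by
      split_ifs
      · convert h1 i using 1
        push_cast; ring
      · simpa using h2 i)
  rw [Finset.card_range, Finset.sum_add_distrib, ← Finset.sum_filter, Finset.sum_const] at h3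
  have h4 : ((Finset.range (M + 1)).filter fun i => i < j) = Finset.range j := by
    ext i; simp; omega
  rw [h4, Finset.card_range, nsmul_eq_mul, ← Finset.prod_range_mul_prod_Ico _ hj] at h3
  rw [shiftFactor]
  convert h3 using 3
  congr 1
  · exact Finset.prod_congr rfl fun i hi => by rw [if_pos (Finset.mem_range.1 hi)]
  · exact Finset.prod_congr rfl fun i hi => by
      rw [if_neg (by have := (Finset.mem_Ico.1 hi).1; omega)]

theorem hasTop_eulerPart (d : Datum M ℂ) (j : ℕ) :
    HasTop 1 ((d.eulerPart j).comp (X - (j : ℂ[X]))) (((X - 1) * d.T).coeff j)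
      (d.p.coeff j - (2 * j + 1) * ((X - 1) * d.T).coeff j) := by
  set c := ((X - 1) * d.T).coeff j
  set p := d.p.coeff j
  set s := (X * d.S).coeff j
  have h : (d.eulerPart j).comp (X - (j : ℂ[X])) = C c * X ^ 2 + C (p - (2 * j + 1) * c) * X
      + C (c * j ^ 2 + c * j - p * j + s) := by
    simp only [eulerPart, add_comp, mul_comp, C_comp, sub_comp, pow_comp, X_comp]
    simp only [map_add, map_sub, map_mul, map_pow, map_natCast, map_one, map_ofNat]
    ring
  rw [h]
  generalize p - (2 * j + 1) * c = u
  generalize c * (j : ℂ) ^ 2 + c * j - p * j + s = v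
  refine ⟨natDegree_quadratic_le, ?_, ?_⟩
  · simp
  · simp [coeff_X_pow, coeff_C]

/-- The second indicial condition forces the degree of the Euler polynomial. -/
theorem natDegree_eq_of_indicial (d : Datum M ℂ) (hd : d.Distinct) {E : ℂ[X]} (hE : E ≠ 0)
    (h : d.indicial E = 0) : E.natDegree = d.N := by
  obtain ⟨e, he⟩ := exists_hasTop_comp E
  obtain ⟨g, hg⟩ := d.hasTop_shiftFactor
  set k := E.natDegree
  set l := E.leadingCoeff with hl
  have hX1d : (X - 1 : ℂ[X]).natDegree ≤ 1 := by simpa using natDegree_X_sub_C_le (1 : ℂ)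
  have hr : ((X - 1) * d.T).natDegree < M + 2 :=
    natDegree_mul_le.trans_lt (by rw [T_natDegree]; omega)
  have s1 : ∑ j ∈ Finset.range (M + 2), ((X - 1) * d.T).coeff j = 0 := by
    have := eval_eq_sum_range' hr 1
    simpa using this.symm
  have s2 : ∑ j ∈ Finset.range (M + 2), d.p.coeff j = d.δ * d.T.eval 1 := by
    have := eval_eq_sum_range' (show d.p.natDegree < M + 2 from by
      have := d.p_natDegree; omega) 1
    simpa [p] using this.symm
  have s3 : ∑ j ∈ Finset.range (M + 2), (j : ℂ) * ((X - 1) * d.T).coeff j = d.T.eval 1 := by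
    have := eval_eq_sum_range' (p := X * derivative ((X - 1) * d.T)) (n := M + 2) (by
      refine natDegree_mul_le.trans_lt ?_
      have := natDegree_derivative_le ((X - 1) * d.T)
      rw [natDegree_X]
      omega) 1
    rw [eval_mul, derivative_mul] at this
    simp only [derivative_sub, derivative_X, derivative_one, sub_zero, one_mul, eval_add, eval_mul,
      eval_sub, eval_X, eval_one, sub_self, zero_mul, add_zero, one_pow, mul_one] at this
    rw [this]
    refine Finset.sum_congr rfl fun j _ => ?_
    cases j with
    | zero => simp
    | succ j =>
      rw [coeff_X_mul, show d.T + (X - 1) * derivative d.T = derivative ((X - 1) * d.T) by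
        rw [derivative_mul]; simp, coeff_derivative]
      push_cast; ring
  -- This is the coefficient just below the top one. In the sum over `j` the multiples of `((z - 1)
  -- T)(1) = 0` drop out, so the unknowns `e` and `g` disappear.
  have hterm : ∀ j ∈ Finset.range (M + 2),
      (X * X * ((d.eulerPart j * E).comp (X - (j : ℂ[X])) * d.shiftFactor j)).coeff
        (1 + k + 1 + (2 * M + 2) + 1)
      = ((X - 1) * d.T).coeff j * (e - l + l * g)
        + (j : ℂ) * ((X - 1) * d.T).coeff j * (l * (d.γ - 1 - d.α - d.β - k))
        + d.p.coeff j * l := by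
    intro j hj
    have := (((d.hasTop_eulerPart j).mul (he j)).mul
      (hg j (Nat.lt_succ_iff.1 (Finset.mem_range.1 hj)))).2.2
    rw [mul_comp, show ∀ a b c : ℂ[X], X * X * (a * b * c) = a * (X * b) * (X * c) by
      intros; ring, this]
    ring
  have hsum := congrArg (fun f => (X * X * f).coeff (1 + k + 1 + (2 * M + 2) + 1)) h
  simp only [indicial, Finset.mul_sum, finsetSum_coeff, mul_zero, coeff_zero] at hsum
  rw [Finset.sum_congr rfl hterm, Finset.sum_add_distrib, Finset.sum_add_distrib,
    ← Finset.sum_mul, ← Finset.sum_mul, ← Finset.sum_mul, s1, s2, s3, δ] at hsum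
  have hT1 := d.T_eval_ne_zero hd.ne_one
  have hl0 : l ≠ 0 := leadingCoeff_ne_zero.2 hE
  -- By the Fuchs relation, what is left is `T(1) l (N - deg E)`.
  have h5 : (d.T.eval 1 * l) * ((d.N : ℂ) - k) = 0 := by linear_combination hsum
  have h6 := (mul_eq_zero.1 h5).resolve_left (mul_ne_zero hT1 hl0)
  exact_mod_cast (sub_eq_zero.1 h6).symm

end Datum
/-! ### Systems of equations with isolated solutions -/

/-- Over a Jacobson ring a maximal ideal of `R[X]` contracts to a maximal ideal of `R`, and its
height is one more. -/
theorem height_eq_of_equiv {R S : Type*} [CommRing R] [CommRing S] [IsNoetherianRing R]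
    [IsJacobsonRing R] (n : ℕ∞) (hR : ∀ Q : Ideal R, ∀ [Q.IsMaximal], Q.height = n)
    (e : S ≃+* R[X]) (P : Ideal S) [P.IsMaximal] : P.height = n + 1 := by
  have h1 : (P.map e).IsMaximal := Ideal.map_isMaximal_of_equiv _
  have h2 : ((P.map e).under R).IsMaximal := isMaximal_comap_C_of_isJacobsonRing (P.map e)
  rw [← RingEquiv.height_map e, Polynomial.height_eq_height_add_one ((P.map e).under R) (P.map e),
    hR]

theorem height_eq_of_isMaximal (ι : Type*) [Finite ι] (P : Ideal (MvPolynomial ι ℂ[X]))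
    [P.IsMaximal] : P.height = Nat.card ι + 1 := by
  induction ι using Finite.induction_empty_option with
  | of_equiv e H =>
    have h1 : (P.map (MvPolynomial.renameEquiv ℂ[X] e.symm).toRingEquiv).IsMaximal :=
      Ideal.map_isMaximal_of_equiv _
    rw [← RingEquiv.height_map (MvPolynomial.renameEquiv ℂ[X] e.symm).toRingEquiv, H,
      Nat.card_congr e]
  | h_empty =>
    have h1 : (P.map (MvPolynomial.isEmptyAlgEquiv ℂ[X] PEmpty).toRingEquiv).IsMaximal :=
      Ideal.map_isMaximal_of_equiv _
    rw [← RingEquiv.height_map (MvPolynomial.isEmptyAlgEquiv ℂ[X] PEmpty).toRingEquiv,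
      IsPrincipalIdealRing.height_eq_one_of_isMaximal _ (Polynomial.not_isField ℂ)]
    simp
  | @h_option ι _ H =>
    rw [height_eq_of_equiv _ H (MvPolynomial.optionEquivLeft ℂ[X] ι).toRingEquiv P]
    simp

/-! ### Finiteness over the parameter line and generic points of the solution scheme -/

/-- All terms of `f` have total degree less than `n`. -/
def Low {σ A : Type*} [CommRing A] (n : ℕ) (f : MvPolynomial σ A) : Prop :=
  ∀ e : σ →₀ ℕ, n ≤ e.degree → f.coeff e = 0

section Low

variable {σ A : Type*} [CommRing A] {n m : ℕ} {f g : MvPolynomial σ A}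

theorem low_zero : Low n (0 : MvPolynomial σ A) := fun _ _ => by simp

theorem Low.mono (h : Low n f) (hnm : n ≤ m) : Low m f := fun e he => h e (hnm.trans he)

theorem Low.add (hf : Low n f) (hg : Low n g) : Low n (f + g) := fun e he => by
  rw [MvPolynomial.coeff_add, hf e he, hg e he, add_zero]

theorem Low.neg (hf : Low n f) : Low n (-f) := fun e he => by
  rw [MvPolynomial.coeff_neg, hf e he, neg_zero]

theorem Low.sum {ι : Type*} {s : Finset ι} {f : ι → MvPolynomial σ A} (h : ∀ i ∈ s, Low n (f i)) :
    Low n (∑ i ∈ s, f i) := fun e he => by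
  rw [MvPolynomial.coeff_sum, Finset.sum_eq_zero fun i hi => h i hi e he]

theorem Low.mul (hf : Low n f) (hg : Low (m + 1) g) : Low (n + m) (f * g) := by
  classical
  intro e he
  rw [MvPolynomial.coeff_mul]
  refine Finset.sum_eq_zero fun x hx => ?_
  have h1 : x.1.degree + x.2.degree = e.degree := by
    rw [← Finset.HasAntidiagonal.mem_antidiagonal.1 hx, map_add]
  rcases Nat.lt_or_ge x.1.degree n with h | h
  · rw [hg _ (by omega), mul_zero]
  · rw [hf _ h, zero_mul]

theorem low_C (a : A) : Low 1 (MvPolynomial.C a : MvPolynomial σ A) := by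
  classical
  intro e he
  rw [MvPolynomial.coeff_C, if_neg]
  rintro rfl
  simp at he

theorem low_monomial (e : σ →₀ ℕ) (a : A) : Low (e.degree + 1) (MvPolynomial.monomial e a) := by
  classical
  intro e' he
  rw [MvPolynomial.coeff_monomial, if_neg]
  rintro rfl
  omega

theorem low_X (i : σ) : Low 2 (MvPolynomial.X i : MvPolynomial σ A) := by
  simpa [MvPolynomial.X] using low_monomial (Finsupp.single i 1) (1 : A)

theorem Low.mem_restrictTotalDegree (hf : Low (n + 1) f) :
    f ∈ MvPolynomial.restrictTotalDegree σ A n := by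
  rw [MvPolynomial.mem_restrictTotalDegree, MvPolynomial.totalDegree]
  refine Finset.sup_le fun e he => ?_
  by_contra! h
  exact (MvPolynomial.mem_support_iff.1 he) (hf e h)

end Low

/-- A system whose leading forms are powers of the single variables defines a finite algebra. -/
theorem finite_quotient {M : ℕ} {A : Type*} [CommRing A] (F : Fin M → MvPolynomial (Fin M) A)
    (m : Fin M → ℕ) (a : Fin M → A) (ha : ∀ k, IsUnit (a k))
    (hF : ∀ k, Low (m k + 1) (F k - MvPolynomial.C (a k) * MvPolynomial.X k ^ (m k + 1)))
    (I : Ideal (MvPolynomial (Fin M) A)) (hI : ∀ k, F k ∈ I) :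
    Module.Finite A (MvPolynomial (Fin M) A ⧸ I) := by
  have hfin : Module.Finite A (MvPolynomial.restrictTotalDegree (Fin M) A (∑ k, m k)) := inferInstance
  have key : ∀ n, ∀ f : MvPolynomial (Fin M) A, Low n f →
      ∃ g ∈ MvPolynomial.restrictTotalDegree (Fin M) A (∑ k, m k), f - g ∈ I := by
    intro n
    induction n with
    | zero =>
      intro f hf
      refine ⟨0, zero_mem _, ?_⟩
      have : f = 0 := by ext e; simpa using hf e (Nat.zero_le _)
      simp [this]
    | succ n ih =>
      have hmon : ∀ (e : Fin M →₀ ℕ) (c : A), e.degree = n →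
          ∃ g ∈ MvPolynomial.restrictTotalDegree (Fin M) A (∑ k, m k),
            MvPolynomial.monomial e c - g ∈ I := by
        intro e c he
        by_cases hlt : n ≤ ∑ k, m k
        · refine ⟨_, ?_, by rw [sub_self]; exact zero_mem _⟩
          exact ((low_monomial e c).mono (by omega)).mem_restrictTotalDegree
        -- Pigeonhole: a monomial of degree above `∑ m_k` is divisible by some `X_k^(m_k + 1)`,
        -- which `F k` replaces by terms of lower total degree.
        · obtain ⟨k, hk⟩ : ∃ k, m k < e k := by
            by_contra! h
            refine hlt ?_
            rw [← he, Finsupp.degree_eq_sum]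
            exact Finset.sum_le_sum fun k _ => h k
          obtain ⟨e', rfl⟩ : ∃ e', e = e' + Finsupp.single k (m k + 1) :=
            ⟨e - Finsupp.single k (m k + 1), (tsub_add_cancel_of_le (Finsupp.single_le_iff.2 hk)).symm⟩
          obtain ⟨u, hu⟩ := ha k
          have h1 : MvPolynomial.monomial (e' + Finsupp.single k (m k + 1)) c
              = MvPolynomial.monomial e' (c * (u⁻¹ : Aˣ)) * F k
                - MvPolynomial.monomial e' (c * (u⁻¹ : Aˣ)) *
                  (F k - MvPolynomial.C (a k) * MvPolynomial.X k ^ (m k + 1)) := by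
            rw [← mul_sub, sub_sub_cancel, MvPolynomial.X_pow_eq_monomial,
              MvPolynomial.C_mul_monomial, MvPolynomial.monomial_mul, ← hu]
            simp [mul_assoc]
          have h2 : e'.degree + (m k + 1) = n := by
            rw [← he, map_add, Finsupp.degree_single]
          have h3 := ((low_monomial e' (c * (u⁻¹ : Aˣ))).mul (hF k)).neg
          obtain ⟨g, hg, hgI⟩ := ih _ (h3.mono (by omega))
          refine ⟨g, hg, ?_⟩
          have h4 := I.add_mem (I.mul_mem_left (MvPolynomial.monomial e' (c * (u⁻¹ : Aˣ))) (hI k)) hgI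
          rw [h1]
          convert h4 using 1
          ring
      intro f hf
      have h4 : ∀ s : Finset (Fin M →₀ ℕ), (∀ e ∈ s, e.degree ≤ n) →
          ∃ g ∈ MvPolynomial.restrictTotalDegree (Fin M) A (∑ k, m k),
            ∑ e ∈ s, MvPolynomial.monomial e (f.coeff e) - g ∈ I := by
        intro s
        induction s using Finset.induction_on with
        | empty => exact fun _ => ⟨0, zero_mem _, by simp⟩
        | insert e s he ihs =>
          intro hs
          obtain ⟨g, hg, hgI⟩ := ihs fun e he => hs e (Finset.mem_insert_of_mem he)
          obtain ⟨g', hg', hgI'⟩ : ∃ g ∈ MvPolynomial.restrictTotalDegree (Fin M) A (∑ k, m k),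
              MvPolynomial.monomial e (f.coeff e) - g ∈ I := by
            rcases (hs e (Finset.mem_insert_self _ _)).eq_or_lt with h | h
            · exact hmon e _ h
            · exact ih _ ((low_monomial e _).mono h)
          refine ⟨g' + g, add_mem hg' hg, ?_⟩
          rw [Finset.sum_insert he, add_sub_add_comm]
          exact I.add_mem hgI' hgI
      obtain ⟨g, hg, hgI⟩ := h4 f.support fun e he => by
        by_contra! h
        exact MvPolynomial.mem_support_iff.1 he (hf e h)
      refine ⟨g, hg, ?_⟩
      rwa [MvPolynomial.support_sum_monomial_coeff] at hgI
  refine Module.Finite.of_surjective ((Ideal.Quotient.mkₐ A I).toLinearMap.comp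
    (MvPolynomial.restrictTotalDegree (Fin M) A (∑ k, m k)).subtype) ?_
  intro x
  obtain ⟨f, rfl⟩ := Ideal.Quotient.mk_surjective x
  obtain ⟨g, hg, hgI⟩ := key (f.totalDegree + 1) f fun e he =>
    MvPolynomial.coeff_eq_zero_of_totalDegree_lt he
  exact ⟨⟨g, hg⟩, (Ideal.Quotient.eq.2 hgI).symm⟩

/-- A nonzero prime of `ℂ[X]` is maximal, and integrality would carry maximality up to the zero
ideal of `B`. -/
theorem comap_bot_of_not_isField (B : Type*) [CommRing B] [IsDomain B] [Algebra ℂ[X] B]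
    [Algebra.IsIntegral ℂ[X] B] (hB : ¬ IsField B) :
    Ideal.comap (algebraMap ℂ[X] B) ⊥ = ⊥ := by
  by_contra h
  have h1 : (Ideal.comap (algebraMap ℂ[X] B) ⊥).IsPrime := inferInstance
  have h2 := h1.isMaximal h
  have h3 := Ideal.isMaximal_of_isIntegral_of_isMaximal_comap (⊥ : Ideal B) h2
  exact hB (Ring.isField_iff_maximal_bot.2 h3)

theorem exists_algHom_of_integral (B : Type*) [CommRing B] [IsDomain B] [Algebra ℂ[X] B]
    [Algebra.IsIntegral ℂ[X] B] [Algebra ℂ B] [IsScalarTower ℂ ℂ[X] B] [Algebra.FiniteType ℂ B]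
    (hB : ¬ IsField B) {b : B} (hb : b ≠ 0) {bad : Set ℂ} (hbad : bad.Countable) :
    ∃ φ : B →ₐ[ℂ] ℂ, φ b ≠ 0 ∧ φ (algebraMap ℂ[X] B X) ∉ bad := by
  have hinj := comap_bot_of_not_isField B hB
  -- By integrality `b` divides a nonzero polynomial `c` in the parameter; avoiding the roots of `c`
  -- keeps `b` nonzero at every point above `ε`.
  have h5 := Ideal.comap_ne_bot_of_integral_mem hb
    (Ideal.mem_span_singleton_self b) (Algebra.IsIntegral.isIntegral (R := ℂ[X]) b)
  obtain ⟨c, hc, hc0⟩ := Submodule.exists_mem_ne_zero_of_ne_bot h5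
  obtain ⟨ε, hε⟩ := ((hbad.union c.roots.toFinset.finite_toSet.countable).dense_compl ℂ).nonempty
  have hε1 : ε ∉ bad := fun h => hε (Or.inl h)
  have hε2 : c.eval ε ≠ 0 := fun h => hε (Or.inr (by simpa [hc0] using h))
  have hmaxε : (Ideal.span {X - C ε} : Ideal ℂ[X]).IsMaximal :=
    PrincipalIdealRing.isMaximal_of_irreducible (irreducible_X_sub_C ε)
  obtain ⟨n, hn, hnε⟩ := Ideal.exists_ideal_over_prime_of_isIntegral_of_isDomain
    (S := B) (Ideal.span {X - C ε} : Ideal ℂ[X]) (by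
      rw [RingHom.ker_eq_comap_bot, hinj]; exact bot_le)
  have hnmax : n.IsMaximal := Ideal.isMaximal_of_isIntegral_of_isMaximal_comap n (hnε ▸ hmaxε)
  let _ : Field (B ⧸ n) := Ideal.Quotient.field n
  have hfinC : Module.Finite ℂ (B ⧸ n) := finite_of_finite_type_of_isJacobsonRing _ _
  have hbij : Function.Bijective (algebraMap ℂ (B ⧸ n)) :=
    IsAlgClosed.algebraMap_bijective_of_isIntegral
  let e : (B ⧸ n) ≃ₐ[ℂ] ℂ := (AlgEquiv.ofBijective (Algebra.ofId ℂ _) hbij).symm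
  refine ⟨(e : (B ⧸ n) →ₐ[ℂ] ℂ).comp (Ideal.Quotient.mkₐ ℂ n), fun h => ?_, ?_⟩
  · have h6 : Ideal.Quotient.mk n b = 0 := e.injective (by simpa using h)
    have h7 : Ideal.span {b} ≤ n := by
      rw [Ideal.span_singleton_le_iff_mem]
      exact Ideal.Quotient.eq_zero_iff_mem.1 h6
    have h8 : c ∈ (Ideal.span {X - C ε} : Ideal ℂ[X]) := hnε ▸ h7 hc
    rw [Ideal.mem_span_singleton, dvd_iff_isRoot] at h8
    exact hε2 h8
  · have h6 : X - C ε ∈ Ideal.comap (algebraMap ℂ[X] B) n := by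
      rw [hnε]; exact Ideal.mem_span_singleton_self _
    have h7 := Ideal.Quotient.eq_zero_iff_mem.2 (Ideal.mem_comap.1 h6)
    rw [map_sub, map_sub, sub_eq_zero, show algebraMap ℂ[X] B (C ε) = algebraMap ℂ B ε from
      (IsScalarTower.algebraMap_apply ℂ ℂ[X] B ε).symm] at h7
    have h9 : e (Ideal.Quotient.mk n (algebraMap ℂ[X] B X)) = ε := by
      rw [h7]; exact e.commutes ε
    exact fun h => hε1 (h9 ▸ h)

/-- A solution at a special value of the parameter is a limit of solutions at generic values. -/
theorem exists_generic_point {M : ℕ} (F : Fin M → MvPolynomial (Fin M) ℂ[X])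
    (m : Fin M → ℕ) (a : Fin M → ℂ[X]) (ha : ∀ k, IsUnit (a k))
    (hF : ∀ k, Low (m k + 1) (F k - MvPolynomial.C (a k) * MvPolynomial.X k ^ (m k + 1)))
    (φ₀ : MvPolynomial (Fin M) ℂ[X] →ₐ[ℂ] ℂ) (hφ₀ : ∀ k, φ₀ (F k) = 0)
    (r : MvPolynomial (Fin M) ℂ[X]) (hr : φ₀ r ≠ 0) (bad : Set ℂ) (hbad : bad.Countable) :
    ∃ φ : MvPolynomial (Fin M) ℂ[X] →ₐ[ℂ] ℂ, (∀ k, φ (F k) = 0) ∧ φ r ≠ 0 ∧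
      φ (MvPolynomial.C X) ∉ bad := by
  have hker : (RingHom.ker φ₀).IsMaximal := RingHom.ker_isMaximal_of_surjective φ₀ fun c =>
    ⟨algebraMap ℂ _ c, φ₀.commutes c⟩
  have hle : Ideal.span (Set.range F) ≤ RingHom.ker φ₀ := by
    rw [Ideal.span_le]
    rintro _ ⟨k, rfl⟩
    exact hφ₀ k
  obtain ⟨p, hp, hpk⟩ := Ideal.exists_minimalPrimes_le hle
  have hpp : p.IsPrime := hp.1.1
  have hFp : ∀ k, F k ∈ p := fun k => hp.1.2 (Ideal.subset_span ⟨k, rfl⟩)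
  have hrp : r ∉ p := fun h => hr (hpk h)
  have hfin := finite_quotient F m a ha hF p hFp
  -- There are at most `M` generators, so Krull bounds the height of `p` by `M`, while maximal
  -- ideals have height `M + 1`.
  have hnot : ¬ p.IsMaximal := by
    intro hmax
    have h1 := height_eq_of_isMaximal (Fin M) p
    have h2 := Ideal.height_le_card_of_mem_minimalPrimes_span (Set.finite_range F) hp
    have h3 : (Set.range F).ncard ≤ M := by
      have := Set.ncard_image_le (f := F) (Set.finite_univ)
      simpa [Set.image_univ, Set.ncard_univ] using this
    rw [h1, Nat.card_fin] at h2
    have h4 : M + 1 ≤ (Set.range F).ncard := by exact_mod_cast h2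
    omega
  have hr0 : Ideal.Quotient.mk p r ≠ 0 := fun h => hrp (Ideal.Quotient.eq_zero_iff_mem.1 h)
  obtain ⟨φ, h1, h2⟩ := exists_algHom_of_integral (MvPolynomial (Fin M) ℂ[X] ⧸ p)
    (fun h => hnot (Ideal.Quotient.maximal_of_isField p h)) hr0 hbad
  refine ⟨φ.comp (Ideal.Quotient.mkₐ ℂ p), fun k => ?_, h1, h2⟩
  simp [Ideal.Quotient.eq_zero_iff_mem.2 (hFp k)]

/-! ### Specialization -/

/-- Injectivity of a matrix of polynomials is an open condition. -/
theorem exists_open_injective {R : Type*} [CommRing R] [Algebra ℂ R] {ι κ : Type*} [Fintype ι]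
    [Fintype κ] [DecidableEq κ] (c : ι → κ → R[X]) (φ₀ : R →ₐ[ℂ] ℂ)
    (h₀ : ∀ x : κ → ℂ, (∀ i, ∑ j, C (x j) * (c i j).map (φ₀ : R →+* ℂ) = 0) → x = 0) :
    ∃ r : R, φ₀ r ≠ 0 ∧ ∀ φ : R →ₐ[ℂ] ℂ, φ r ≠ 0 →
      ∀ x : κ → ℂ, (∀ i, ∑ j, C (x j) * (c i j).map (φ : R →+* ℂ) = 0) → x = 0 := by
  classical
  set K := (Finset.univ.sup fun p : ι × κ => (c p.1 p.2).natDegree) + 1 with hK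
  have hdeg : ∀ i j, (c i j).natDegree < K := fun i j => Nat.lt_succ_of_le
    (Finset.le_sup (f := fun p : ι × κ => (c p.1 p.2).natDegree) (Finset.mem_univ (i, j)))
  let A : Matrix (ι × Fin K) κ R := fun p j => (c p.1 j).coeff p.2
  have hA : ∀ (φ : R →ₐ[ℂ] ℂ) (x : κ → ℂ),
      (A.map φ).mulVec x = 0 ↔ ∀ i, ∑ j, C (x j) * (c i j).map (φ : R →+* ℂ) = 0 := by
    intro φ x
    have h1 : ∀ i n, (∑ j, C (x j) * (c i j).map (φ : R →+* ℂ)).coeff n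
        = ∑ j, φ ((c i j).coeff n) * x j := by
      intro i n
      rw [finsetSum_coeff]
      refine Finset.sum_congr rfl fun j _ => ?_
      rw [coeff_C_mul, coeff_map, mul_comm]
      rfl
    constructor
    · intro h i
      ext n
      rw [h1, coeff_zero]
      rcases Nat.lt_or_ge n K with hn | hn
      · exact congrFun h (i, ⟨n, hn⟩)
      · refine Finset.sum_eq_zero fun j _ => ?_
        rw [coeff_eq_zero_of_natDegree_lt ((hdeg i j).trans_le hn), map_zero, zero_mul]
    · intro h
      ext ⟨i, n⟩
      have := h1 i n
      rw [h i, coeff_zero] at this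
      exact this.symm
  have hinj : LinearMap.ker (A.map φ₀).mulVecLin = ⊥ := by
    rw [LinearMap.ker_eq_bot']
    intro x hx
    exact h₀ x ((hA φ₀ x).1 hx)
  -- A left inverse `B` of the matrix at `φ₀` makes `det (B A)` a function equal to `1` there; where
  -- it does not vanish the matrix stays injective.
  obtain ⟨g, hg⟩ := LinearMap.exists_leftInverse_of_injective _ hinj
  set B := LinearMap.toMatrix' g with hB
  have hBA : B * A.map φ₀ = 1 := by
    have := congrArg LinearMap.toMatrix' hg
    rwa [LinearMap.toMatrix'_comp, ← Matrix.toLin'_apply', LinearMap.toMatrix'_toLin',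
      LinearMap.toMatrix'_id] at this
  have hr : ∀ φ : R →ₐ[ℂ] ℂ, φ (B.map (algebraMap ℂ R) * A).det = (B * A.map φ).det := by
    intro φ
    rw [AlgHom.map_det, AlgHom.mapMatrix_apply, Matrix.map_mul, Matrix.map_map]
    congr 2
    ext i j
    simp
  refine ⟨(B.map (algebraMap ℂ R) * A).det, ?_, fun φ hφ x hx => ?_⟩
  · rw [hr, hBA, Matrix.det_one]
    exact one_ne_zero
  · rw [hr] at hφ
    refine Matrix.eq_zero_of_mulVec_eq_zero hφ ?_
    rw [← Matrix.mulVec_mulVec, (hA φ x).2 hx, Matrix.mulVec_zero]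

/-! ### Compatibility of the linear conditions with base change -/

namespace Datum

variable {M : ℕ} {A B : Type*} [CommRing A] [CommRing B]

/-- Base change of the parameters. -/
def map (d : Datum M A) (f : A →+* B) : Datum M B where
  t k := f (d.t k)
  m := d.m
  α := f d.α
  β := f d.β
  γ := f d.γ
  η k := f (d.η k)

theorem map_N (d : Datum M A) (f : A →+* B) : (d.map f).N = d.N := rfl

theorem map_δ (d : Datum M A) (f : A →+* B) : (d.map f).δ = f d.δ := by
  simp [δ, map, N]

theorem map_T (d : Datum M A) (f : A →+* B) : (d.map f).T = d.T.map f := by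
  simp [T, map, Polynomial.map_prod]

theorem map_Tk (d : Datum M A) (f : A →+* B) (k : Fin M) : (d.map f).Tk k = (d.Tk k).map f := by
  simp [Tk, map, Polynomial.map_prod]

theorem map_mT (d : Datum M A) (f : A →+* B) : (d.map f).mT = d.mT.map f := by
  simp [mT, map_Tk, Polynomial.map_sum]
  rfl

theorem map_q (d : Datum M A) (f : A →+* B) : (d.map f).q = d.q.map f := by
  simp [q, map_T]

theorem map_p (d : Datum M A) (f : A →+* B) : (d.map f).p = d.p.map f := by
  simp [p, map_T, map_mT, map_δ]
  rfl

theorem map_S (d : Datum M A) (f : A →+* B) : (d.map f).S = d.S.map f := by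
  simp [S, map_T, map_Tk, Polynomial.map_sum]
  rfl

theorem map_H₁ (d : Datum M A) (f : A →+* B) : (d.map f).H₁ = d.H₁.map f := by
  simp [H₁, map]

theorem map_H₂ (d : Datum M A) (f : A →+* B) : (d.map f).H₂ = d.H₂.map f := by
  simp [H₂, map]

theorem map_thetaIter (d : Datum M A) (f : A →+* B) (j : ℕ) :
    (d.map f).thetaIter j = ((d.thetaIter j).1.map f, (d.thetaIter j).2.map f) := by
  induction j with
  | zero => simp [thetaIter]
  | succ j ih =>
    have h : (X - 1) * d.T.map f = ((X - 1) * d.T).map f := by simp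
    simp only [thetaIter, ih, map_q, map_p, map_S, map_T, h, derivative_map]
    simp only [Polynomial.map_sub, Polynomial.map_add, Polynomial.map_mul, map_X,
      Polynomial.map_natCast]

theorem map_opCoeff (d : Datum M A) (f : A →+* B) (E : A[X]) (j : ℕ) :
    (d.map f).opCoeff (E.map f) j = (d.opCoeff E j).map f := by
  have h1 : d.H₁.map f * (E.map f).comp (X - 1) = (d.H₁ * E.comp (X - 1)).map f := by
    simp [Polynomial.map_comp]
  have h2 : d.H₂.map f * (E.map f).comp (X + 1) = (d.H₂ * E.comp (X + 1)).map f := by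
    simp [Polynomial.map_comp]
  rw [opCoeff, map_H₁, map_H₂, h1, h2, coeff_map, coeff_map, opCoeff]
  simp only [Polynomial.map_sub, Polynomial.map_mul, map_X, map_C]

theorem map_eulerPart (d : Datum M A) (f : A →+* B) (j : ℕ) :
    (d.map f).eulerPart j = (d.eulerPart j).map f := by
  have h1 : (X - 1) * d.T.map f = ((X - 1) * d.T).map f := by simp
  have h2 : X * d.S.map f = (X * d.S).map f := by simp
  rw [eulerPart, map_T, map_p, map_S, h1, h2, coeff_map, coeff_map, coeff_map, eulerPart]
  simp only [Polynomial.map_sub, Polynomial.map_add, Polynomial.map_mul, Polynomial.map_pow, map_X,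
    map_C]

theorem map_shiftFactor (d : Datum M A) (f : A →+* B) (j : ℕ) :
    (d.map f).shiftFactor j = (d.shiftFactor j).map f := by
  simp [shiftFactor, Polynomial.map_prod, Polynomial.map_comp, map_H₁, map_H₂]

/-- The three linear conditions on the Euler polynomial. -/
def condition (d : Datum M A) (i : Fin 3) (E : A[X]) : A[X] :=
  ![(d.rem E).1, (d.rem E).2, d.indicial E] i

theorem map_condition (d : Datum M A) (f : A →+* B) (i : Fin 3) (E : A[X]) :
    (d.map f).condition i (E.map f) = (d.condition i E).map f := by
  have h : (X - 1) * d.T.map f = ((X - 1) * d.T).map f := by simp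
  fin_cases i
  · simp only [condition, rem, map_opCoeff, map_T, map_thetaIter, map_N, h]
    simp [Polynomial.map_sum]
  · simp only [condition, rem, map_opCoeff, map_T, map_thetaIter, map_N, h]
    simp [Polynomial.map_sum]
  · simp [condition, indicial, Polynomial.map_sum, map_eulerPart, map_shiftFactor,
      Polynomial.map_comp]

theorem opCoeff_add (d : Datum M A) (E E' : A[X]) (j : ℕ) :
    d.opCoeff (E + E') j = d.opCoeff E j + d.opCoeff E' j := by
  simp only [opCoeff, add_comp, mul_add, coeff_add, C_add]
  ring

theorem opCoeff_C_mul (d : Datum M A) (c : A) (E : A[X]) (j : ℕ) :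
    d.opCoeff (C c * E) j = C c * d.opCoeff E j := by
  simp only [opCoeff, C_mul_comp, mul_left_comm _ (C c), coeff_C_mul, C_mul]
  ring

theorem condition_add (d : Datum M A) (i : Fin 3) (E E' : A[X]) :
    d.condition i (E + E') = d.condition i E + d.condition i E' := by
  fin_cases i
  · simp [condition, rem, opCoeff_add, add_mul, Finset.sum_add_distrib]
  · simp [condition, rem, opCoeff_add, add_mul, Finset.sum_add_distrib]
  · simp [condition, indicial, mul_add, add_mul, Finset.sum_add_distrib]

theorem condition_C_mul (d : Datum M A) (i : Fin 3) (c : A) (E : A[X]) :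
    d.condition i (C c * E) = C c * d.condition i E := by
  fin_cases i
  · simp [condition, rem, opCoeff_C_mul, mul_assoc, Finset.mul_sum]
  · simp [condition, rem, opCoeff_C_mul, mul_assoc, Finset.mul_sum]
  · simp [condition, indicial, Finset.mul_sum, mul_left_comm _ (C c), mul_assoc]

theorem condition_sum (d : Datum M A) (i : Fin 3) {κ : Type*} (s : Finset κ) (x : κ → A)
    (E : κ → A[X]) :
    d.condition i (∑ j ∈ s, C (x j) * E j) = ∑ j ∈ s, C (x j) * d.condition i (E j) := by
  classical
  induction s using Finset.induction_on with
  | empty =>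
    have := d.condition_C_mul i 0 0
    simpa using this
  | insert j s hj ih => rw [Finset.sum_insert hj, Finset.sum_insert hj, condition_add, ih,
      condition_C_mul]

theorem condition_eq_zero_iff (d : Datum M A) (E : A[X]) :
    (∀ i, d.condition i E = 0) ↔ d.rem E = 0 ∧ d.indicial E = 0 := by
  rw [Fin.forall_fin_succ, Fin.forall_fin_two, Prod.ext_iff, and_assoc]
  rfl

end Datum
-- Frobenius method and the obstruction to apparentness
/-- The coefficient of `(z - t) ^ n` in the Taylor expansion of `f` at `t`. -/
def localCoeff {A : Type*} [CommRing A] (t : A) (n : ℕ) (f : A[X]) : A := (taylor t f).coeff n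

section LocalCoeff

variable {A B : Type*} [CommRing A] [CommRing B] (t : A) (n : ℕ)

theorem localCoeff_add (f g : A[X]) :
    localCoeff t n (f + g) = localCoeff t n f + localCoeff t n g := by
  simp [localCoeff]

theorem localCoeff_sub (f g : A[X]) :
    localCoeff t n (f - g) = localCoeff t n f - localCoeff t n g := by
  simp [localCoeff]

theorem localCoeff_C_mul (c : A) (f : A[X]) :
    localCoeff t n (C c * f) = c * localCoeff t n f := by
  simp [localCoeff, taylor_mul]

theorem localCoeff_pow_mul (f : A[X]) : localCoeff t n ((X - C t) ^ n * f) = f.eval t := by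
  have h : taylor t (X - C t) = X := by simp
  have h2 : taylor t ((X - C t) ^ n) = X ^ n := by
    rw [← taylorAlgHom_apply, map_pow, taylorAlgHom_apply, h]
  rw [localCoeff, taylor_mul, h2]
  have := coeff_X_pow_mul (taylor t f) n 0
  rwa [zero_add, taylor_coeff_zero] at this

theorem map_localCoeff (φ : A →+* B) (f : A[X]) :
    localCoeff (φ t) n (f.map φ) = φ (localCoeff t n f) := by
  rw [localCoeff, ← map_taylor, coeff_map, localCoeff]

theorem pow_succ_dvd_of_localCoeff {t : A} {n : ℕ} {f : A[X]} (h : (X - C t) ^ n ∣ f)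
    (h0 : localCoeff t n f = 0) : (X - C t) ^ (n + 1) ∣ f := by
  obtain ⟨g, rfl⟩ := h
  rw [localCoeff_pow_mul] at h0
  rw [pow_succ]
  exact mul_dvd_mul_left _ (dvd_iff_isRoot.2 h0)

theorem localCoeff_of_dvd {t : A} {n : ℕ} {f : A[X]} (h : (X - C t) ^ (n + 1) ∣ f) :
    localCoeff t n f = 0 := by
  obtain ⟨g, rfl⟩ := h
  rw [pow_succ, mul_assoc, localCoeff_pow_mul]
  simp

end LocalCoeff

namespace Datum

variable {M : ℕ} {A B : Type*} [CommRing A] [CommRing B]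

/-- The second order operator with polynomial coefficients. -/
def oper (d : Datum M A) (f : A[X]) : A[X] :=
  d.q * derivative (derivative f) + d.p * derivative f + d.S * f

theorem oper_sub (d : Datum M A) (f g : A[X]) : d.oper (f - g) = d.oper f - d.oper g := by
  simp only [oper, derivative_sub]; ring

theorem oper_C_mul (d : Datum M A) (c : A) (f : A[X]) : d.oper (C c * f) = C c * d.oper f := by
  simp only [oper, derivative_C_mul]; ring

theorem map_oper (d : Datum M A) (φ : A →+* B) (f : A[X]) :
    (d.map φ).oper (f.map φ) = (d.oper f).map φ := by
  simp only [oper, map_q, map_p, map_S, derivative_map, Polynomial.map_add, Polynomial.map_mul]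

/-- The derivative of the leading coefficient at `t_k`. -/
def weight (d : Datum M A) (k : Fin M) : A := d.t k * (d.t k - 1) * (d.Tk k).eval (d.t k)

theorem p_eval (d : Datum M A) (k : Fin M) : d.p.eval (d.t k) = -(d.m k * d.weight k) := by
  have : d.T.eval (d.t k) = 0 := by rw [← d.X_sub_mul_Tk k]; simp
  simp [p, this, mT_eval, weight]
  ring

/-- The factor `(n + 1)(n - m_k)` is the indicial polynomial at exponent `n + 1`; its zero at `n =
m_k` is the resonance. -/
theorem exists_oper_pow_mul (d : Datum M A) (k : Fin M) (n : ℕ) (h : A[X]) :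
    ∃ w, d.oper ((X - C (d.t k)) ^ (n + 1) * h) = (X - C (d.t k)) ^ n * w ∧
      w.eval (d.t k) = (n + 1) * (n - d.m k) * d.weight k * h.eval (d.t k) := by
  have hp := d.p_eval k
  set x := X - C (d.t k) with hx
  refine ⟨X * (X - 1) * d.Tk k * (((n : A[X]) + 1) * (n : A[X]) * h + 2 * ((n : A[X]) + 1) * x * derivative h
    + x ^ 2 * derivative (derivative h)) + d.p * (((n : A[X]) + 1) * h + x * derivative h) + d.S * x * h,
    ?_, ?_⟩
  · have hD : x * derivative (x ^ n) = n * x ^ n := by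
      rw [hx, derivative_X_sub_C_pow]
      cases n with
      | zero => simp
      | succ n => rw [Nat.add_sub_cancel, pow_succ, map_natCast]; ring
    have hD' : derivative (x ^ (n + 1)) = (n + 1) * x ^ n := by
      rw [hx, derivative_X_sub_C_pow, Nat.add_sub_cancel]; simp
    rw [oper, derivative_mul, hD']
    simp only [derivative_add, derivative_mul, derivative_natCast, derivative_one, hD', q,
      ← d.X_sub_mul_Tk k, ← hx]
    linear_combination X * (X - 1) * d.Tk k * (n + 1) * h * hD
  · simp [hp, weight, hx]
    ring

variable [Algebra ℂ A] [Algebra ℂ B]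

/-- The Frobenius approximations to the local solution with exponent zero. -/
def frob (d : Datum M A) (κ : ℂ) (k : Fin M) : ℕ → A[X]
  | 0 => 1
  -- The number `κ` is meant to be `weight k`, the derivative of `q` at `t_k`. The points `t_k` are
  -- not deformed, so it is a complex constant and the recursion makes sense over any `ℂ`-algebra.
  | n + 1 => d.frob κ k n - C ((((n + 1) * (n - d.m k) * κ)⁻¹ : ℂ) •
      localCoeff (d.t k) n (d.oper (d.frob κ k n))) * (X - C (d.t k)) ^ (n + 1)

/-- The coefficient of the logarithmic term, up to a constant. -/
def obstruction (d : Datum M A) (κ : ℂ) (k : Fin M) : A :=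
  localCoeff (d.t k) (d.m k) (d.oper (d.frob κ k (d.m k)))

theorem map_frob (d : Datum M A) (φ : A →ₐ[ℂ] B) (κ : ℂ) (k : Fin M) (n : ℕ) :
    (d.map (φ : A →+* B)).frob κ k n = (d.frob κ k n).map (φ : A →+* B) := by
  induction n with
  | zero => simp [frob]
  | succ n ih =>
    have ht : (d.map (φ : A →+* B)).t k = (φ : A →+* B) (d.t k) := rfl
    have hm : (d.map (φ : A →+* B)).m k = d.m k := rfl
    have hs : ∀ (c : ℂ) (a : A), (φ : A →+* B) (c • a) = c • (φ : A →+* B) a := fun c a =>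
      map_smul φ c a
    rw [frob, ih, map_oper, ht, hm, map_localCoeff, frob, ← hs]
    simp only [Polynomial.map_sub, Polynomial.map_mul, Polynomial.map_pow, map_X, map_C]

theorem map_obstruction (d : Datum M A) (φ : A →ₐ[ℂ] B) (κ : ℂ) (k : Fin M) :
    (d.map (φ : A →+* B)).obstruction κ k = φ (d.obstruction κ k) := by
  have ht : (d.map (φ : A →+* B)).t k = (φ : A →+* B) (d.t k) := rfl
  have hm : (d.map (φ : A →+* B)).m k = d.m k := rfl
  rw [obstruction, map_frob, map_oper, ht, hm, map_localCoeff, obstruction]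
  rfl

theorem frob_coeff_ne_zero (d : Datum M ℂ) (hd : d.Distinct) (k : Fin M) {n : ℕ} (hn : n < d.m k) :
    ((n + 1) * (n - d.m k) * d.weight k : ℂ) ≠ 0 := by
  refine mul_ne_zero (mul_ne_zero (Nat.cast_add_one_ne_zero n) ?_) ?_
  · rw [sub_ne_zero]
    exact_mod_cast hn.ne
  · exact mul_ne_zero (mul_ne_zero (hd.ne_zero k) (sub_ne_zero.2 (hd.ne_one k)))
      (d.Tk_eval_ne_zero hd k)

theorem frob_spec (d : Datum M ℂ) (hd : d.Distinct) (k : Fin M) {n : ℕ} (hn : n ≤ d.m k) :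
    (d.frob (d.weight k) k n).eval (d.t k) = 1 ∧
      (X - C (d.t k)) ^ n ∣ d.oper (d.frob (d.weight k) k n) := by
  induction n with
  | zero => simp [frob]
  | succ n ih =>
    obtain ⟨h1, h2⟩ := ih (by omega)
    refine ⟨by simp [frob, h1], ?_⟩
    obtain ⟨w, hw, hwt⟩ := d.exists_oper_pow_mul k n 1
    have h3 := d.frob_coeff_ne_zero hd k (Nat.lt_of_succ_le hn)
    rw [mul_one] at hw
    rw [frob, oper_sub, oper_C_mul, hw]
    refine pow_succ_dvd_of_localCoeff (dvd_sub h2 ((dvd_mul_right _ _).mul_left _)) ?_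
    rw [localCoeff_sub, localCoeff_C_mul, localCoeff_pow_mul, hwt, eval_one, mul_one, smul_eq_mul,
      mul_right_comm _ _ (d.weight k)]
    rw [mul_right_comm] at h3
    rw [mul_comm _⁻¹, mul_assoc, inv_mul_cancel₀ h3, mul_one, sub_self]

theorem frob_unique (d : Datum M ℂ) (hd : d.Distinct) (k : Fin M) {f : ℂ[X]}
    (hf : f.eval (d.t k) = 1) (h : (X - C (d.t k)) ^ (d.m k + 1) ∣ d.oper f) {n : ℕ}
    (hn : n ≤ d.m k) : (X - C (d.t k)) ^ (n + 1) ∣ f - d.frob (d.weight k) k n := by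
  induction n with
  | zero => simpa [frob, hf] using (dvd_iff_isRoot (a := d.t k) (p := f - 1)).2 (by simp [hf])
  | succ n ih =>
    obtain ⟨g, hg⟩ := ih (by omega)
    obtain ⟨w, hw, hwt⟩ := d.exists_oper_pow_mul k n g
    have h3 := d.frob_coeff_ne_zero hd k (Nat.lt_of_succ_le hn)
    have h4 : localCoeff (d.t k) n (d.oper f) = 0 :=
      localCoeff_of_dvd ((pow_dvd_pow _ (by omega)).trans h)
    have h5 : d.oper (d.frob (d.weight k) k n) = d.oper f - d.oper ((X - C (d.t k)) ^ (n + 1) * g) := by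
      rw [← hg, oper_sub]; ring
    have h6 : localCoeff (d.t k) n (d.oper (d.frob (d.weight k) k n))
        = -((n + 1) * (n - d.m k) * d.weight k * g.eval (d.t k)) := by
      rw [h5, localCoeff_sub, h4, hw, localCoeff_pow_mul, hwt, zero_sub]
    have h7 : f - d.frob (d.weight k) k (n + 1)
        = (X - C (d.t k)) ^ (n + 1) * (g - C (g.eval (d.t k))) := by
      have h8 : (((n + 1) * (n - d.m k) * d.weight k)⁻¹ : ℂ) •
          -((n + 1) * (n - d.m k) * d.weight k * g.eval (d.t k)) = -g.eval (d.t k) := by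
        rw [smul_eq_mul]
        generalize ((n : ℂ) + 1) * (n - d.m k) * d.weight k = a at h3 ⊢
        field_simp
      rw [frob, h6, h8, C_neg]
      linear_combination hg
    rw [h7, pow_succ _ (n + 1)]
    refine mul_dvd_mul_left _ (dvd_iff_isRoot.2 (by simp))

/-- A polynomial solution to order `m_k + 1` agrees, after scaling, with the Frobenius approximation
up to a multiple of `(z - t_k)^(m_k + 1)`. By resonance such a multiple does not change the
obstruction. -/
theorem obstruction_eq_zero_iff (d : Datum M ℂ) (hd : d.Distinct) (k : Fin M) :
    d.obstruction (d.weight k) k = 0 ↔ d.ApparentAt k := by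
  obtain ⟨h1, h2⟩ := d.frob_spec hd k le_rfl
  constructor
  · intro h
    exact ⟨_, by rw [h1]; exact one_ne_zero, pow_succ_dvd_of_localCoeff h2 h⟩
  · rintro ⟨f, hf, h⟩
    obtain ⟨g, hg⟩ := d.frob_unique hd k (f := C (f.eval (d.t k))⁻¹ * f) (by simp [hf])
      (by rw [oper_C_mul]; exact h.mul_left _) le_rfl
    obtain ⟨w, hw, hwt⟩ := d.exists_oper_pow_mul k (d.m k) g
    have h3 : d.oper (d.frob (d.weight k) k (d.m k))
        = C (f.eval (d.t k))⁻¹ * d.oper f - (X - C (d.t k)) ^ d.m k * w := by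
      rw [← hw, ← hg, oper_sub, oper_C_mul]; ring
    rw [obstruction, h3, localCoeff_sub, localCoeff_C_mul, localCoeff_of_dvd (f := d.oper f) h, localCoeff_pow_mul,
      hwt]
    simp

/-! ### The leading form of the obstruction -/

/-- All coefficients of `f` have terms of total degree less than `n` only. -/
def CoeffLow {σ A : Type*} [CommRing A] (n : ℕ) (f : (MvPolynomial σ A)[X]) : Prop :=
  ∀ i, Low n (f.coeff i)

section CoeffLow

variable {σ A : Type*} [CommRing A] {n m : ℕ} {f g : (MvPolynomial σ A)[X]}

theorem CoeffLow.mono (h : CoeffLow n f) (hnm : n ≤ m) : CoeffLow m f := fun i => (h i).mono hnm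

theorem CoeffLow.add (hf : CoeffLow n f) (hg : CoeffLow n g) : CoeffLow n (f + g) := fun i => by
  rw [coeff_add]; exact (hf i).add (hg i)

theorem CoeffLow.neg (hf : CoeffLow n f) : CoeffLow n (-f) := fun i => by
  rw [coeff_neg]; exact (hf i).neg

theorem CoeffLow.sum {ι : Type*} {s : Finset ι} {f : ι → (MvPolynomial σ A)[X]}
    (h : ∀ i ∈ s, CoeffLow n (f i)) : CoeffLow n (∑ i ∈ s, f i) := fun j => by
  rw [finsetSum_coeff]; exact Low.sum fun i hi => h i hi j

theorem CoeffLow.mul (hf : CoeffLow n f) (hg : CoeffLow (m + 1) g) : CoeffLow (n + m) (f * g) :=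
  fun i => by
    rw [coeff_mul]; exact Low.sum fun x _ => (hf _).mul (hg _)

theorem coeffLow_map (f : A[X]) : CoeffLow 1 (f.map (MvPolynomial.C : A →+* MvPolynomial σ A)) :=
  fun i => by
    rw [coeff_map]; exact low_C _

theorem coeffLow_C {a : MvPolynomial σ A} (ha : Low n a) : CoeffLow n (C a) := fun i => by
  rw [coeff_C]; split_ifs
  · exact ha
  · exact low_zero

theorem CoeffLow.derivative (hf : CoeffLow n f) : CoeffLow n (derivative f) := fun i => by
  rw [coeff_derivative]
  have h : ((i : MvPolynomial σ A) + 1) = MvPolynomial.C ((i : A) + 1) := by simp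
  rw [h]
  exact (hf _).mul (low_C _)

theorem CoeffLow.localCoeff (hf : CoeffLow n f) (t : A) (i : ℕ) :
    Low n (localCoeff (MvPolynomial.C t) i f) := by
  have h : ∀ s : Finset ℕ, CoeffLow n (∑ e ∈ s, C (f.coeff e) * (X + C (MvPolynomial.C t)) ^ e) :=
    fun s => CoeffLow.sum fun e _ => by
      have := coeffLow_map (σ := σ) ((X + C t) ^ e)
      rw [Polynomial.map_pow, Polynomial.map_add, map_X, map_C] at this
      exact (coeffLow_C (hf e)).mul this
  rw [Fuchsian.localCoeff, taylor_apply, comp_eq_sum_left]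
  exact h _ i

end CoeffLow

/-- The universal deformation of the parameters: the exponents move along a line in the direction
`(1, 1, 3)` and the accessory parameters are free. -/
def universal (d : Datum M ℂ) : Datum M (MvPolynomial (Fin M) ℂ[X]) where
  t k := MvPolynomial.C (C (d.t k))
  m := d.m
  α := MvPolynomial.C (C d.α + X)
  β := MvPolynomial.C (C d.β + X)
  -- With slope 3 the quantities `α`, `β`, `α - γ`, `β - γ`, `δ` have slopes `1, 1, -2, -2, -1`; all
  -- are nonzero, so each is an integer only for countably many values.
  γ := MvPolynomial.C (C d.γ + 3 * X)
  η k := MvPolynomial.X k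

/-- The deformation of the exponents only. -/
def exponents (d : Datum M ℂ) : Datum M ℂ[X] where
  t k := C (d.t k)
  m := d.m
  α := C d.α + X
  β := C d.β + X
  γ := C d.γ + 3 * X
  η _ := 0

theorem universal_q (d : Datum M ℂ) : d.universal.q = d.exponents.q.map MvPolynomial.C :=
  d.exponents.map_q MvPolynomial.C

theorem universal_p (d : Datum M ℂ) : d.universal.p = d.exponents.p.map MvPolynomial.C :=
  d.exponents.map_p MvPolynomial.C

theorem universal_T (d : Datum M ℂ) : d.universal.T = d.exponents.T.map MvPolynomial.C :=
  d.exponents.map_T MvPolynomial.C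

theorem universal_Tk (d : Datum M ℂ) (k : Fin M) :
    d.universal.Tk k = (d.exponents.Tk k).map MvPolynomial.C :=
  d.exponents.map_Tk MvPolynomial.C k

theorem exponents_Tk_eval (d : Datum M ℂ) (k : Fin M) :
    (d.exponents.Tk k).eval (C (d.t k)) = C ((d.Tk k).eval (d.t k)) := by
  simp [Tk, eval_prod, exponents]

theorem universal_S_eval (d : Datum M ℂ) (k : Fin M) :
    d.universal.S.eval (MvPolynomial.C (C (d.t k)))
      = MvPolynomial.C (C ((d.Tk k).eval (d.t k))) * MvPolynomial.X k := by
  have h1 : d.universal.T.eval (d.universal.t k) = 0 := by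
    rw [← d.universal.X_sub_mul_Tk k]; simp
  have h2 : (d.universal.Tk k).eval (d.universal.t k)
      = MvPolynomial.C (C ((d.Tk k).eval (d.t k))) := by
    rw [universal_Tk, ← exponents_Tk_eval]
    exact eval_map_apply _ _
  change d.universal.S.eval (d.universal.t k) = _
  rw [S, eval_add, eval_mul, h1, mul_zero, zero_add, eval_finsetSum, Finset.sum_eq_single k]
  · rw [eval_mul, h2, eval_C, mul_comm]; rfl
  · intro j _ hj
    rw [eval_mul, d.universal.Tk_eval_of_ne hj.symm, mul_zero]
  · simp

theorem coeffLow_universal_S (d : Datum M ℂ) : CoeffLow 2 d.universal.S := by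
  refine CoeffLow.add ?_ (CoeffLow.sum fun k _ => ?_)
  · have h : d.universal.α * d.universal.β = MvPolynomial.C ((C d.α + X) * (C d.β + X)) := by
      rw [MvPolynomial.C_mul]; rfl
    rw [universal_T, h]
    exact (coeffLow_C ((low_C _).mono one_le_two)).mul (coeffLow_map _)
  · rw [universal_Tk]
    exact (coeffLow_C (low_X k)).mul (coeffLow_map _)

/-- The coefficients `q` and `p` do not involve the accessory parameters and `S` is of degree one in
them. The only contribution of top degree is thus `S(t_k) c`, and `S(t_k)` is a constant times
`η_k`. -/
theorem localCoeff_oper_universal (d : Datum M ℂ) (k : Fin M) {n : ℕ} {f : (MvPolynomial (Fin M) ℂ[X])[X]}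
    {c : MvPolynomial (Fin M) ℂ[X]} (hc : Low (n + 1) c)
    (hf : CoeffLow n (f - C c * (X - C (d.universal.t k)) ^ n)) :
    Low (n + 1) (localCoeff (d.universal.t k) n (d.universal.oper f)
      - MvPolynomial.C (C ((d.Tk k).eval (d.t k))) * MvPolynomial.X k * c) := by
  set x := X - C (d.universal.t k) with hx
  have hxl : CoeffLow 1 (x ^ n) := by
    have := coeffLow_map (σ := Fin M) ((X - C (C (d.t k))) ^ n)
    rwa [Polynomial.map_pow, Polynomial.map_sub, map_X, map_C] at this
  have hf' : CoeffLow (n + 1) f := by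
    have := (hf.mono (Nat.le_succ n)).add ((coeffLow_C hc).mul hxl)
    rwa [sub_add_cancel] at this
  have h1 : CoeffLow (n + 1) (d.universal.q * derivative (derivative f)
      + d.universal.p * derivative f + (f - C c * x ^ n) * d.universal.S) := by
    rw [universal_q, universal_p]
    refine CoeffLow.add (CoeffLow.add ?_ ?_) (hf.mul d.coeffLow_universal_S)
    · rw [mul_comm]; exact hf'.derivative.derivative.mul (coeffLow_map _)
    · rw [mul_comm]; exact hf'.derivative.mul (coeffLow_map _)
  have h2 : d.universal.oper f = (d.universal.q * derivative (derivative f)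
      + d.universal.p * derivative f + (f - C c * x ^ n) * d.universal.S)
      + C c * (x ^ n * d.universal.S) := by
    rw [oper]; ring
  have h3 : d.universal.S.eval (d.universal.t k) = _ := d.universal_S_eval k
  rw [h2, localCoeff_add, localCoeff_C_mul, localCoeff_pow_mul, h3, mul_comm c, add_sub_cancel_right]
  exact h1.localCoeff _ _

theorem low_smul {σ A : Type*} [CommRing A] [Algebra ℂ A] {n : ℕ} {f : MvPolynomial σ A} (c : ℂ)
    (hf : Low n f) : Low n (c • f) := fun e he => by
  rw [MvPolynomial.coeff_smul, hf e he, smul_zero]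

theorem frob_universal (d : Datum M ℂ) (hd : d.Distinct) (k : Fin M) {n : ℕ} (hn : n ≤ d.m k) :
    ∃ a : ℂ, a ≠ 0 ∧ CoeffLow n (d.universal.frob (d.weight k) k n
      - C (MvPolynomial.C (C a) * MvPolynomial.X k ^ n) * (X - C (d.universal.t k)) ^ n) := by
  induction n with
  | zero => exact ⟨1, one_ne_zero, fun i => by simp [frob, low_zero]⟩
  | succ n ih =>
    obtain ⟨a, ha, h⟩ := ih (by omega)
    have h3 := d.frob_coeff_ne_zero hd k (Nat.lt_of_succ_le hn)
    set κ := d.weight k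
    set r : ℂ := (((n + 1) * (n - d.m k) * κ)⁻¹ : ℂ) with hr
    set f := d.universal.frob κ k n
    set c : MvPolynomial (Fin M) ℂ[X] := MvPolynomial.C (C a) * MvPolynomial.X k ^ n with hc
    set x := X - C (d.universal.t k) with hx
    have hcl : Low (n + 1) c := by
      have := low_monomial (Finsupp.single k n) (C a)
      rw [Finsupp.degree_single] at this
      rwa [hc, MvPolynomial.X_pow_eq_monomial, MvPolynomial.C_mul_monomial, mul_one]
    have h4 := d.localCoeff_oper_universal k hcl h
    set b := (d.Tk k).eval (d.t k) with hb
    have hb0 : b ≠ 0 := d.Tk_eval_ne_zero hd k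
    have hxl : ∀ n, CoeffLow 1 (x ^ n) := fun n => by
      have := coeffLow_map (σ := Fin M) ((X - C (C (d.t k))) ^ n)
      rwa [Polynomial.map_pow, Polynomial.map_sub, map_X, map_C] at this
    have hf' : CoeffLow (n + 1) f := by
      have := (h.mono (Nat.le_succ n)).add ((coeffLow_C hcl).mul (hxl n))
      rwa [sub_add_cancel] at this
    -- Each Frobenius step multiplies the leading form by `-r b η_k`, with `r` the reciprocal of the
    -- recursion factor.
    refine ⟨-(r * b * a), neg_ne_zero.2 (mul_ne_zero (mul_ne_zero (inv_ne_zero h3) hb0) ha), ?_⟩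
    set u := localCoeff (d.universal.t k) n (d.universal.oper f) with hu
    have h5 : d.universal.frob κ k (n + 1) = f - C (r • u) * x ^ (n + 1) := rfl
    have h6 : d.universal.frob κ k (n + 1)
        - C (MvPolynomial.C (C (-(r * b * a))) * MvPolynomial.X k ^ (n + 1)) * x ^ (n + 1)
        = f + -(C (r • (u - MvPolynomial.C (C b) * MvPolynomial.X k * c)) * x ^ (n + 1)) := by
      have h7 : ∀ g : MvPolynomial (Fin M) ℂ[X], r • g = MvPolynomial.C (C r) * g := fun g => by
        rw [Algebra.smul_def]; rfl
      rw [h5, h7, h7, hc]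
      simp only [C_neg, C_mul, C_sub, C_pow, MvPolynomial.C_mul, MvPolynomial.C_neg]
      ring
    rw [h6]
    exact hf'.add ((coeffLow_C (low_smul r h4)).mul (hxl (n + 1))).neg

/-- The obstruction at `t_k` is dominated by a power of the accessory parameter at `t_k`. -/
theorem obstruction_universal (d : Datum M ℂ) (hd : d.Distinct) (k : Fin M) :
    ∃ a : ℂ, a ≠ 0 ∧ Low (d.m k + 1) (d.universal.obstruction (d.weight k) k
      - MvPolynomial.C (C a) * MvPolynomial.X k ^ (d.m k + 1)) := by
  obtain ⟨a, ha, h⟩ := d.frob_universal hd k le_rfl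
  have hcl : Low (d.m k + 1) (MvPolynomial.C (C a) * MvPolynomial.X k ^ d.m k :
      MvPolynomial (Fin M) ℂ[X]) := by
    have := low_monomial (Finsupp.single k (d.m k)) (C a)
    rw [Finsupp.degree_single] at this
    rwa [MvPolynomial.X_pow_eq_monomial, MvPolynomial.C_mul_monomial, mul_one]
  refine ⟨(d.Tk k).eval (d.t k) * a, mul_ne_zero (d.Tk_eval_ne_zero hd k) ha, ?_⟩
  have h2 := d.localCoeff_oper_universal k hcl h
  have h3 : MvPolynomial.C (C ((d.Tk k).eval (d.t k) * a)) * MvPolynomial.X k ^ (d.m k + 1)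
      = MvPolynomial.C (C ((d.Tk k).eval (d.t k))) * MvPolynomial.X k *
        (MvPolynomial.C (C a) * MvPolynomial.X k ^ d.m k : MvPolynomial (Fin M) ℂ[X]) := by
    rw [C_mul, MvPolynomial.C_mul]; ring
  rw [h3]
  exact h2

/-! ### Existence of the Euler polynomial -/

section Point

variable (d : Datum M ℂ) (φ : MvPolynomial (Fin M) ℂ[X] →ₐ[ℂ] ℂ)

/-- A point of the universal deformation. -/
def point : Datum M ℂ := d.universal.map (φ : MvPolynomial (Fin M) ℂ[X] →+* ℂ)

theorem point_t : (d.point φ).t = d.t := funext fun k => φ.commutes (d.t k)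

theorem map_C_C (c : ℂ) : φ (MvPolynomial.C (C c)) = c := φ.commutes c

theorem point_α : (d.point φ).α = d.α + φ (MvPolynomial.C X) := by
  change φ (MvPolynomial.C (C d.α + X)) = _
  rw [MvPolynomial.C_add, map_add, map_C_C]

theorem point_β : (d.point φ).β = d.β + φ (MvPolynomial.C X) := by
  change φ (MvPolynomial.C (C d.β + X)) = _
  rw [MvPolynomial.C_add, map_add, map_C_C]

theorem point_γ : (d.point φ).γ = d.γ + 3 * φ (MvPolynomial.C X) := by
  change φ (MvPolynomial.C (C d.γ + 3 * X)) = _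
  rw [MvPolynomial.C_add, map_add, map_C_C, MvPolynomial.C_mul, map_mul,
    show (3 : ℂ[X]) = C 3 from rfl, map_C_C]

theorem point_distinct (hd : d.Distinct) : (d.point φ).Distinct where
  inj := by rw [point_t]; exact hd.inj
  ne_zero := by rw [point_t]; exact hd.ne_zero
  ne_one := by rw [point_t]; exact hd.ne_one

theorem point_weight (k : Fin M) : (d.point φ).weight k = d.weight k := by
  simp only [weight, Tk, point_t]

theorem point_apparent_iff (hd : d.Distinct) (k : Fin M) :
    (d.point φ).ApparentAt k ↔ φ (d.universal.obstruction (d.weight k) k) = 0 := by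
  rw [← obstruction_eq_zero_iff _ (d.point_distinct φ hd), point_weight, point, map_obstruction]

/-- The parameters at which the deformation is not generic. -/
def bad : Set ℂ := ⋃ n : ℤ, {n - d.α, n - d.β, (d.α - d.γ - n) / 2, (d.β - d.γ - n) / 2, d.δ - n}

theorem bad_countable : d.bad.Countable :=
  Set.countable_iUnion fun _ => (Set.toFinite _).countable

theorem point_generic (h : φ (MvPolynomial.C X) ∉ d.bad) : (d.point φ).Generic := by
  rw [bad, Set.mem_iUnion, not_exists] at h
  have hδ : (d.point φ).δ = d.δ - φ (MvPolynomial.C X) := by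
    rw [δ, point_α, point_β, point_γ, δ]
    simp only [N, point, map, universal]
    ring
  constructor
  · intro n hn
    rw [point_α] at hn
    exact h n (by left; rw [← hn]; ring)
  · intro n hn
    rw [point_β] at hn
    exact h n (by right; left; rw [← hn]; ring)
  · intro n hn
    rw [point_α, point_γ] at hn
    exact h n (by right; right; left; rw [← hn]; ring)
  · intro n hn
    rw [point_β, point_γ] at hn
    exact h n (by right; right; right; left; rw [← hn]; ring)
  · intro n hn
    rw [hδ] at hn
    exact h n (by right; right; right; right; rw [← hn, Set.mem_singleton_iff]; ring)

theorem point_condition {n : ℕ} (i : Fin 3) (x : Fin n → ℂ) :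
    ∑ j, C (x j) * (d.universal.condition i (X ^ (j : ℕ))).map
      (φ : MvPolynomial (Fin M) ℂ[X] →+* ℂ)
      = (d.point φ).condition i (∑ j, C (x j) * X ^ (j : ℕ)) := by
  rw [condition_sum]
  refine Finset.sum_congr rfl fun j _ => ?_
  rw [← map_condition, Polynomial.map_pow, map_X]
  rfl

end Point

/-- The point of the universal deformation which gives back the parameters. -/
def basePoint (d : Datum M ℂ) : MvPolynomial (Fin M) ℂ[X] →ₐ[ℂ] ℂ :=
  MvPolynomial.aevalTower (Polynomial.aeval (0 : ℂ)) d.η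

theorem point_basePoint (d : Datum M ℂ) : d.point d.basePoint = d := by
  have h : d.basePoint (MvPolynomial.C X) = 0 := by simp [basePoint]
  have hη : (d.point d.basePoint).η = d.η := funext fun k => MvPolynomial.aevalTower_X _ _ _
  have ht := d.point_t d.basePoint
  have hα := d.point_α d.basePoint
  have hβ := d.point_β d.basePoint
  have hγ := d.point_γ d.basePoint
  rw [h] at hα hβ hγ
  rw [add_zero] at hα hβ
  rw [mul_zero, add_zero] at hγ
  have hm : (d.point d.basePoint).m = d.m := rfl
  generalize d.point d.basePoint = d' at *
  cases d'
  cases d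
  simp only at ht hm hα hβ hγ hη
  subst ht hm hα hβ hγ hη
  rfl

theorem sum_C_mul_X_pow_eq_zero {n : ℕ} {x : Fin n → ℂ}
    (h : ∑ j : Fin n, C (x j) * X ^ (j : ℕ) = 0) : x = 0 := by
  ext j
  have := congrArg (fun f => coeff f j) h
  simp only [finsetSum_coeff, coeff_C_mul, coeff_X_pow, coeff_zero] at this
  rw [Finset.sum_eq_single j] at this
  · simpa using this
  · intro i _ hij
    rw [if_neg (fun h => hij (Fin.ext h.symm)), mul_zero]
  · simp

theorem sum_coeff_mul_X_pow {n : ℕ} {E : ℂ[X]} (hE : E.natDegree ≤ n) :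
    ∑ j : Fin (n + 1), C (E.coeff j) * X ^ (j : ℕ) = E := by
  rw [Finset.sum_range (fun j => C (E.coeff j) * X ^ j) |>.symm,
    ← as_sum_range_C_mul_X_pow' (p := E) (by omega)]

/-- There is an Euler polynomial of degree `N` for which the remainder vanishes. -/
theorem exists_rem_eq_zero (d : Datum M ℂ) (hd : d.Distinct) (ha : ∀ k, d.ApparentAt k) {n : ℕ}
    (hN : d.N = n + 1) : ∃ E : ℂ[X], E.natDegree = d.N ∧ d.rem E = 0 := by
  by_contra! hcon
  -- At the given parameters `indicial` forces degree `N`, so if no `E` of degree `N` has zero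
  -- remainder, the combined conditions have trivial kernel.
  have hinj : ∀ x : Fin (d.N + 1) → ℂ,
      (∀ i, ∑ j, C (x j) * (d.universal.condition i (X ^ (j : ℕ))).map
        (d.basePoint : MvPolynomial (Fin M) ℂ[X] →+* ℂ) = 0) → x = 0 := by
    intro x hx
    simp only [point_condition, point_basePoint] at hx
    obtain ⟨h1, h2⟩ := (d.condition_eq_zero_iff _).1 hx
    by_contra hx0
    have hE := fun h => hx0 (sum_C_mul_X_pow_eq_zero h)
    exact hcon _ (d.natDegree_eq_of_indicial hd hE h2) h1
  obtain ⟨r, hr, hopen⟩ := exists_open_injective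
    (fun (i : Fin 3) (j : Fin (d.N + 1)) => d.universal.condition i (X ^ (j : ℕ))) d.basePoint hinj
  choose a ha0 hlow using d.obstruction_universal hd
  obtain ⟨φ, hφ, hφr, hφb⟩ := exists_generic_point
    (fun k => d.universal.obstruction (d.weight k) k) d.m (fun k => C (a k))
    (fun k => isUnit_C.2 (ha0 k).isUnit) hlow d.basePoint
    (fun k => (d.point_apparent_iff d.basePoint hd k).1 (by rw [point_basePoint]; exact ha k))
    r hr d.bad d.bad_countable
  obtain ⟨E, hE0, hE, hrem, hind⟩ := (d.point φ).exists_rem_indicial_eq_zero_of_generic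
    (d.point_distinct φ hd) (d.point_generic φ hφb)
    (fun k => (d.point_apparent_iff φ hd k).2 (hφ k)) hN
  change E.natDegree ≤ d.N at hE
  -- Injectivity persists at the generic point, contradicting the Euler polynomial found there.
  have hx := hopen φ hφr (fun j => E.coeff j) fun i => by
    rw [point_condition, sum_coeff_mul_X_pow hE]
    exact ((d.point φ).condition_eq_zero_iff E).2 ⟨hrem, hind⟩ i
  refine hE0 ?_
  rw [← sum_coeff_mul_X_pow hE]
  refine Finset.sum_eq_zero fun j _ => ?_
  have : E.coeff j = 0 := congrFun hx j
  rw [this, C_0, zero_mul]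

end Datum
/-! ### Analytic solutions -/

/-- Taylor's formula for analytic functions. -/
theorem exists_taylor {f : ℂ → ℂ} {t : ℂ} (hf : AnalyticAt ℂ f t) (n : ℕ) :
    ∃ (r : ℂ[X]) (g : ℂ → ℂ), AnalyticAt ℂ g t ∧
      ∀ᶠ z in 𝓝 t, f z - r.eval z = (z - t) ^ n * g z := by
  induction n with
  | zero => exact ⟨0, f, hf, by simp⟩
  | succ n ih =>
    obtain ⟨r, g, hg, h⟩ := ih
    have h1 : AnalyticAt ℂ (fun z => g z - g t) t := hg.sub analyticAt_const
    have h2 : ((1 : ℕ) : ℕ∞) ≤ analyticOrderAt (fun z => g z - g t) t := by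
      rw [Nat.cast_one, Order.one_le_iff_ne_zero, h1.analyticOrderAt_ne_zero, sub_self]
    obtain ⟨u, hu, h3⟩ := (natCast_le_analyticOrderAt h1).1 h2
    refine ⟨r + C (g t) * (X - C t) ^ n, u, hu, ?_⟩
    filter_upwards [h, h3] with z hz hz3
    simp only [pow_one, smul_eq_mul] at hz3
    simp only [eval_add, eval_mul, eval_C, eval_pow, eval_sub, eval_X]
    rw [← sub_sub, hz, pow_succ, mul_assoc, ← hz3]
    ring

theorem exists_deriv_eq {f g : ℂ → ℂ} {t : ℂ} {n : ℕ} (hg : AnalyticAt ℂ g t)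
    (h : ∀ᶠ z in 𝓝 t, f z = (z - t) ^ (n + 1) * g z) :
    ∃ u : ℂ → ℂ, AnalyticAt ℂ u t ∧ ∀ᶠ z in 𝓝 t, deriv f z = (z - t) ^ n * u z := by
  refine ⟨fun z => (n + 1) * g z + (z - t) * deriv g z, ?_, ?_⟩
  · have := hg.deriv
    fun_prop
  · filter_upwards [h.eventually_nhds, hg.eventually_analyticAt] with z hz hgz
    have h1 : HasDerivAt (fun z => (z - t) ^ (n + 1) * g z)
        (((n + 1 : ℕ) : ℂ) * (z - t) ^ n * 1 * g z + (z - t) ^ (n + 1) * deriv g z) z :=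
      (((hasDerivAt_id z).sub_const t).pow (n + 1)).mul hgz.differentiableAt.hasDerivAt
    rw [Filter.EventuallyEq.deriv_eq hz, h1.deriv]
    push_cast
    ring

theorem pow_dvd_of_eventually {f : ℂ[X]} {t : ℂ} {n : ℕ} {u : ℂ → ℂ} (hu : ContinuousAt u t)
    (h : ∀ᶠ z in 𝓝[≠] t, f.eval z = (z - t) ^ n * u z) : (X - C t) ^ n ∣ f := by
  by_cases h0 : f = 0
  · simp [h0]
  rw [← le_rootMultiplicity_iff h0]
  by_contra! hlt
  obtain ⟨g, hg, hgt⟩ := exists_eq_pow_rootMultiplicity_mul_and_not_dvd f h0 t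
  refine hgt (dvd_iff_isRoot.2 ?_)
  set k := f.rootMultiplicity t
  have h1 : ∀ᶠ z in 𝓝[≠] t, g.eval z = (z - t) ^ (n - k) * u z := by
    filter_upwards [h, self_mem_nhdsWithin] with z hz hzt
    rw [hg] at hz
    simp only [eval_mul, eval_pow, eval_sub, eval_X, eval_C] at hz
    refine mul_left_cancel₀ (pow_ne_zero k (sub_ne_zero.2 hzt)) ?_
    rw [hz, ← mul_assoc, ← pow_add, Nat.add_sub_cancel' hlt.le]
  have h2 : Tendsto (fun z => g.eval z) (𝓝[≠] t) (𝓝 (g.eval t)) :=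
    g.continuous.continuousAt.tendsto.mono_left nhdsWithin_le_nhds
  have h3 : Tendsto (fun z => (z - t) ^ (n - k) * u z) (𝓝[≠] t) (𝓝 ((t - t) ^ (n - k) * u t)) := by
    have : ContinuousAt (fun z => (z - t) ^ (n - k) * u z) t := by fun_prop
    exact this.tendsto.mono_left nhdsWithin_le_nhds
  have h4 := tendsto_nhds_unique h2 (h3.congr' (h1.mono fun z hz => hz.symm))
  rw [IsRoot.def, h4, sub_self, zero_pow (by omega), zero_mul]

/-- Evaluation of rational functions is multiplicative only where denominators do not vanish, which
holds on a punctured neighbourhood. -/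
theorem eventually_eval_mul (P : RatFunc ℂ) (p q : ℂ[X])
    (h : P * algebraMap ℂ[X] (RatFunc ℂ) q = algebraMap ℂ[X] (RatFunc ℂ) p) (t : ℂ) :
    ∀ᶠ z in 𝓝[≠] t, P.eval (RingHom.id ℂ) z * q.eval z = p.eval z := by
  have h1 : ∀ᶠ z in 𝓝[≠] t, P.denom.eval z ≠ 0 := by
    have hfin : (P.denom.roots.toFinset : Set ℂ).Finite := Finset.finite_toSet _
    have := (hfin.subset Set.sdiff_subset : ((P.denom.roots.toFinset : Set ℂ) \ {t}).Finite)
      |>.isClosed.isOpen_compl.mem_nhds (x := t) (by simp)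
    filter_upwards [nhdsWithin_le_nhds this, self_mem_nhdsWithin] with z hz hzt h0
    exact hz ⟨by simpa [P.denom_ne_zero] using h0, hzt⟩
  filter_upwards [h1] with z hz
  have h2 := congrArg (RatFunc.eval (RingHom.id ℂ) z) h
  rw [RatFunc.eval_mul _ _ (by simpa [eval₂_id] using hz) (by simp [RatFunc.denom_algebraMap])] at h2
  simpa using h2

namespace Datum

variable {M : ℕ}

theorem apparentAt_of_isApparentAt (d : Datum M ℂ) (k : Fin M)
    (h : IsApparentAt d.P d.Q (d.t k) (d.m k)) : d.ApparentAt k := by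
  obtain ⟨⟨f, hf, hft, hsol⟩, -⟩ := h
  set t := d.t k
  -- Two derivatives lower the order of the Taylor remainder by two, leaving the required `m_k + 1`.
  obtain ⟨r, g, hg, h0⟩ := exists_taylor hf (d.m k + 3)
  set f₀ : ℂ → ℂ := fun z => f z - r.eval z with hf₀
  obtain ⟨g₁, hg₁, h1⟩ := exists_deriv_eq (f := f₀) hg h0
  obtain ⟨g₂, hg₂, h2⟩ := exists_deriv_eq hg₁ h1
  have hd1 : ∀ᶠ z in 𝓝 t, deriv f z = deriv f₀ z + (derivative r).eval z := by
    filter_upwards [hf.eventually_analyticAt] with z hz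
    rw [hf₀, deriv_fun_sub hz.differentiableAt r.differentiableAt, Polynomial.deriv]
    ring
  have hd2 : ∀ᶠ z in 𝓝 t,
      deriv (deriv f) z = deriv (deriv f₀) z + (derivative (derivative r)).eval z := by
    have hf₀a : AnalyticAt ℂ f₀ t := hf.sub (r.differentiable.analyticAt t)
    filter_upwards [hd1.eventually_nhds, hf₀a.deriv.eventually_analyticAt] with z hz hza
    rw [Filter.EventuallyEq.deriv_eq hz, deriv_fun_add hza.differentiableAt
      (derivative r).differentiableAt, Polynomial.deriv]
  refine ⟨r, ?_, ?_⟩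
  · have := h0.self_of_nhds
    rw [sub_self, zero_pow (by omega), zero_mul, sub_eq_zero] at this
    rwa [← this]
  · refine pow_dvd_of_eventually (u := fun z => -(d.q.eval z * g₂ z + d.p.eval z * ((z - t) * g₁ z)
      + d.S.eval z * ((z - t) ^ 2 * g z))) ?_ ?_
    · have := hg.continuousAt
      have := hg₁.continuousAt
      have := hg₂.continuousAt
      fun_prop
    · have hq := d.q_ne_zero
      have e1 := eventually_eval_mul d.P d.p d.q (by rw [P]; field_simp) t
      have e2 := eventually_eval_mul d.Q d.S d.q (by rw [Q]; field_simp) t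
      filter_upwards [hsol, e1, e2, nhdsWithin_le_nhds h0, nhdsWithin_le_nhds h1,
        nhdsWithin_le_nhds h2, nhdsWithin_le_nhds hd1, nhdsWithin_le_nhds hd2]
        with z hz a1 a2 b0 b1 b2 c1 c2
      have b0' : f z = (z - t) ^ (d.m k + 3) * g z + r.eval z := by rw [← b0]; ring
      rw [c1, c2, b1, b2, b0'] at hz
      simp only [eval_add, eval_mul]
      rw [← a1, ← a2]
      linear_combination d.q.eval z * hz

/-! ### Division of the hypergeometric operator -/

theorem prod_eulerPair (d : Datum M ℂ) (l : List ℂ) :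
    (l.map fun c => eulerPair d.P d.Q c).prod = aeval d.θ (l.map fun c => X + C c).prod := by
  induction l with
  | nil => simp
  | cons c l ih =>
    rw [List.map_cons, List.prod_cons, ih, List.map_cons, List.prod_cons, map_mul]
    congr 1
    rw [map_add, aeval_X, aeval_C]
    refine LinearMap.ext fun w => ?_
    ext <;> simp [eulerPair, θ, Module.algebraMap_end_apply, RatFunc.smul_eq_C_mul]

theorem exists_eq_prod_X_add_C {E : ℂ[X]} {n : ℕ} (hE : E.Monic) (hn : E.natDegree = n) :
    ∃ e : Fin n → ℂ, E = ((List.ofFn e).map fun c => X + C c).prod := by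
  have h1 := (IsAlgClosed.splits E).eq_prod_roots_of_monic hE
  have h2 : E.roots.toList.length = n := by
    rw [Multiset.length_toList, ← (IsAlgClosed.splits E).natDegree_eq_card_roots, hn]
  refine ⟨fun i => -E.roots.toList.get (Fin.cast h2.symm i), ?_⟩
  have h3 : List.ofFn (fun i : Fin n => -E.roots.toList.get (Fin.cast h2.symm i))
      = E.roots.toList.map fun r => -r := by
    subst h2
    refine List.ext_getElem (by simp) fun i _ _ => by simp
  rw [h3, List.map_map, ← Multiset.prod_coe, ← Multiset.map_coe, Multiset.coe_toList]
  conv_lhs => rw [h1]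
  simp [sub_eq_add_neg]

theorem comp_prod_X_add_C (l : List ℂ) (a : ℂ) :
    ((l.map fun c => X + C c).prod).comp (X + C a) = ((l.map fun c => c + a).map fun c => X + C c).prod := by
  induction l with
  | nil => simp
  | cons c l ih =>
    simp only [List.map_cons, List.prod_cons, mul_comp, ih, add_comp, X_comp, C_comp, C_add]
    ring

theorem exists_ghgOp_eq (d : Datum M ℂ) (hd : d.Distinct) (ha : ∀ k, d.ApparentAt k) {n : ℕ}
    (hN : d.N = n + 1) : ∃ (e : Fin (n + 1) → ℂ) (D : Module.End ℂ (RatFunc ℂ)),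
      IsDiffOpOfOrder (n + 1) D ∧
      ghgOp (d.α :: d.β :: List.ofFn fun i => e i + 1) (d.γ :: List.ofFn e) =
        D * secondOrderOp d.P d.Q := by
  obtain ⟨E₀, hE₀, hrem₀⟩ := d.exists_rem_eq_zero hd ha hN
  have h0 : E₀ ≠ 0 := fun h => by rw [h, natDegree_zero] at hE₀; omega
  set E := C E₀.leadingCoeff⁻¹ * E₀ with hE
  have hl : E₀.leadingCoeff ≠ 0 := leadingCoeff_ne_zero.2 h0
  have hEm : E.Monic := by
    rw [hE, Monic, leadingCoeff_mul, leadingCoeff_C, inv_mul_cancel₀ hl]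
  have hEd : E.natDegree = n + 1 := by
    rw [hE, natDegree_C_mul (inv_ne_zero hl), hE₀, hN]
  have hrem : d.rem E = 0 := by
    have h1 : ∀ i : Fin 3, i ≠ 2 → d.condition i E = 0 := by
      intro i hi
      rw [hE, condition_C_mul]
      have : d.condition i E₀ = 0 := by
        fin_cases i
        · exact congrArg Prod.fst hrem₀
        · exact congrArg Prod.snd hrem₀
        · exact absurd rfl hi
      rw [this, mul_zero]
    exact Prod.ext (h1 0 (by decide)) (h1 1 (by decide))
  obtain ⟨e, he⟩ := exists_eq_prod_X_add_C hEm hEd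
  have hmain := (d.rem_eq_zero_iff (by rw [hEd, hN])).1 hrem
  obtain ⟨D, hD, hDe⟩ := exists_ghgOp_eq_mul d.P d.Q n
    (d.α :: d.β :: List.ofFn fun i => e i + 1) (d.γ :: List.ofFn e) (by simp) (by simp) (by
      have ha' : ((d.α :: d.β :: List.ofFn fun i => e i + 1).map fun c => X + C c).prod
          = d.H₂ * E.comp (X + 1) := by
        rw [he, ← C_1, comp_prod_X_add_C, List.map_ofFn]
        simp [H₂, mul_assoc, Function.comp_def]
      have hb' : (((d.γ :: List.ofFn e).map fun c => c - 1).map fun c => X + C c).prod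
          = (X + C (d.γ - 1)) * E.comp (X - 1) := by
        rw [he, show (X - 1 : ℂ[X]) = X + C (-1) by simp [sub_eq_add_neg], comp_prod_X_add_C,
          List.map_ofFn]
        simp [Function.comp_def, sub_eq_add_neg]
      have hb'' : ((d.γ :: List.ofFn e).map fun c => eulerPair d.P d.Q (c - 1)).prod
          = aeval d.θ ((X + C (d.γ - 1)) * E.comp (X - 1)) := by
        rw [← hb', ← prod_eulerPair, List.map_map]
        rfl
      rw [ghgPair, hb'', prod_eulerPair, ha', LinearMap.sub_apply, sub_eq_zero,
        Module.End.mul_apply]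
      -- The factor `X` of `H₁` acts as `z d/dz`; cancelling `z` on both sides leaves the `d/dz` of
      -- the hypergeometric operator.
      rw [H₁, mul_assoc, map_mul, aeval_X, Module.End.mul_apply, θ_apply] at hmain
      exact smul_right_injective _ (RatFunc.X_ne_zero (K := ℂ)) hmain)
  exact ⟨e, D, hD, hDe⟩

theorem coeffP_eq (d : Datum M ℂ) (δ : ℂ) (hδ : d.δ = δ) : coeffP d.γ δ d.m d.t = d.P := by
  have hX : (RatFunc.X : RatFunc ℂ) ≠ 0 := RatFunc.X_ne_zero
  have hX1 := X_sub_one_ne_zero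
  have hT : algebraMap ℂ[X] (RatFunc ℂ) d.T ≠ 0 := RatFunc.algebraMap_ne_zero d.T_monic.ne_zero
  have h1 : ∑ k, (d.m k : RatFunc ℂ) / (RatFunc.X - RatFunc.C (d.t k))
      = algebraMap ℂ[X] (RatFunc ℂ) d.mT / algebraMap ℂ[X] (RatFunc ℂ) d.T := by
    rw [mT, map_sum, Finset.sum_div]
    refine Finset.sum_congr rfl fun k _ => ?_
    have h2 : algebraMap ℂ[X] (RatFunc ℂ) (X - C (d.t k)) ≠ 0 :=
      RatFunc.algebraMap_ne_zero (X_sub_C_ne_zero _)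
    have h3 : algebraMap ℂ[X] (RatFunc ℂ) (d.Tk k) ≠ 0 :=
      RatFunc.algebraMap_ne_zero (d.Tk_monic k).ne_zero
    rw [← d.X_sub_mul_Tk k, map_mul, map_mul, mul_div_mul_right _ _ h3]
    simp
  rw [coeffP, h1, P, p, q, hδ]
  simp only [map_sub, map_add, map_mul, RatFunc.algebraMap_X, RatFunc.algebraMap_C, map_one]
  field_simp

theorem coeffQ_eq (d : Datum M ℂ) (s : Fin (M + 1) → ℂ)
    (hs : d.S = ∑ i : Fin (M + 1), C (s i) * X ^ (i : ℕ)) : coeffQ s d.t = d.Q := by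
  rw [coeffQ, Q, hs, q, T]
  simp [map_sum, map_prod]

end Datum

/-! ### Passage from the coefficients `γ, δ, s_i` to the parameters -/

/-- Every Fuchsian equation with apparent singularities divides a hypergeometric one. -/
theorem exists_ghgOp_eq_mul_secondOrderOp (M : ℕ) (m : Fin M → ℕ) (n : ℕ) (hn : ∑ k, m k = n + 1)
    (t : Fin M → ℂ) (ht : Function.Injective t) (ht0 : ∀ k, t k ≠ 0) (ht1 : ∀ k, t k ≠ 1)
    (γ δ : ℂ) (s : Fin (M + 1) → ℂ)
    (happ : ∀ k, IsApparentAt (coeffP γ δ m t) (coeffQ s t) (t k) (m k)) :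
    ∃ (α β : ℂ) (e : Fin (n + 1) → ℂ) (D : Module.End ℂ (RatFunc ℂ)),
      s (Fin.last M) = α * β ∧ δ = α + β - γ + ((n + 1 : ℕ) : ℂ) + 1 ∧
      IsDiffOpOfOrder (n + 1) D ∧
      ghgOp (α :: β :: List.ofFn fun i => e i + 1) (γ :: List.ofFn e) =
        D * secondOrderOp (coeffP γ δ m t) (coeffQ s t) := by
  obtain ⟨α, β, hs, hδ⟩ : ∃ α β : ℂ, s (Fin.last M) = α * β ∧
      δ = α + β - γ + ((n + 1 : ℕ) : ℂ) + 1 := by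
    set a := δ + γ - ((n + 1 : ℕ) : ℂ) - 1 with ha
    -- The numbers `α`, `β` are the roots of `x² - a x + s_M`, and `r` is a square root of the
    -- discriminant.
    obtain ⟨r, hr⟩ := IsAlgClosed.exists_eq_mul_self (a ^ 2 - 4 * s (Fin.last M))
    refine ⟨(a + r) / 2, (a - r) / 2, ?_, by rw [ha]; ring⟩
    linear_combination -hr / 4
  set S₀ : ℂ[X] := ∑ i : Fin (M + 1), C (s i) * X ^ (i : ℕ) with hS₀
  let d₀ : Datum M ℂ := ⟨t, m, α, β, γ, 0⟩
  -- The accessory parameters are the Lagrange interpolation coefficients of the numerator at the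
  -- `t_k`; together with the top coefficient `αβ` they determine it.
  let d : Datum M ℂ := ⟨t, m, α, β, γ, fun k => S₀.eval (t k) / (d₀.Tk k).eval (t k)⟩
  have hd : d.Distinct := ⟨ht, ht0, ht1⟩
  have hN : d.N = n + 1 := hn
  have hdδ : d.δ = δ := by rw [Datum.δ, hN]; exact hδ.symm
  have hS₀d : S₀.natDegree ≤ M := natDegree_sum_le_of_forall_le _ _ fun i _ =>
    (natDegree_C_mul_X_pow_le _ _).trans (by omega)
  have hS₀c : S₀.coeff M = s (Fin.last M) := by
    rw [hS₀, finsetSum_coeff, Finset.sum_eq_single (Fin.last M)]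
    · simp
    · intro i _ hi
      rw [coeff_C_mul, coeff_X_pow, if_neg (fun h => hi (Fin.ext h.symm)), mul_zero]
    · simp
  have hdS : d.S = S₀ := by
    rw [← sub_eq_zero]
    refine eq_zero_of_degree_lt_of_eval_index_eq_zero (v := t) Finset.univ ht.injOn ?_ fun k _ => ?_
    · rw [Finset.card_univ, Fintype.card_fin]
      refine degree_lt_iff_coeff_zero _ _ |>.2 fun i hi => ?_
      rcases hi.eq_or_lt with rfl | hi
      · rw [coeff_sub, hS₀c, hs, Datum.S_coeff, sub_self]
      · rw [coeff_sub, coeff_eq_zero_of_natDegree_lt (d.S_natDegree.trans_lt hi),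
          coeff_eq_zero_of_natDegree_lt (hS₀d.trans_lt hi), sub_zero]
    · have hT : d.T.eval (d.t k) = 0 := by rw [← d.X_sub_mul_Tk k]; simp
      have h1 : d.S.eval (d.t k) = S₀.eval (t k) := by
        rw [Datum.S, eval_add, eval_mul, hT, mul_zero, zero_add, eval_finsetSum,
          Finset.sum_eq_single k]
        · rw [eval_mul, eval_C]
          exact div_mul_cancel₀ _ (d.Tk_eval_ne_zero hd k)
        · intro j _ hj
          rw [eval_mul, d.Tk_eval_of_ne hj.symm, mul_zero]
        · simp
      rw [eval_sub, sub_eq_zero]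
      exact h1
  have hP : coeffP γ δ m t = d.P := d.coeffP_eq δ hdδ
  have hQ : coeffQ s t = d.Q := d.coeffQ_eq s hdS
  rw [hP, hQ] at happ ⊢
  obtain ⟨e, D, hD, h⟩ := d.exists_ghgOp_eq hd
    (fun k => d.apparentAt_of_isApparentAt k (happ k)) hN
  exact ⟨α, β, e, D, hs, hδ, hD, h⟩

end Fuchsian
end

theorem mainTheorem1 (M : ℕ) (m : Fin M → ℕ) (hm : ∀ k, 1 ≤ m k)
    (hcase : (M = 1 ∧ ∑ k, m k ≤ 5) ∨ (M = 2 ∧ ∑ k, m k ≤ 4) ∨ (M = 3 ∧ ∀ k, m k = 1))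
    (t : Fin M → ℂ) (ht : Function.Injective t) (ht0 : ∀ k, t k ≠ 0) (ht1 : ∀ k, t k ≠ 1)
    (γ δ : ℂ) (s : Fin (M + 1) → ℂ)
    (happ : ∀ k, Fuchsian.IsApparentAt (Fuchsian.coeffP γ δ m t) (Fuchsian.coeffQ s t)
      (t k) (m k)) :
    ∃ (α β : ℂ) (e : Fin (∑ k, m k) → ℂ) (D : Module.End ℂ (RatFunc ℂ)),
      s (Fin.last M) = α * β ∧
      δ = α + β - γ + ((∑ k, m k : ℕ) : ℂ) + 1 ∧
      Fuchsian.IsDiffOpOfOrder (∑ k, m k) D ∧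
      Fuchsian.ghgOp (α :: β :: List.ofFn fun i => e i + 1) (γ :: List.ofFn e) =
        D * Fuchsian.secondOrderOp (Fuchsian.coeffP γ δ m t) (Fuchsian.coeffQ s t) := by
  have hN : 1 ≤ ∑ k, m k := by
    have hM : 0 < M := by omega
    exact (hm ⟨0, hM⟩).trans (Finset.single_le_sum (fun _ _ => Nat.zero_le _) (Finset.mem_univ _))
  obtain ⟨n, hn⟩ := Nat.exists_eq_add_of_le' hN
  obtain ⟨α, β, e, D, hs, hδ, hD, h⟩ := Fuchsian.exists_ghgOp_eq_mul_secondOrderOp M m n hn t ht ht0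
    ht1 γ δ s happ
  rw [hn]
  exact ⟨α, β, e, D, hs, hδ, hD, h⟩
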